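/- Let $d,m\ge 1$ be integers, $p>1$, let $\Omega\subset\mathbb R^d$ be a bounded open set with Lipschitz boundary and let $A\subseteq\Omega$ be an open set with Lipschitz boundary. For $\varepsilon>0$ let $f_\varepsilon:\Omega\times\mathbb R^d\times\mathbb R^m\to[0,+\infty)$ be Borel functions, and assume that there are constants $r_0,c_0>0$ and measurable functions $\rho_\varepsilon:B_{r_0}\to[0,+\infty)$, $\psi_\varepsilon:\mathbb R^d\to[0,+\infty)$ with $$\limsup_{\varepsilon\to0}\int_{B_{r_0}}\rho_\varepsilon\,d\xi<+\infty,\qquad \limsup_{\varepsilon\to0}\int_{\mathbb R^d}\psi_\varepsilon(\xi)(|\xi|^p+1)\,d\xi<+\infty,$$ such that, for all $\varepsilon>0$, $x\in\Omega$, $z\in\mathbb R^m$: (H0) $c_0(|z|^p-\rho_\varepsilon(\xi))\le f_\varepsilon(x,\xi,z)$ for all $\xi\in B_{r_0}$; (H1) $f_\varepsilon(x,\xi,z)\le\psi_\varepsilon(\xi)(|z|^p+1)$ for all $\xi\in\mathbb R^d$; (H2) for every $\delta>0$ there is $r_\delta>0$ with $\limsup_{\varepsilon\to0}\int_{B_{r_\delta}^c}\psi_\varepsilon(\xi)|\xi|^p\,d\xi<\delta$.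 For $u\in L^p(\Omega;\mathbb R^m)$ set $$F_\varepsilon(u,A)=\int_{\mathbb R^d}\int_{\{x\in A\,:\,x+\varepsilon\xi\in A\}}f_\varepsilon\Big(x,\xi,\frac{u(x+\varepsilon\xi)-u(x)}{\varepsilon}\Big)dx\,d\xi\in[0,+\infty].$$ Let $\varepsilon_j>0$, $\varepsilon_j\to0$, and let $f_0:\Omega\times\mathbb R^{m\times d}\to[0,+\infty)$ be such that, with respect to the strong topology of $L^p(\Omega;\mathbb R^m)$, the functionals $F_{\varepsilon_j}(\cdot,A)$ $\Gamma$-converge to $$F(u,A)=\begin{cases}\displaystyle\int_A f_0(x,Du(x))\,dx&\text{if }u\in W^{1,p}(A;\mathbb R^m),\\+\infty&\text{otherwise.}\end{cases}$$ Let $g\in W^{1,p}_{\rm loc}(\mathbb R^d;\mathbb R^m)$ and $r>0$. For $s>0$ let $$\mathcal D^{s,g}(A)=\{u\in L^p(\Omega;\mathbb R^m):u(x)=g(x)\text{ for a.e. }x\in\Omega\text{ with }\operatorname{dist}(x,\mathbb R^d\setminus A)<s\}$$ and let $\mathcal A^g$ be the set of $u\in L^p(\Omega;\mathbb R^m)$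 with $u-g\in W^{1,p}_0(A;\mathbb R^m)$, where functions in $W^{1,p}_0(A;\mathbb R^m)$ are extended by $0$ outside $A$ (so $u=g$ a.e. on $\Omega\setminus A$). Then the minimum of $F(\cdot,A)$ on $\mathcal A^g$ exists and $$\lim_{j\to\infty}\inf\{F_{\varepsilon_j}(u,A):u\in\mathcal D^{\varepsilon_jr,g}(A)\}=\min\{F(u,A):u\in\mathcal A^g\}.$$ Moreover, if $u_j\in\mathcal D^{\varepsilon_jr,g}(A)$ converge in $L^p(\Omega;\mathbb R^m)$ to $u$ and $$\lim_{j\to\infty}F_{\varepsilon_j}(u_j,A)=\lim_{j\to\infty}\inf\{F_{\varepsilon_j}(v,A):v\in\mathcal D^{\varepsilon_jr,g}(A)\},$$ then $u\in\mathcal A^g$ and $u$ minimizes $F(\cdot,A)$ on $\mathcal A^g$. -/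

import Mathlib

open Set Filter Topology MeasureTheory
open scoped NNReal ENNReal ContDiff

namespace NonlocalGamma

/-- `ℝ^n` with the Euclidean norm. -/
abbrev Euc (n : ℕ) : Type := EuclideanSpace ℝ (Fin n)

/-- `A` has Lipschitz boundary: near each boundary point, and in suitable orthogonal coordinates
(the last axis being spanned by the unit vector `ν`), `A` is the strict epigraph of a Lipschitz
function `γ` of the remaining coordinates. -/
def LipschitzBoundary {d : ℕ} (A : Set (Euc d)) : Prop :=
  ∀ x₀ ∈ frontier A, ∃ r > (0 : ℝ), ∃ ν : Euc d, ‖ν‖ = 1 ∧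
    ∃ (K : ℝ≥0) (γ : Euc d → ℝ), LipschitzWith K γ ∧
      ∀ x ∈ Metric.ball x₀ r, (x ∈ A ↔ γ (x - inner ℝ ν x • ν) < inner ℝ ν x)

/-! ### Sobolev spaces -/

/-- `u ∈ L^p(A; ℝ^m)` and `V ∈ L^p(A; ℝ^{m×d})` is a weak gradient of `u` on the open set `A`.
A matrix is read as the linear map `ℝ^d → ℝ^m` it represents. -/
structure IsWeakGrad {d m : ℕ} (A : Set (Euc d)) (p : ℝ) (u : Euc d → Euc m)
    (V : Euc d → (Euc d →L[ℝ] Euc m)) : Prop where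
  memLp : MemLp u (ENNReal.ofReal p) (volume.restrict A)
  memLp_grad : MemLp V (ENNReal.ofReal p) (volume.restrict A)
  integral_eq : ∀ φ : Euc d → ℝ, ContDiff ℝ ∞ φ → HasCompactSupport φ → tsupport φ ⊆ A →
    ∀ v : Euc d, ∫ x in A, (fderiv ℝ φ x v) • u x = - ∫ x in A, φ x • V x v

/-- `u ∈ W^{1,p}(A; ℝ^m)`. -/
def MemW {d m : ℕ} (A : Set (Euc d)) (p : ℝ) (u : Euc d → Euc m) : Prop :=
  ∃ V, IsWeakGrad A p u V

open Classical in
/-- The weak gradient `Du` on `A` of a function `u ∈ W^{1,p}(A; ℝ^m)` (unique almost everywhere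
on `A`). -/
noncomputable def weakGrad {d m : ℕ} (A : Set (Euc d)) (p : ℝ) (u : Euc d → Euc m) :
    Euc d → (Euc d →L[ℝ] Euc m) :=
  if h : MemW A p u then h.choose else 0

/-- `w ∈ W^{1,p}_0(A; ℝ^m)`: the closure of `C_c^∞(A; ℝ^m)` in `W^{1,p}(A; ℝ^m)`. -/
def MemWZero {d m : ℕ} (A : Set (Euc d)) (p : ℝ) (w : Euc d → Euc m) : Prop :=
  MemW A p w ∧ ∃ φ : ℕ → Euc d → Euc m,
    (∀ n, ContDiff ℝ ∞ (φ n) ∧ HasCompactSupport (φ n) ∧ tsupport (φ n) ⊆ A) ∧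
    Tendsto (fun n => eLpNorm (fun x => φ n x - w x) (ENNReal.ofReal p) (volume.restrict A))
      atTop (𝓝 0) ∧
    Tendsto (fun n => eLpNorm (fun x => fderiv ℝ (φ n) x - weakGrad A p w x)
      (ENNReal.ofReal p) (volume.restrict A)) atTop (𝓝 0)

/-- `g ∈ W^{1,p}_loc(ℝ^d; ℝ^m)`. -/
def MemWLoc {d m : ℕ} (p : ℝ) (g : Euc d → Euc m) : Prop :=
  ∀ U : Set (Euc d), IsOpen U → Bornology.IsBounded U → MemW U p g

/-! ### The energies -/

/-- The localized functional
`F_ε(u, A) = ∫_{ℝ^d} ∫_{A_ε(ξ)} f_ε(x, ξ, (u(x + εξ) - u(x)) / ε) dx dξ`,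
where `A_ε(ξ) = {x ∈ A | x + εξ ∈ A}`. -/
noncomputable def energy {d m : ℕ} (f : ℝ → Euc d → Euc d → Euc m → ℝ≥0) (ε : ℝ)
    (u : Euc d → Euc m) (A : Set (Euc d)) : ℝ≥0∞ :=
  ∫⁻ ξ : Euc d, ∫⁻ x in {x | x ∈ A ∧ x + ε • ξ ∈ A},
    (f ε x ξ (ε⁻¹ • (u (x + ε • ξ) - u x)) : ℝ≥0∞)

/-- The family `f_ε` consists of Borel functions and satisfies the growth and locality assumptions
(H0), (H1), (H2), with constants `r₀, c₀ > 0` and kernels `ρ_ε`, `ψ_ε`. -/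
def GrowthAssumptions {d m : ℕ} (Ω : Set (Euc d)) (p : ℝ)
    (f : ℝ → Euc d → Euc d → Euc m → ℝ≥0) : Prop :=
  (∀ ε > 0, Measurable (fun q : Euc d × Euc d × Euc m => f ε q.1 q.2.1 q.2.2)) ∧
  ∃ r₀ > (0 : ℝ), ∃ c₀ > (0 : ℝ), ∃ ρ ψ : ℝ → Euc d → ℝ≥0,
    (∀ ε > 0, Measurable (ρ ε)) ∧ (∀ ε > 0, Measurable (ψ ε)) ∧
    limsup (fun ε => ∫⁻ ξ in Metric.ball (0 : Euc d) r₀, (ρ ε ξ : ℝ≥0∞)) (𝓝[>] (0 : ℝ)) < ⊤ ∧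
    limsup (fun ε => ∫⁻ ξ : Euc d, (ψ ε ξ : ℝ≥0∞) * ENNReal.ofReal (‖ξ‖ ^ p + 1))
      (𝓝[>] (0 : ℝ)) < ⊤ ∧
    -- (H0)
    (∀ ε > 0, ∀ x ∈ Ω, ∀ ξ ∈ Metric.ball (0 : Euc d) r₀, ∀ z : Euc m,
      c₀ * (‖z‖ ^ p - ρ ε ξ) ≤ f ε x ξ z) ∧
    -- (H1)
    (∀ ε > 0, ∀ x ∈ Ω, ∀ ξ : Euc d, ∀ z : Euc m, (f ε x ξ z : ℝ) ≤ ψ ε ξ * (‖z‖ ^ p + 1)) ∧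
    -- (H2)
    (∀ δ > (0 : ℝ), ∃ rδ > (0 : ℝ),
      limsup (fun ε => ∫⁻ ξ in (Metric.ball (0 : Euc d) rδ)ᶜ,
        (ψ ε ξ : ℝ≥0∞) * ENNReal.ofReal (‖ξ‖ ^ p)) (𝓝[>] (0 : ℝ)) < ENNReal.ofReal δ)

open Classical in
/-- The functional `F(u, A) = ∫_A f₀(x, Du(x)) dx` if `u ∈ W^{1,p}(A; ℝ^m)`, and `+∞`
otherwise. -/
noncomputable def limitEnergy {d m : ℕ} (f₀ : Euc d → (Euc d →L[ℝ] Euc m) → ℝ≥0) (p : ℝ)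
    (u : Euc d → Euc m) (A : Set (Euc d)) : ℝ≥0∞ :=
  if MemW A p u then ∫⁻ x in A, (f₀ x (weakGrad A p u x) : ℝ≥0∞) else ⊤

/-- Convergence `u_j → u` in `L^p(Ω; ℝ^m)`; all the functions are required to be in `L^p`. -/
def TendstoLp {d m : ℕ} (Ω : Set (Euc d)) (p : ℝ) (u : ℕ → Euc d → Euc m)
    (u₀ : Euc d → Euc m) : Prop :=
  (∀ j, MemLp (u j) (ENNReal.ofReal p) (volume.restrict Ω)) ∧
  MemLp u₀ (ENNReal.ofReal p) (volume.restrict Ω) ∧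
  Tendsto (fun j => eLpNorm (fun x => u j x - u₀ x) (ENNReal.ofReal p) (volume.restrict Ω))
    atTop (𝓝 0)

/-- `Φ_j` `Γ`-converges to `Φ` with respect to the strong topology of `L^p(Ω; ℝ^m)`. -/
def GammaTendstoLp {d m : ℕ} (Ω : Set (Euc d)) (p : ℝ) (Φ : ℕ → (Euc d → Euc m) → ℝ≥0∞)
    (Φ₀ : (Euc d → Euc m) → ℝ≥0∞) : Prop :=
  ∀ u₀ : Euc d → Euc m, MemLp u₀ (ENNReal.ofReal p) (volume.restrict Ω) →
    (∀ u : ℕ → Euc d → Euc m, TendstoLp Ω p u u₀ →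
      Φ₀ u₀ ≤ liminf (fun j => Φ j (u j)) atTop) ∧
    ∃ u : ℕ → Euc d → Euc m, TendstoLp Ω p u u₀ ∧
      limsup (fun j => Φ j (u j)) atTop ≤ Φ₀ u₀

/-! ### Dirichlet data -/

/-- `𝒟^{r,g}(A)`: the functions `u ∈ L^p(Ω; ℝ^m)` equal to `g` at almost every point of `Ω` whose
distance from the complement of `A` is less than `r`, that is, on `Ω \ A` and on the
`r`-neighbourhood of `∂A`. -/
def dirichletClass {d m : ℕ} (Ω : Set (Euc d)) (p r : ℝ) (g : Euc d → Euc m)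
    (A : Set (Euc d)) : Set (Euc d → Euc m) :=
  {u | MemLp u (ENNReal.ofReal p) (volume.restrict Ω) ∧
    ∀ᵐ x : Euc d, x ∈ Ω → Metric.infDist x Aᶜ < r → u x = g x}

/-- The functions `u ∈ L^p(Ω; ℝ^m)` with `u - g ∈ W^{1,p}_0(A; ℝ^m)`, where functions in
`W^{1,p}_0(A; ℝ^m)` are extended by `0` to `Ω \ A`. -/
def admissible {d m : ℕ} (Ω : Set (Euc d)) (p : ℝ) (g : Euc d → Euc m)
    (A : Set (Euc d)) : Set (Euc d → Euc m) :=
  {u | MemLp u (ENNReal.ofReal p) (volume.restrict Ω) ∧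
    MemWZero A p (fun x => u x - g x) ∧ ∀ᵐ x : Euc d, x ∈ Ω \ A → u x = g x}

end NonlocalGamma

set_option linter.unusedSectionVars false

/-! The argument is the direct method: compactness in the Dirichlet classes, the Γ-liminf inequality
along subsequences, and the modification of recovery sequences near the boundary at negligible cost.

Compactness (`exists_isTest_of_energy_le`, `exists_subseq_tendstoLp_of_energy_le`). By (H0), bounded
energy bounds the `L^p` norms of the difference quotients with `|ξ| ≤ r₁`, for any `r₁ < r₀`. If `u
= g` within distance `εr` of the complement of `A` and `r₁ < r`, then `w = u - g`, extended by zero,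
satisfies the same kind of bound on the whole space, since steps of length at most `εr₁` crossing
the boundary only meet zeros of `w`. Mollifying `w` at scale `ε` gives a test function `v` on `A`
with `∫ |Dv|^p` bounded and `∫ |v - w|^p = O(ε^p)`. Rellich's theorem applies to such `v`, and the
limit lies in `W^{1,p}_0(A)`. This last point is proved without weak topologies: near-minimizers of
a gradient norm over the convex hulls of the tails have Cauchy gradients, by uniform convexity
(`exists_convexHull_cauchy`).

Upper bound (`limsup_iInf_energy_le`). Let `u` be admissible, `u_j` a recovery sequence for `u`, and
`φ_n` test functions converging to `u - g` in `W^{1,p}(A)`. For a cut-off `θ` vanishing near the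
boundary, `θ u_j + (1 - θ)(g + φ_n)` is in the Dirichlet class when `j` is large. Its excess energy
has four sources. The energy of `g + φ_n` in the boundary layer is small because the layer is thin.
The slope of `θ` multiplies `u_j - g - φ_n`, which is small in `L^p`. Interactions longer than `s/ε`
are small by (H2). Finally, the difference quotients of `u_j` in the transition layer of `θ` are not
small, but among `N` disjoint transition layers the average cost is `1/N` of the total, as in De
Giorgi's slicing argument.

For the total to be finite, quotients of `u_j` at every `ξ` must be controlled, whereas (H0) sees
only small `ξ`. The remedy is `exists_shiftInt_le_quotEnergy`: on the whole space, mollification at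
scale `ε` bounds the quotient at `ξ` by `C(|ξ|^p + 1)` times the short-range energy. It is applied
to `u_j` multiplied by a function that vanishes near the boundary of `A` and equals one on all the
transition layers.

Conclusion (`convergence_of_minima`). Near-minimizers along a subsequence realizing the liminf of
the infima converge to an admissible function whose limit energy is at most that liminf. The upper
bound shows that the limsup is at most the limit energy of every admissible function. Hence the
infima converge and the limit is a minimum. -/

namespace NonlocalGamma

/-! ### Convexity inequalities for p-th powers -/

/-- Jensen's inequality for a finite weight `k`. -/
theorem lintegral_mul_rpow_le {α : Type*} [MeasurableSpace α] {μ : Measure α} {p : ℝ} (hp : 1 < p)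
    {k F : α → ℝ≥0∞} (hk : Measurable k) (hF : Measurable F) :
    (∫⁻ a, k a * F a ∂μ) ^ p ≤ (∫⁻ a, k a ∂μ) ^ (p - 1) * ∫⁻ a, k a * F a ^ p ∂μ := by
  have hpq : p.HolderConjugate (p / (p - 1)) := Real.HolderConjugate.conjExponent hp
  have hp0 : 0 < p := by linarith
  set q := p / (p - 1) with hq
  have hq0 : 0 < q := hpq.symm.pos
  have hpq1 : 1 / q + 1 / p = 1 := by
    have := hpq.inv_add_inv_eq_one; simp only [one_div]; linarith
  have h1 : ∀ a, k a * F a = (k a ^ (1 / q)) * (k a ^ (1 / p) * F a) := by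
    intro a
    rw [← mul_assoc, ← ENNReal.rpow_add_of_nonneg _ _ (by positivity) (by positivity), hpq1,
      ENNReal.rpow_one]
  have h2 := ENNReal.lintegral_mul_le_Lp_mul_Lq μ hpq.symm (hk.pow_const (1 / q)).aemeasurable
    ((hk.pow_const (1 / p)).mul hF).aemeasurable
  simp only [Pi.mul_apply, ← h1] at h2
  calc (∫⁻ a, k a * F a ∂μ) ^ p ≤ _ := ENNReal.rpow_le_rpow h2 hp0.le
    _ = _ := by
      rw [ENNReal.mul_rpow_of_nonneg _ _ hp0.le, ← ENNReal.rpow_mul, ← ENNReal.rpow_mul,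
        one_div_mul_cancel hp0.ne', ENNReal.rpow_one]
      congr 2
      · simp only [← ENNReal.rpow_mul, one_div_mul_cancel hq0.ne', ENNReal.rpow_one]
      · rw [hq]; field_simp
      · ext a
        rw [ENNReal.mul_rpow_of_nonneg _ _ hp0.le, ← ENNReal.rpow_mul,
          one_div_mul_cancel hp0.ne', ENNReal.rpow_one]

/-- `(a + b) ^ p ≤ 2 ^ p (a ^ p + b ^ p)`. -/
theorem add_rpow_le_two {p : ℝ} (hp : 1 < p) (a b : ℝ≥0∞) :
    (a + b) ^ p ≤ 2 ^ p * (a ^ p + b ^ p) := by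
  refine (ENNReal.rpow_add_le_mul_rpow_add_rpow a b hp.le).trans ?_
  gcongr
  · norm_num
  · linarith

theorem enorm_add_rpow_le {F : Type*} [NormedAddCommGroup F] {p : ℝ} (hp : 1 < p) (a b : F) :
    ‖a + b‖ₑ ^ p ≤ 2 ^ p * (‖a‖ₑ ^ p + ‖b‖ₑ ^ p) :=
  (ENNReal.rpow_le_rpow (enorm_add_le a b) (by linarith)).trans (add_rpow_le_two hp _ _)

theorem enorm_sub_rpow_le {F : Type*} [NormedAddCommGroup F] {p : ℝ} (hp : 1 < p) (a b : F) :
    ‖a - b‖ₑ ^ p ≤ 2 ^ p * (‖a‖ₑ ^ p + ‖b‖ₑ ^ p) :=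
  (ENNReal.rpow_le_rpow (enorm_sub_le) (by linarith)).trans (add_rpow_le_two hp _ _)

theorem lintegral_le_mul_add {α : Type*} [MeasurableSpace α] {μ : Measure α} {f a b : α → ℝ≥0∞}
    {C : ℝ≥0∞} (hC : C ≠ ⊤) (hb : Measurable b) (h : ∀ x, f x ≤ C * (a x + b x)) :
    ∫⁻ x, f x ∂μ ≤ C * ((∫⁻ x, a x ∂μ) + ∫⁻ x, b x ∂μ) := by
  refine (lintegral_mono h).trans_eq ?_
  rw [lintegral_const_mul' _ _ hC, lintegral_add_right _ hb]

/-! ### Translation integrals -/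

variable {d : ℕ} {F : Type*} [NormedAddCommGroup F] [NormedSpace ℝ F]

/-- `∫ |w(x + h) - w(x)|^p dx`. -/
noncomputable def shiftInt (p : ℝ) (w : Euc d → F) (h : Euc d) : ℝ≥0∞ :=
  ∫⁻ x, ‖w (x + h) - w x‖ₑ ^ p

theorem shiftInt_neg (p : ℝ) (w : Euc d → F) (h : Euc d) :
    shiftInt p w (-h) = shiftInt p w h := by
  unfold shiftInt
  rw [← lintegral_add_right_eq_self (fun x => ‖w (x + -h) - w x‖ₑ ^ p) h]
  congr 1; ext x
  rw [add_neg_cancel_right, ← enorm_neg, neg_sub]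

/-- Used with `v` a regularization of `w`: the error `w - v` contributes twice its `L^p` integral,
whatever `h` is, and the smooth part is left to a gradient estimate. -/
theorem shiftInt_le_of_sub {p : ℝ} (hp : 1 < p) {w v : Euc d → F} (hw : StronglyMeasurable w)
    (hv : StronglyMeasurable v) (h : Euc d) :
    shiftInt p w h ≤ 2 ^ p * (2 ^ p * (2 * ∫⁻ x, ‖w x - v x‖ₑ ^ p) + shiftInt p v h) := by
  unfold shiftInt
  have hm : Measurable fun x => ‖w x - v x‖ₑ ^ p := (hw.sub hv).enorm.pow_const p
  have hm2 : Measurable fun x => ‖w (x + h) - v (x + h)‖ₑ ^ p :=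
    hm.comp (measurable_id.add_const h)
  have hm3 : Measurable fun x => ‖v (x + h) - v x‖ₑ ^ p :=
    ((hv.comp_measurable (measurable_id.add_const h)).sub hv).enorm.pow_const p
  have h2 : (2 : ℝ≥0∞) ^ p ≠ ⊤ := by finiteness
  calc ∫⁻ x, ‖w (x + h) - w x‖ₑ ^ p
      ≤ 2 ^ p * ((∫⁻ x, ‖(w (x + h) - v (x + h)) - (w x - v x)‖ₑ ^ p)
          + ∫⁻ x, ‖v (x + h) - v x‖ₑ ^ p) := by
        refine lintegral_le_mul_add h2 hm3 fun x => ?_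
        have : w (x + h) - w x
            = ((w (x + h) - v (x + h)) - (w x - v x)) + (v (x + h) - v x) := by abel
        rw [this]
        exact enorm_add_rpow_le hp _ _
    _ ≤ _ := by
        gcongr
        refine (lintegral_le_mul_add h2 hm fun x => enorm_sub_rpow_le hp _ _).trans_eq ?_
        rw [lintegral_add_right_eq_self (fun x => ‖w x - v x‖ₑ ^ p) h, two_mul]

/-! ### Mollification -/

/-- `∫ η(ζ) w(x - σζ) dζ`. -/
noncomputable def moll (η : Euc d → ℝ) (σ : ℝ) (w : Euc d → F) (x : Euc d) : F :=
  ∫ ζ, η ζ • w (x - σ • ζ)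

/-- A smooth even-free probability density supported in the closed ball of radius `r`. -/
structure IsMollifier (η : Euc d → ℝ) (r : ℝ) : Prop where
  contDiff : ContDiff ℝ ∞ η
  nonneg : ∀ ζ, 0 ≤ η ζ
  integral_eq_one : ∫ ζ, η ζ = 1
  eq_zero : ∀ ζ, r < ‖ζ‖ → η ζ = 0

theorem exists_isMollifier (d : ℕ) {r : ℝ} (hr : 0 < r) :
    ∃ η : Euc d → ℝ, IsMollifier η r := by
  let b : ContDiffBump (0 : Euc d) := ⟨r / 2, r, by positivity, by linarith⟩
  refine ⟨b.normed volume, b.contDiff_normed, b.nonneg_normed, b.integral_normed, fun ζ hζ => ?_⟩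
  have : ζ ∉ Function.support (b.normed volume) := by
    rw [b.support_normed_eq]; simp [b]; exact hζ.le
  simpa using this

namespace IsMollifier

variable {η : Euc d → ℝ} {r : ℝ}

theorem hasCompactSupport (hη : IsMollifier η r) : HasCompactSupport η :=
  HasCompactSupport.intro (isCompact_closedBall (0 : Euc d) r) fun x hx => hη.eq_zero x (by simpa using hx)

theorem tsupport_subset (hη : IsMollifier η r) : tsupport η ⊆ Metric.closedBall 0 r :=
  closure_minimal (fun x hx => by
    by_contra h
    exact hx (hη.eq_zero x (by simpa using h))) Metric.isClosed_closedBall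

theorem fderiv_eq_zero (hη : IsMollifier η r) {ζ : Euc d} (h : r < ‖ζ‖) : fderiv ℝ η ζ = 0 := by
  by_contra h0
  have := hη.tsupport_subset (support_fderiv_subset ℝ (f := η) h0)
  simp at this; linarith

theorem lintegral_enorm (hη : IsMollifier η r) : ∫⁻ ζ, ‖η ζ‖ₑ = 1 := by
  have h := ofReal_integral_eq_lintegral_ofReal (μ := (volume : Measure (Euc d)))
    (hη.contDiff.continuous.integrable_of_hasCompactSupport hη.hasCompactSupport)
    (Eventually.of_forall hη.nonneg)
  rw [hη.integral_eq_one, ENNReal.ofReal_one] at h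
  rw [h]
  congr 1; ext ζ
  rw [Real.enorm_eq_ofReal (hη.nonneg ζ)]

end IsMollifier

section moll

variable [CompleteSpace F] {η : Euc d → ℝ} {r σ p : ℝ} {w : Euc d → F}

theorem integrable_comp_sub_smul (hw : Integrable w) (hσ : σ ≠ 0) (x : Euc d) :
    Integrable fun ζ => w (x - σ • ζ) :=
  (hw.comp_sub_left x).comp_smul hσ

theorem integrable_moll_integrand (hη : IsMollifier η r) (hw : Integrable w) (hσ : σ ≠ 0)
    (x : Euc d) : Integrable fun ζ => η ζ • w (x - σ • ζ) := by
  obtain ⟨C, hC⟩ := hη.contDiff.continuous.bounded_above_of_compact_support hη.hasCompactSupport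
  exact (integrable_comp_sub_smul hw hσ x).bdd_smul C
    hη.contDiff.continuous.aestronglyMeasurable (Eventually.of_forall hC)

theorem moll_sub_eq (hη : IsMollifier η r) (hw : Integrable w) (hσ : σ ≠ 0) (x : Euc d) :
    moll η σ w x - w x = ∫ ζ, η ζ • (w (x - σ • ζ) - w x) := by
  simp only [smul_sub]
  rw [integral_sub (integrable_moll_integrand hη hw hσ x), integral_smul_const,
    hη.integral_eq_one, one_smul, moll]
  exact (hη.contDiff.continuous.integrable_of_hasCompactSupport hη.hasCompactSupport).smul_const _

/-- Since `η` is a probability density, `moll η σ w - w` is an average of increments of `w`. Jensen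
moves the power inside the average and Tonelli exchanges the integrals; the increment by `-σζ` is
turned into one by `σζ` using `shiftInt_neg`. -/
theorem moll_sub_lintegral_le (hp : 1 < p) (hη : IsMollifier η r) (hw : Integrable w)
    (hwm : StronglyMeasurable w) (hσ : σ ≠ 0) :
    ∫⁻ x, ‖moll η σ w x - w x‖ₑ ^ p ≤ ∫⁻ ζ, ‖η ζ‖ₑ * shiftInt p w (σ • ζ) := by
  have hm : Measurable fun q : Euc d × Euc d => ‖w (q.1 - σ • q.2) - w q.1‖ₑ ^ p :=
    ((hwm.comp_measurable (by fun_prop)).sub (hwm.comp_measurable measurable_fst)).enorm.pow_const p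
  have hηm : Measurable fun ζ => ‖η ζ‖ₑ := hη.contDiff.continuous.measurable.enorm
  calc ∫⁻ x, ‖moll η σ w x - w x‖ₑ ^ p
      ≤ ∫⁻ x, ∫⁻ ζ, ‖η ζ‖ₑ * ‖w (x - σ • ζ) - w x‖ₑ ^ p := by
        refine lintegral_mono fun x => ?_
        rw [moll_sub_eq hη hw hσ]
        refine (ENNReal.rpow_le_rpow (enorm_integral_le_lintegral_enorm _) (by linarith)).trans ?_
        simp only [enorm_smul]
        refine (lintegral_mul_rpow_le hp hηm ?_).trans_eq ?_
        · exact ((hwm.comp_measurable (by fun_prop)).sub stronglyMeasurable_const).enorm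
        · rw [hη.lintegral_enorm, ENNReal.one_rpow, one_mul]
    _ = ∫⁻ ζ, ∫⁻ x, ‖η ζ‖ₑ * ‖w (x - σ • ζ) - w x‖ₑ ^ p := by
        refine lintegral_lintegral_swap (Measurable.aemeasurable ?_)
        exact (hηm.comp measurable_snd).mul hm
    _ = _ := by
        congr 1; ext ζ
        rw [lintegral_const_mul' _ _ (by finiteness), ← shiftInt_neg]
        simp only [shiftInt, sub_eq_add_neg]

/-- Writing the scale into `w` and into the evaluation point leaves a convolution with the fixed
kernel `η`, so that smoothness and the derivative come from the theory of convolutions. -/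
theorem moll_eq_convolution (x : Euc d) (hσ : σ ≠ 0) :
    moll η σ w x
      = (convolution η (fun y => w (σ • y)) (ContinuousLinearMap.lsmul ℝ ℝ) volume) (σ⁻¹ • x) := by
  simp [moll, convolution, smul_sub, smul_smul, hσ]

theorem moll_contDiff (hη : IsMollifier η r) (hw : Integrable w) (hσ : σ ≠ 0) :
    ContDiff ℝ ∞ (moll η σ w) := by
  have : moll η σ w = fun x => _ := funext fun x => moll_eq_convolution x hσ
  rw [this]
  exact (hη.hasCompactSupport.contDiff_convolution_left _ hη.contDiff
    (hw.comp_smul hσ).locallyIntegrable).comp (contDiff_const_smul _)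

theorem integrable_moll_fderiv_integrand (hη : IsMollifier η r) (hw : Integrable w) (hσ : σ ≠ 0)
    (x : Euc d) : Integrable fun ζ => (fderiv ℝ η ζ).smulRight (w (x - σ • ζ)) := by
  have hc : Continuous (fderiv ℝ η) := hη.contDiff.continuous_fderiv (by simp)
  obtain ⟨C, hC⟩ := hc.bounded_above_of_compact_support (hη.hasCompactSupport.fderiv ℝ)
  have := integrable_comp_sub_smul hw hσ x
  refine (this.norm.const_mul C).mono' ?_ (Eventually.of_forall fun ζ => ?_)
  · exact (ContinuousLinearMap.smulRightL ℝ (Euc d) F).aestronglyMeasurable_comp₂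
      hc.aestronglyMeasurable this.aestronglyMeasurable
  · rw [ContinuousLinearMap.norm_smulRight_apply]
    gcongr
    exact hC ζ

theorem moll_hasFDerivAt (hη : IsMollifier η r) (hw : Integrable w) (hσ : σ ≠ 0) (x : Euc d) :
    HasFDerivAt (moll η σ w) (σ⁻¹ • ∫ ζ, (fderiv ℝ η ζ).smulRight (w (x - σ • ζ))) x := by
  have : moll η σ w = fun x => _ := funext fun x => moll_eq_convolution x hσ
  rw [this]
  have h1 := hη.hasCompactSupport.hasFDerivAt_convolution_left (ContinuousLinearMap.lsmul ℝ ℝ)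
    (hη.contDiff.of_le (by simp)) (hw.comp_smul hσ).locallyIntegrable (σ⁻¹ • x)
  have h2 := h1.comp x ((hasFDerivAt_id x).const_smul σ⁻¹)
  convert! h2 using 1
  ext e
  simp only [ContinuousLinearMap.comp_smul, ContinuousLinearMap.comp_id,
    smul_apply, convolution]
  congr 2
  congr 1; ext ζ e
  simp [ContinuousLinearMap.precompL_apply, smul_sub, smul_smul, hσ]

theorem integral_fderiv_eq_zero (hη : IsMollifier η r) : ∫ ζ, fderiv ℝ η ζ = 0 := by
  have hc : Continuous (fderiv ℝ η) := hη.contDiff.continuous_fderiv (by simp)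
  have hi : Integrable (fderiv ℝ η) := hc.integrable_of_hasCompactSupport
    (hη.hasCompactSupport.fderiv ℝ)
  ext e
  rw [ContinuousLinearMap.integral_apply hi]
  have := integral_smul_fderiv_eq_neg_fderiv_smul_of_integrable (𝕜 := ℝ) (μ := volume) (f := fun _ : Euc d => (1:ℝ)) (g := η) (v := e)
    (by simp) (by simpa using hi.apply_continuousLinearMap e)
    (by simpa using hη.contDiff.continuous.integrable_of_hasCompactSupport hη.hasCompactSupport)
    (fun x _ => by fun_prop) (fun x _ => hη.contDiff.differentiable (by simp) x)
  simpa using this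

/-- The derivative falls on `η`, which costs a factor `σ⁻¹`. Because `∫ Dη = 0`, the constant `w x`
may be subtracted, and `σ⁻¹` then turns the increment into a difference quotient. -/
theorem enorm_fderiv_moll_le (hη : IsMollifier η r) (hw : Integrable w) (hσ : σ ≠ 0) (x : Euc d) :
    ‖fderiv ℝ (moll η σ w) x‖ₑ
      ≤ ∫⁻ ζ, ‖fderiv ℝ η ζ‖ₑ * ‖σ⁻¹ • (w (x - σ • ζ) - w x)‖ₑ := by
  have hc : Continuous (fderiv ℝ η) := hη.contDiff.continuous_fderiv (by simp)
  have hi : Integrable (fderiv ℝ η) := hc.integrable_of_hasCompactSupport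
    (hη.hasCompactSupport.fderiv ℝ)
  have h0 : ∫ ζ, (fderiv ℝ η ζ).smulRight (w x) = 0 := by
    have := (((ContinuousLinearMap.smulRightL ℝ (Euc d) F).flip (w x))).integral_comp_comm hi
    simp only [ContinuousLinearMap.flip_apply, ContinuousLinearMap.smulRightL_apply_apply,
      integral_fderiv_eq_zero hη] at this
    rw [this]; simp
  have hi2 : Integrable fun ζ => (fderiv ℝ η ζ).smulRight (w x) :=
    ((ContinuousLinearMap.smulRightL ℝ (Euc d) F).flip (w x)).integrable_comp hi
  rw [(moll_hasFDerivAt hη hw hσ x).fderiv]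
  have : σ⁻¹ • ∫ ζ, (fderiv ℝ η ζ).smulRight (w (x - σ • ζ))
      = ∫ ζ, (fderiv ℝ η ζ).smulRight (σ⁻¹ • (w (x - σ • ζ) - w x)) := by
    rw [← sub_zero (∫ ζ, (fderiv ℝ η ζ).smulRight (w (x - σ • ζ))), ← h0, ← integral_sub
      (integrable_moll_fderiv_integrand hη hw hσ x) hi2, ← integral_smul]
    congr 1; ext ζ e
    simp [smul_sub, smul_comm σ⁻¹]
  rw [this]
  refine (enorm_integral_le_lintegral_enorm _).trans_eq ?_
  congr 1; ext ζ
  rw [← ofReal_norm, ContinuousLinearMap.norm_smulRight_apply,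
    ENNReal.ofReal_mul (norm_nonneg _), ofReal_norm, ofReal_norm]

theorem fderiv_moll_lintegral_le (hp : 1 < p) (hη : IsMollifier η r) (hw : Integrable w)
    (hwm : StronglyMeasurable w) (hσ : σ ≠ 0) :
    ∫⁻ x, ‖fderiv ℝ (moll η σ w) x‖ₑ ^ p ≤ (∫⁻ ζ, ‖fderiv ℝ η ζ‖ₑ) ^ (p - 1) *
      (‖σ⁻¹‖ₑ ^ p * ∫⁻ ζ, ‖fderiv ℝ η ζ‖ₑ * shiftInt p w (σ • ζ)) := by
  have hm : Measurable fun q : Euc d × Euc d => ‖σ⁻¹ • (w (q.1 - σ • q.2) - w q.1)‖ₑ ^ p :=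
    (((hwm.comp_measurable (by fun_prop)).sub
      (hwm.comp_measurable measurable_fst)).const_smul _).enorm.pow_const p
  have hηm : Measurable fun ζ => ‖fderiv ℝ η ζ‖ₑ :=
    (hη.contDiff.continuous_fderiv (by simp)).measurable.enorm
  have hd : ∫⁻ ζ, ‖fderiv ℝ η ζ‖ₑ ≠ ⊤ :=
    ((hη.contDiff.continuous_fderiv (by simp)).integrable_of_hasCompactSupport
      (hη.hasCompactSupport.fderiv ℝ)).2.ne
  calc ∫⁻ x, ‖fderiv ℝ (moll η σ w) x‖ₑ ^ p
      ≤ ∫⁻ x, (∫⁻ ζ, ‖fderiv ℝ η ζ‖ₑ) ^ (p - 1) *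
          ∫⁻ ζ, ‖fderiv ℝ η ζ‖ₑ * ‖σ⁻¹ • (w (x - σ • ζ) - w x)‖ₑ ^ p := by
        refine lintegral_mono fun x => ?_
        refine (ENNReal.rpow_le_rpow (enorm_fderiv_moll_le hη hw hσ x) (by linarith)).trans ?_
        refine lintegral_mul_rpow_le hp hηm ?_
        exact (((hwm.comp_measurable (by fun_prop)).sub stronglyMeasurable_const).const_smul _).enorm
    _ = (∫⁻ ζ, ‖fderiv ℝ η ζ‖ₑ) ^ (p - 1) *
          ∫⁻ ζ, ∫⁻ x, ‖fderiv ℝ η ζ‖ₑ * ‖σ⁻¹ • (w (x - σ • ζ) - w x)‖ₑ ^ p := by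
        rw [lintegral_const_mul' _ _ (ENNReal.rpow_ne_top_of_nonneg (by linarith) hd)]
        congr 1
        refine lintegral_lintegral_swap (Measurable.aemeasurable ?_)
        exact (hηm.comp measurable_snd).mul hm
    _ = _ := by
        rw [← lintegral_const_mul' (‖σ⁻¹‖ₑ ^ p) _ (by finiteness)]
        refine congrArg _ (lintegral_congr fun ζ => ?_)
        rw [lintegral_const_mul' _ _ (by finiteness), ← shiftInt_neg]
        simp only [shiftInt, sub_eq_add_neg, enorm_smul,
          ENNReal.mul_rpow_of_nonneg _ _ (by linarith : 0 ≤ p)]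
        rw [lintegral_const_mul' _ _ (by finiteness)]
        ring

theorem moll_eq_zero (hη : IsMollifier η r) {x : Euc d} (hσ : 0 < σ)
    (h : ∀ y, dist x y ≤ σ * r → w y = 0) : moll η σ w x = 0 := by
  unfold moll
  refine integral_eq_zero_of_ae (Eventually.of_forall fun ζ => ?_)
  rcases lt_or_ge r ‖ζ‖ with h1 | h1
  · simp [hη.eq_zero ζ h1]
  · dsimp only
    rw [h]
    · simp
    · rw [dist_eq_norm, sub_sub_cancel, norm_smul, Real.norm_of_nonneg hσ.le]
      gcongr

end moll


/-! ### Gradient bounds for translations and the short-range difference-quotient energy -/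

section translation

variable {d : ℕ} {F : Type*} [NormedAddCommGroup F] [NormedSpace ℝ F] [CompleteSpace F]

theorem enorm_sub_le_lintegral_fderiv {v : Euc d → F} (hv : ContDiff ℝ 1 v) (x h : Euc d) :
    ‖v (x + h) - v x‖ₑ ≤ ∫⁻ t in Ioc (0 : ℝ) 1, ‖h‖ₑ * ‖fderiv ℝ v (x + t • h)‖ₑ := by
  have hc : Continuous fun t : ℝ => fderiv ℝ v (x + t • h) h :=
    ((hv.continuous_fderiv one_ne_zero).comp (by fun_prop)).clm_apply continuous_const
  have h1 : ∫ t in (0 : ℝ)..1, fderiv ℝ v (x + t • h) h = v (x + h) - v x := by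
    have := intervalIntegral.integral_eq_sub_of_hasDerivAt (a := 0) (b := 1)
      (f := fun t : ℝ => v (x + t • h)) (f' := fun t => fderiv ℝ v (x + t • h) h)
      (fun t _ => by
        have h2 : HasDerivAt (fun t : ℝ => x + t • h) h t := by
          simpa using ((hasDerivAt_id t).smul_const h).const_add x
        exact ((hv.differentiable one_ne_zero) _).hasFDerivAt.comp_hasDerivAt t h2)
      (hc.intervalIntegrable _ _)
    simpa using this
  rw [← h1, intervalIntegral.integral_of_le zero_le_one]
  refine (enorm_integral_le_lintegral_enorm _).trans (lintegral_mono fun t => ?_)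
  rw [mul_comm]
  exact ContinuousLinearMap.le_opENorm _ _

/-- Translation estimate for `C¹` functions. -/
theorem lintegral_shift_le_of_contDiff {p : ℝ} (hp : 1 < p) {v : Euc d → F} (hv : ContDiff ℝ 1 v)
    {h : Euc d} {S S' : Set (Euc d)} (hS : MeasurableSet S) (hS' : MeasurableSet S')
    (hSS' : ∀ x ∈ S, ∀ t ∈ Ioc (0 : ℝ) 1, x + t • h ∈ S') :
    ∫⁻ x in S, ‖v (x + h) - v x‖ₑ ^ p ≤ ‖h‖ₑ ^ p * ∫⁻ x in S', ‖fderiv ℝ v x‖ₑ ^ p := by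
  have hp0 : 0 ≤ p := by linarith
  have hc := hv.continuous_fderiv one_ne_zero
  have hm : Measurable fun q : Euc d × ℝ => ‖fderiv ℝ v (q.1 + q.2 • h)‖ₑ :=
    (hc.comp (by fun_prop : Continuous fun q : Euc d × ℝ => q.1 + q.2 • h)).enorm.measurable
  have hmx : ∀ x, Measurable fun t : ℝ => ‖fderiv ℝ v (x + t • h)‖ₑ := fun x =>
    (hc.comp (by fun_prop : Continuous fun t : ℝ => x + t • h)).enorm.measurable
  calc ∫⁻ x in S, ‖v (x + h) - v x‖ₑ ^ p
      ≤ ∫⁻ x in S, ‖h‖ₑ ^ p * ∫⁻ t in Ioc (0 : ℝ) 1, ‖fderiv ℝ v (x + t • h)‖ₑ ^ p := by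
        refine lintegral_mono fun x => ?_
        refine (ENNReal.rpow_le_rpow (enorm_sub_le_lintegral_fderiv hv x h) hp0).trans ?_
        rw [lintegral_const_mul' _ _ (by finiteness), ENNReal.mul_rpow_of_nonneg _ _ hp0]
        gcongr
        have := lintegral_mul_rpow_le (μ := volume.restrict (Ioc (0 : ℝ) 1)) hp
          (k := fun _ => 1) (F := fun t => ‖fderiv ℝ v (x + t • h)‖ₑ) measurable_const
          (hmx x)
        simpa only [one_mul, lintegral_const, Measure.restrict_apply_univ, Real.volume_Ioc, sub_zero,
          ENNReal.ofReal_one, ENNReal.one_rpow, Measure.restrict_apply MeasurableSet.univ, univ_inter] using this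
    _ = ‖h‖ₑ ^ p * ∫⁻ t in Ioc (0 : ℝ) 1, ∫⁻ x in S, ‖fderiv ℝ v (x + t • h)‖ₑ ^ p := by
        rw [lintegral_const_mul' _ _ (by finiteness)]
        congr 1
        exact lintegral_lintegral_swap (hm.pow_const p).aemeasurable
    _ ≤ ‖h‖ₑ ^ p * ∫⁻ t in Ioc (0 : ℝ) 1, ∫⁻ x in S', ‖fderiv ℝ v x‖ₑ ^ p := by
        gcongr 1
        refine setLIntegral_mono' measurableSet_Ioc fun t ht => ?_
        -- For fixed `t`, translation by `t • h` sends `S` into `S'`, so the inner integral is at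
        -- most the integral over `S'`.
        rw [← lintegral_indicator hS, ← lintegral_indicator hS', ← lintegral_add_right_eq_self
          (S'.indicator fun x => ‖fderiv ℝ v x‖ₑ ^ p) (t • h)]
        refine lintegral_mono fun x => ?_
        by_cases hx : x ∈ S
        · rw [indicator_of_mem hx, indicator_of_mem (hSS' x hx t ht)]
        · rw [indicator_of_notMem hx]; exact zero_le
    _ = _ := by simp

theorem shiftInt_le_of_contDiff {p : ℝ} (hp : 1 < p) {v : Euc d → F} (hv : ContDiff ℝ 1 v)
    (h : Euc d) : shiftInt p v h ≤ ‖h‖ₑ ^ p * ∫⁻ x, ‖fderiv ℝ v x‖ₑ ^ p := by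
  simpa [shiftInt] using lintegral_shift_le_of_contDiff hp hv (h := h) MeasurableSet.univ
    MeasurableSet.univ (by simp)

/-- Poincaré's inequality for functions supported in a ball. -/
theorem lintegral_le_of_support_subset_ball (hd : 0 < d) {p : ℝ} (hp : 1 < p) {v : Euc d → F}
    (hv : ContDiff ℝ 1 v) {R : ℝ} (hR : 0 < R) (hs : ∀ x, R ≤ ‖x‖ → v x = 0) :
    ∫⁻ x, ‖v x‖ₑ ^ p ≤ ENNReal.ofReal (2 * R) ^ p * ∫⁻ x, ‖fderiv ℝ v x‖ₑ ^ p := by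
  have : Nonempty (Fin d) := ⟨⟨0, hd⟩⟩
  -- Translating by a vector of length `2R` moves the ball off itself: wherever `v x` is nonzero, `v
  -- (x + h)` vanishes, so `|v|` is itself an increment. Such a vector exists because `d` is
  -- positive.
  obtain ⟨h, hh⟩ := exists_norm_eq (Euc d) (by positivity : 0 ≤ 2 * R)
  rw [← hh, ofReal_norm]
  refine le_trans (lintegral_mono fun x => ?_) (shiftInt_le_of_contDiff hp hv h)
  by_cases hx : R ≤ ‖x‖
  · rw [hs x hx]; simp [show 0 < p by linarith]
  · rw [hs (x + h), zero_sub, enorm_neg]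
    have := norm_sub_le (x + h) x
    rw [add_sub_cancel_left] at this
    linarith

/-- The energy `∫_{B_r} ∫ |(w(x + εζ) - w(x)) / ε|^p dx dζ`. -/
noncomputable def quotEnergy (p r ε : ℝ) (w : Euc d → F) : ℝ≥0∞ :=
  ∫⁻ ζ in Metric.closedBall (0 : Euc d) r, ‖ε⁻¹‖ₑ ^ p * shiftInt p w (ε • ζ)

/-- Any bounded kernel supported in the ball of radius `r` is dominated by a multiple of its
indicator. This serves for both kernels `|η|` and `|Dη|`. -/
theorem lintegral_weight_mul_shiftInt_le {p r ε C : ℝ} (hε : 0 < ε) {w : Euc d → F}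
    {k : Euc d → ℝ≥0∞} (hkC : ∀ ζ, k ζ ≤ ENNReal.ofReal C) (hk : ∀ ζ, r < ‖ζ‖ → k ζ = 0) :
    ‖ε⁻¹‖ₑ ^ p * ∫⁻ ζ, k ζ * shiftInt p w (ε • ζ) ≤ ENNReal.ofReal C * quotEnergy p r ε w := by
  have hne : ‖ε⁻¹‖ₑ ≠ 0 := by simpa using hε.ne'
  have hnt : ‖ε⁻¹‖ₑ ^ p ≠ ⊤ := by
    exact ENNReal.rpow_ne_top_of_ne_zero hne (by finiteness)
  unfold quotEnergy
  rw [← lintegral_const_mul' _ _ hnt, ← lintegral_const_mul' _ _ (by finiteness),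
    ← lintegral_indicator measurableSet_closedBall]
  refine lintegral_mono fun ζ => ?_
  by_cases hζ : ζ ∈ Metric.closedBall (0 : Euc d) r
  · rw [indicator_of_mem hζ, mul_left_comm]
    gcongr
    exact hkC ζ
  · rw [hk ζ (by simpa using hζ)]; simp

/-- Mollification at the scale `ε` of a function with finite difference-quotient energy. -/
theorem IsMollifier.exists_const {η : Euc d → ℝ} {r : ℝ} (hη : IsMollifier η r) {p : ℝ}
    (hp : 1 < p) : ∃ C : ℝ, 0 < C ∧ ∀ (ε : ℝ) (w : Euc d → F), 0 < ε → Integrable w →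
      StronglyMeasurable w →
      ∫⁻ x, ‖moll η ε w x - w x‖ₑ ^ p ≤ ENNReal.ofReal (C * ε ^ p) * quotEnergy p r ε w ∧
      ∫⁻ x, ‖fderiv ℝ (moll η ε w) x‖ₑ ^ p ≤ ENNReal.ofReal C * quotEnergy p r ε w := by
  have hc : Continuous (fderiv ℝ η) := hη.contDiff.continuous_fderiv (by simp)
  obtain ⟨C₁, h1⟩ := hη.contDiff.continuous.bounded_above_of_compact_support hη.hasCompactSupport
  obtain ⟨C₂, h2⟩ := hc.bounded_above_of_compact_support (hη.hasCompactSupport.fderiv ℝ)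
  have hd : ∫⁻ ζ, ‖fderiv ℝ η ζ‖ₑ ≠ ⊤ :=
    (hc.integrable_of_hasCompactSupport (hη.hasCompactSupport.fderiv ℝ)).2.ne
  have hJt : (∫⁻ ζ, ‖fderiv ℝ η ζ‖ₑ) ^ (p - 1) ≠ ⊤ := ENNReal.rpow_ne_top_of_nonneg (by linarith) hd
  set J := ((∫⁻ ζ, ‖fderiv ℝ η ζ‖ₑ) ^ (p - 1)).toReal with hJ
  have hC1 : 0 ≤ C₁ := (norm_nonneg _).trans (h1 0)
  have hC2 : 0 ≤ C₂ := (norm_nonneg _).trans (h2 0)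
  have hJ0 : 0 ≤ J := ENNReal.toReal_nonneg
  -- A single constant for both estimates: `C₁ = sup |η|` serves the first and `J * C₂` the second,
  -- where `C₂ = sup |Dη|` and `J` is the power of `∫ |Dη|` produced by Jensen. The added `1` gives
  -- positivity.
  refine ⟨C₁ + J * C₂ + 1, by positivity, fun ε w hε hw hwm => ⟨?_, ?_⟩⟩
  · have h3 := lintegral_weight_mul_shiftInt_le (p := p) (r := r) (w := w) (k := fun ζ => ‖η ζ‖ₑ) hε
      (fun ζ => by rw [← ofReal_norm]; exact ENNReal.ofReal_le_ofReal (h1 ζ))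
      (fun ζ hζ => by simp [hη.eq_zero ζ hζ])
    have h4 : ENNReal.ofReal (ε ^ p) * ‖ε⁻¹‖ₑ ^ p = 1 := by
      rw [← ofReal_norm, ENNReal.ofReal_rpow_of_nonneg (norm_nonneg _) (by linarith),
        ← ENNReal.ofReal_mul (by positivity), Real.norm_of_nonneg (by positivity),
        ← Real.mul_rpow hε.le (by positivity), mul_inv_cancel₀ hε.ne']
      simp
    calc _ ≤ _ := moll_sub_lintegral_le hp hη hw hwm hε.ne'
      _ = ENNReal.ofReal (ε ^ p) * (‖ε⁻¹‖ₑ ^ p * ∫⁻ ζ, ‖η ζ‖ₑ * shiftInt p w (ε • ζ)) := by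
        rw [← mul_assoc, h4, one_mul]
      _ ≤ ENNReal.ofReal (ε ^ p) * (ENNReal.ofReal C₁ * quotEnergy p r ε w) := by gcongr
      _ ≤ _ := by
        rw [← mul_assoc, ← ENNReal.ofReal_mul (by positivity), mul_comm (ε ^ p)]
        gcongr
        nlinarith [mul_nonneg hJ0 hC2]
  · have h3 := lintegral_weight_mul_shiftInt_le (p := p) (r := r) (w := w) (k := fun ζ => ‖fderiv ℝ η ζ‖ₑ) hε
      (fun ζ => by rw [← ofReal_norm]; exact ENNReal.ofReal_le_ofReal (h2 ζ))
      (fun ζ hζ => by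
        show ‖fderiv ℝ η ζ‖ₑ = 0
        rw [hη.fderiv_eq_zero hζ]
        exact enorm_zero (E := Euc d →L[ℝ] ℝ))
    calc _ ≤ _ := fderiv_moll_lintegral_le hp hη hw hwm hε.ne'
      _ ≤ ENNReal.ofReal J * (ENNReal.ofReal C₂ * quotEnergy p r ε w) := by
        rw [hJ, ENNReal.ofReal_toReal hJt]
        gcongr
      _ ≤ _ := by
        rw [← mul_assoc, ← ENNReal.ofReal_mul (by positivity)]
        gcongr
        nlinarith [mul_nonneg hJ0 hC2]

/-- Long-range difference quotients are controlled by short-range ones. -/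
theorem exists_shiftInt_le_quotEnergy (d : ℕ) (F : Type*) [NormedAddCommGroup F] [NormedSpace ℝ F]
    [CompleteSpace F] {r : ℝ} (hr : 0 < r) {p : ℝ} (hp : 1 < p) :
    ∃ C : ℝ, 0 < C ∧ ∀ (ε : ℝ) (w : Euc d → F) (ξ : Euc d), 0 < ε → Integrable w →
      StronglyMeasurable w →
      ‖ε⁻¹‖ₑ ^ p * shiftInt p w (ε • ξ)
        ≤ ENNReal.ofReal (C * (‖ξ‖ ^ p + 1)) * quotEnergy p r ε w := by
  obtain ⟨η, hη⟩ := exists_isMollifier d hr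
  obtain ⟨C, hC, h⟩ := hη.exists_const (F := F) hp
  -- Compare `w` with its mollification at scale `ε`. The error is `O(ε^p)`, which absorbs the
  -- factor `ε⁻ᵖ` whatever `ξ` is and yields the `1`; the increment of the mollification along `εξ`
  -- is bounded by its gradient and yields `|ξ|^p`.
  refine ⟨2 ^ p * (2 ^ p * 2 + 1) * C, by positivity, fun ε w ξ hε hw hwm => ?_⟩
  obtain ⟨h1, h2⟩ := h ε w hε hw hwm
  have hv := moll_contDiff hη hw hε.ne'
  have hp0 : 0 ≤ p := by linarith
  have h3 := shiftInt_le_of_contDiff hp (hv.of_le (by simp)) (ε • ξ)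
  have h4 := shiftInt_le_of_sub hp hwm hv.continuous.stronglyMeasurable (ε • ξ)
  have h5 : ‖ε⁻¹‖ₑ ^ p = ENNReal.ofReal (ε⁻¹ ^ p) := by
    rw [← ofReal_norm, ENNReal.ofReal_rpow_of_nonneg (norm_nonneg _) hp0,
      Real.norm_of_nonneg (by positivity)]
  have h6 : ‖ε • ξ‖ₑ ^ p = ENNReal.ofReal (ε ^ p * ‖ξ‖ ^ p) := by
    rw [← ofReal_norm, ENNReal.ofReal_rpow_of_nonneg (norm_nonneg _) hp0, norm_smul,
      Real.norm_of_nonneg hε.le, Real.mul_rpow hε.le (norm_nonneg _)]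
  have h7 : (2 : ℝ≥0∞) ^ p = ENNReal.ofReal (2 ^ p) := by
    rw [← ENNReal.ofReal_rpow_of_nonneg (by norm_num) hp0]; simp
  have h8 : ε⁻¹ ^ p * ε ^ p = 1 := by
    rw [← Real.mul_rpow (by positivity) hε.le, inv_mul_cancel₀ hε.ne', Real.one_rpow]
  have h9 : ∫⁻ x, ‖w x - moll η ε w x‖ₑ ^ p
      ≤ ENNReal.ofReal (C * ε ^ p) * quotEnergy p r ε w := by
    simpa only [← enorm_neg (w _ - _), neg_sub] using h1
  set Q := quotEnergy p r ε w
  calc ‖ε⁻¹‖ₑ ^ p * shiftInt p w (ε • ξ)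
      ≤ ENNReal.ofReal (ε⁻¹ ^ p) * (ENNReal.ofReal (2 ^ p) * (ENNReal.ofReal (2 ^ p) *
        (ENNReal.ofReal 2 * (ENNReal.ofReal (C * ε ^ p) * Q)) +
          ENNReal.ofReal (ε ^ p * ‖ξ‖ ^ p) * (ENNReal.ofReal C * Q))) := by
        rw [h5]
        gcongr
        refine h4.trans ?_
        rw [h7]
        gcongr
        · simp
        · exact h3.trans (by rw [h6]; gcongr)
    _ = ENNReal.ofReal (2 ^ p * (2 ^ p * 2 * C + ‖ξ‖ ^ p * C)) * Q := by
        have h10 : (2 : ℝ) ^ p * (2 ^ p * 2 * C + ‖ξ‖ ^ p * C)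
            = ε⁻¹ ^ p * (2 ^ p * (2 ^ p * (2 * (C * ε ^ p)) + ε ^ p * ‖ξ‖ ^ p * C)) := by
          linear_combination (-(2 : ℝ) ^ p * (2 ^ p * 2 * C + ‖ξ‖ ^ p * C)) * h8
        rw [h10, ENNReal.ofReal_mul (p := ε⁻¹ ^ p) (by positivity),
          ENNReal.ofReal_mul (p := 2 ^ p) (by positivity),
          ENNReal.ofReal_add (by positivity) (by positivity),
          ENNReal.ofReal_mul (p := 2 ^ p) (by positivity),
          ENNReal.ofReal_mul zero_le_two, ENNReal.ofReal_mul (q := C) (by positivity)]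
        ring
    _ ≤ _ := by
        gcongr ENNReal.ofReal ?_ * _
        have : (0 : ℝ) < 2 ^ p := by positivity
        have h10 : 0 ≤ ‖ξ‖ ^ p := by positivity
        have h11 := mul_nonneg (mul_nonneg this.le hC.le) h10
        nlinarith [mul_nonneg this.le h11, mul_pos this hC, mul_pos this (mul_pos this hC)]

end translation


/-! ### Translation between L^p norms and integrals of p-th powers -/

section bridge

variable {α : Type*} [MeasurableSpace α] {μ : Measure α} {F : Type*} [NormedAddCommGroup F]

theorem eLpNorm_ofReal_rpow {p : ℝ} (hp : 0 < p) (f : α → F) :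
    eLpNorm f (ENNReal.ofReal p) μ ^ p = ∫⁻ x, ‖f x‖ₑ ^ p ∂μ := by
  rw [eLpNorm_eq_lintegral_rpow_enorm_toReal (by simpa using hp) ENNReal.ofReal_ne_top,
    ENNReal.toReal_ofReal hp.le, ← ENNReal.rpow_mul, one_div_mul_cancel hp.ne', ENNReal.rpow_one]

theorem tendsto_rpow_zero_iff {p : ℝ} (hp : 0 < p) {ι : Type*} {l : Filter ι} {a : ι → ℝ≥0∞} :
    Tendsto (fun i => a i ^ p) l (𝓝 0) ↔ Tendsto a l (𝓝 0) := by
  constructor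
  · intro h
    have := (ENNReal.continuous_rpow_const (y := p⁻¹)).continuousAt.tendsto.comp h
    simpa [Function.comp_def, ← ENNReal.rpow_mul, hp.ne', hp] using this
  · intro h
    have := (ENNReal.continuous_rpow_const (y := p)).continuousAt.tendsto.comp h
    simpa [Function.comp_def, hp] using this

theorem tendsto_eLpNorm_zero_iff {p : ℝ} (hp : 0 < p) {ι : Type*} {l : Filter ι} {f : ι → α → F} :
    Tendsto (fun i => eLpNorm (f i) (ENNReal.ofReal p) μ) l (𝓝 0)
      ↔ Tendsto (fun i => ∫⁻ x, ‖f i x‖ₑ ^ p ∂μ) l (𝓝 0) := by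
  rw [← tendsto_rpow_zero_iff hp]
  simp only [eLpNorm_ofReal_rpow hp]

theorem memLp_ofReal_iff {p : ℝ} (hp : 0 < p) {f : α → F} :
    MemLp f (ENNReal.ofReal p) μ ↔ AEStronglyMeasurable f μ ∧ ∫⁻ x, ‖f x‖ₑ ^ p ∂μ < ⊤ := by
  rw [MemLp, ← eLpNorm_ofReal_rpow hp, ENNReal.rpow_lt_top_iff_of_pos hp]

theorem exists_rpow_mul_lt {p : ℝ} (hp : 0 < p) (K : ℝ) {δ : ℝ} (hδ : 0 < δ) :
    ∃ σ : ℝ, 0 < σ ∧ σ ≤ 1 ∧ σ ^ p * K < δ := by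
  have h : Tendsto (fun σ : ℝ => σ ^ p * K) (𝓝[>] 0) (𝓝 0) := by
    have := ((Real.continuous_rpow_const hp.le).mul_const K).tendsto (0 : ℝ)
    simp only [Real.zero_rpow hp.ne', zero_mul] at this
    exact this.mono_left nhdsWithin_le_nhds
  obtain ⟨σ, h1, h2⟩ := ((h.eventually (gt_mem_nhds hδ)).and
    (Ioc_mem_nhdsGT (zero_lt_one' ℝ))).exists
  exact ⟨σ, h2.1, h2.2, h1⟩

end bridge

/-! ### Rellich compactness via mollification and Arzelà–Ascoli -/

section rellich

variable {d : ℕ} {F : Type*} [NormedAddCommGroup F] [NormedSpace ℝ F] [FiniteDimensional ℝ F]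

/-- Mollification at a fixed scale maps functions bounded in `L¹` to bounded equi-Lipschitz
functions. -/
theorem IsMollifier.exists_lipschitz {η : Euc d → ℝ} {r : ℝ} (hη : IsMollifier η r) {σ : ℝ}
    (hσ : 0 < σ) (M : ℝ) : ∃ K : ℝ≥0, ∀ w : Euc d → F, Integrable w → ∫ x, ‖w x‖ ≤ M →
      LipschitzWith K (moll η σ w) ∧ ∀ x, ‖moll η σ w x‖ ≤ K := by
  have : CompleteSpace F := FiniteDimensional.complete ℝ F
  have hc : Continuous (fderiv ℝ η) := hη.contDiff.continuous_fderiv (by simp)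
  obtain ⟨C₁, h1⟩ := hη.contDiff.continuous.bounded_above_of_compact_support hη.hasCompactSupport
  obtain ⟨C₂, h2⟩ := hc.bounded_above_of_compact_support (hη.hasCompactSupport.fderiv ℝ)
  have hC1 : 0 ≤ C₁ := (norm_nonneg _).trans (h1 0)
  have hC2 : 0 ≤ C₂ := (norm_nonneg _).trans (h2 0)
  set s := |(σ ^ Module.finrank ℝ (Euc d))⁻¹| with hs
  have key : ∀ w : Euc d → F, ∀ x, ∫ ζ, ‖w (x - σ • ζ)‖ = s * ∫ x, ‖w x‖ := by
    intro w x
    rw [Measure.integral_comp_smul volume (fun ζ => ‖w (x - ζ)‖),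
      integral_sub_left_eq_self (fun ζ => ‖w ζ‖), smul_eq_mul]
  refine ⟨(max (C₁ * (s * M)) (σ⁻¹ * (C₂ * (s * M)))).toNNReal, fun w hw hwM => ⟨?_, fun x => ?_⟩⟩
  · refine lipschitzWith_of_nnnorm_fderiv_le (𝕜 := ℝ)
      ((moll_contDiff hη hw hσ.ne').differentiable (by simp)) fun x => ?_
    rw [← NNReal.coe_le_coe, coe_nnnorm]
    refine le_trans ?_ ((le_max_right _ _).trans (Real.le_coe_toNNReal _))
    rw [(moll_hasFDerivAt hη hw hσ.ne' x).fderiv, norm_smul, Real.norm_of_nonneg (by positivity)]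
    gcongr
    refine (norm_integral_le_integral_norm _).trans ?_
    calc ∫ ζ, ‖(fderiv ℝ η ζ).smulRight (w (x - σ • ζ))‖
        ≤ ∫ ζ, C₂ * ‖w (x - σ • ζ)‖ := by
          refine integral_mono (integrable_moll_fderiv_integrand hη hw hσ.ne' x).norm
            ((integrable_comp_sub_smul hw hσ.ne' x).norm.const_mul _) fun ζ => ?_
          dsimp only
          rw [ContinuousLinearMap.norm_smulRight_apply]
          gcongr
          exact h2 ζ
      _ ≤ _ := by
          rw [integral_const_mul, key]
          gcongr
  · refine le_trans ?_ ((le_max_left _ _).trans (Real.le_coe_toNNReal _))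
    refine (norm_integral_le_integral_norm _).trans ?_
    calc ∫ ζ, ‖η ζ • w (x - σ • ζ)‖
        ≤ ∫ ζ, C₁ * ‖w (x - σ • ζ)‖ := by
          refine integral_mono (integrable_moll_integrand hη hw hσ.ne' x).norm
            ((integrable_comp_sub_smul hw hσ.ne' x).norm.const_mul _) fun ζ => ?_
          dsimp only
          rw [norm_smul]
          gcongr
          exact h1 ζ
      _ ≤ _ := by
          rw [integral_const_mul, key]
          gcongr

/-- A sequence of uniformly bounded equi-Lipschitz functions has finite nets in the uniform
distance over compact sets. -/
theorem exists_finite_net_of_lipschitz {K : ℝ≥0} {g : ℕ → Euc d → F} (hL : ∀ k, LipschitzWith K (g k))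
    (hb : ∀ k x, ‖g k x‖ ≤ K) (R : ℝ) {δ : ℝ} (hδ : 0 < δ) :
    ∃ t : Set ℕ, t.Finite ∧ ∀ k, ∃ i ∈ t, ∀ x ∈ Metric.closedBall (0 : Euc d) R,
      ‖g k x - g i x‖ < δ := by
  have : ProperSpace F := FiniteDimensional.proper ℝ F
  have : CompactSpace (Metric.closedBall (0 : Euc d) R) :=
    isCompact_iff_compactSpace.mp (isCompact_closedBall _ _)
  -- Restriction to a closed ball makes the domain compact, as Arzelà–Ascoli requires.
  let G : ℕ → BoundedContinuousFunction (Metric.closedBall (0 : Euc d) R) F := fun k =>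
    BoundedContinuousFunction.mkOfCompact ⟨fun x => g k x, (hL k).continuous.comp continuous_subtype_val⟩
  have hcomp : IsCompact (closure (range G)) := by
    refine BoundedContinuousFunction.arzela_ascoli (Metric.closedBall 0 K) (isCompact_closedBall _ _) _
      ?_ ?_
    · rintro f x ⟨k, rfl⟩
      simpa [G] using hb k x
    · refine (LipschitzWith.uniformEquicontinuous _ K ?_).equicontinuous
      rintro ⟨f, k, rfl⟩
      intro x y
      exact hL k x y
  have htb : TotallyBounded (range G) := hcomp.totallyBounded.subset subset_closure
  obtain ⟨s, hs, hsf, hcov⟩ := htb.exists_subset (Metric.dist_mem_uniformity hδ)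
  have hs2 : ∀ y ∈ s, ∃ k, G k = y := fun y hy => hs hy
  choose! idx hidx using hs2
  refine ⟨idx '' s, hsf.image _, fun k => ?_⟩
  obtain ⟨y, hy, hky⟩ := mem_iUnion₂.1 (hcov (mem_range_self k))
  refine ⟨idx y, mem_image_of_mem _ hy, fun x hx => ?_⟩
  have h1 : dist (G k) (G (idx y)) < δ := by rw [hidx y hy]; exact hky
  have h2 := (BoundedContinuousFunction.dist_coe_le_dist (f := G k) (g := G (idx y)) ⟨x, hx⟩).trans_lt h1
  rwa [dist_eq_norm] at h2

/-- Rellich's compactness theorem for functions supported in a fixed ball. -/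
theorem exists_subseq_tendsto_of_fderiv_bounded (hd : 0 < d) {p : ℝ} (hp : 1 < p)
    {v : ℕ → Euc d → F} (hv : ∀ k, ContDiff ℝ 1 (v k)) {R : ℝ} (hR : 0 < R)
    (hs : ∀ k x, R ≤ ‖x‖ → v k x = 0) {C : ℝ}
    (hC : ∀ k, ∫⁻ x, ‖fderiv ℝ (v k) x‖ₑ ^ p ≤ ENNReal.ofReal C) :
    ∃ φ : ℕ → ℕ, StrictMono φ ∧ ∃ w : Euc d → F, MemLp w (ENNReal.ofReal p) volume ∧
      Tendsto (fun k => ∫⁻ x, ‖v (φ k) x - w x‖ₑ ^ p) atTop (𝓝 0) := by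
  have : CompleteSpace F := FiniteDimensional.complete ℝ F
  have hp0 : 0 < p := by linarith
  have : Fact (1 ≤ ENNReal.ofReal p) := ⟨by simpa using hp.le⟩
  wlog hC0 : 0 ≤ C generalizing C
  · exact this (C := 0) (fun k => (hC k).trans (by gcongr; linarith)) le_rfl
  have hsm : ∀ k, StronglyMeasurable (v k) := fun k => (hv k).continuous.stronglyMeasurable
  have hcs : ∀ k, HasCompactSupport (v k) := fun k =>
    HasCompactSupport.intro (isCompact_closedBall (0 : Euc d) R) fun x hx =>
      hs k x (by simpa using (not_le.1 (by simpa using hx)).le)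
  have hint : ∀ k, Integrable (v k) := fun k => (hv k).continuous.integrable_of_hasCompactSupport (hcs k)
  have hLp : ∀ k, ∫⁻ x, ‖v k x‖ₑ ^ p ≤ ENNReal.ofReal (2 * R) ^ p * ENNReal.ofReal C := fun k =>
    (lintegral_le_of_support_subset_ball hd hp (hv k) hR (hs k)).trans (by gcongr; exact hC k)
  have hmem : ∀ k, MemLp (v k) (ENNReal.ofReal p) volume := fun k =>
    (memLp_ofReal_iff hp0).2 ⟨(hsm k).aestronglyMeasurable, (hLp k).trans_lt (by finiteness)⟩
  -- A uniform `L¹` bound: Jensen with the indicator of the ball as weight, using that all the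
  -- functions vanish outside the ball.
  obtain ⟨M, hM⟩ : ∃ M : ℝ, ∀ k, ∫ x, ‖v k x‖ ≤ M := by
    set B := (volume (Metric.closedBall (0 : Euc d) R)) ^ (p - 1) *
      (ENNReal.ofReal (2 * R) ^ p * ENNReal.ofReal C) with hB
    have hBt : B ≠ ⊤ := by
      have : volume (Metric.closedBall (0 : Euc d) R) ≠ ⊤ := measure_closedBall_lt_top.ne
      have : (volume (Metric.closedBall (0 : Euc d) R)) ^ (p - 1) ≠ ⊤ :=
        ENNReal.rpow_ne_top_of_nonneg (by linarith) this
      finiteness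
    refine ⟨(B ^ (p⁻¹)).toReal, fun k => ?_⟩
    rw [integral_norm_eq_lintegral_enorm (hsm k).aestronglyMeasurable]
    refine ENNReal.toReal_mono (ENNReal.rpow_ne_top_of_nonneg (by positivity) hBt) ?_
    rw [ENNReal.le_rpow_inv_iff hp0]
    have h1 := lintegral_mul_rpow_le (μ := volume) hp (k := (Metric.closedBall (0 : Euc d) R).indicator 1)
      (F := fun x => ‖v k x‖ₑ) (measurable_one.indicator measurableSet_closedBall) (hsm k).enorm
    rw [lintegral_indicator_one measurableSet_closedBall] at h1
    refine le_trans (le_of_eq ?_) (h1.trans ?_)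
    · congr 2; ext x
      by_cases hx : x ∈ Metric.closedBall (0 : Euc d) R
      · simp [hx]
      · rw [hs k x (by simpa using (not_le.1 (by simpa using hx)).le)]; simp
    · rw [hB]
      gcongr
      refine le_trans (lintegral_mono fun x => ?_) (hLp k)
      by_cases hx : x ∈ Metric.closedBall (0 : Euc d) R
      · rw [indicator_of_mem hx]; simp
      · rw [indicator_of_notMem hx]; simp
  let f : ℕ → Lp F (ENNReal.ofReal p) (volume : Measure (Euc d)) := fun k => (hmem k).toLp (v k)
  have htb : TotallyBounded (range f) := by
    rw [Metric.totallyBounded_iff]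
    intro δ hδ
    have hδp : 0 < δ ^ p / 2 := by positivity
    -- The mollification scale `σ` and the tolerance `δ'` of the uniform net are chosen so that each
    -- accounts for less than half of `δ ^ p` once the powers of two from the triangle inequalities
    -- are included. The bound `σ ≤ 1` keeps the mollified functions supported in the ball of radius
    -- `R + 1`.
    obtain ⟨σ, hσ0, hσ1, hσ⟩ := exists_rpow_mul_lt hp0 (2 ^ p * 2 ^ p * 2 * C) hδp
    obtain ⟨δ', hδ0, -, hδ'⟩ := exists_rpow_mul_lt hp0
      (2 ^ p * (volume (Metric.closedBall (0 : Euc d) (R + 1))).toReal) hδp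
    obtain ⟨η, hη⟩ := exists_isMollifier d (zero_lt_one' ℝ)
    obtain ⟨K, hK⟩ := hη.exists_lipschitz (F := F) hσ0 M
    have hclose : ∀ k, ∫⁻ x, ‖v k x - moll η σ (v k) x‖ₑ ^ p ≤ ENNReal.ofReal (σ ^ p * C) := by
      intro k
      simp only [← enorm_neg (v k _ - _), neg_sub]
      calc _ ≤ _ := moll_sub_lintegral_le hp hη (hint k) (hsm k) hσ0.ne'
        _ ≤ ∫⁻ ζ, ‖η ζ‖ₑ * ENNReal.ofReal (σ ^ p * C) := by
          refine lintegral_mono fun ζ => ?_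
          by_cases hζ : ‖ζ‖ ≤ 1
          · gcongr
            refine (shiftInt_le_of_contDiff hp (hv k) _).trans ?_
            rw [ENNReal.ofReal_mul (by positivity)]
            refine mul_le_mul' ?_ (hC k)
            rw [← ofReal_norm, ENNReal.ofReal_rpow_of_nonneg (norm_nonneg _) hp0.le, norm_smul,
              Real.norm_of_nonneg hσ0.le]
            gcongr
            exact mul_le_of_le_one_right hσ0.le hζ
          · rw [hη.eq_zero ζ (not_le.1 hζ)]; simp
        _ = _ := by rw [lintegral_mul_const' _ _ (by finiteness), hη.lintegral_enorm, one_mul]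
    obtain ⟨t, htf, ht⟩ := exists_finite_net_of_lipschitz (fun k => (hK (v k) (hint k) (hM k)).1)
      (fun k => (hK (v k) (hint k) (hM k)).2) (R + 1) hδ0
    refine ⟨f '' t, htf.image f, ?_⟩
    rintro _ ⟨k, rfl⟩
    obtain ⟨i, hi, hki⟩ := ht k
    refine mem_iUnion₂.2 ⟨f i, mem_image_of_mem _ hi, ?_⟩
    have hmm : ∀ k, StronglyMeasurable (moll η σ (v k)) := fun k =>
      (moll_contDiff hη (hint k) hσ0.ne').continuous.stronglyMeasurable
    have hout : ∀ k x, x ∉ Metric.closedBall (0 : Euc d) (R + 1) → moll η σ (v k) x = 0 := by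
      intro k x hx
      refine moll_eq_zero hη hσ0 fun y hy => hs k y ?_
      have h1 : R + 1 < ‖x‖ := by simpa using hx
      have h2 := norm_sub_norm_le x y
      rw [dist_eq_norm] at hy
      linarith
    have h2t : (2 : ℝ≥0∞) ^ p ≠ ⊤ := by finiteness
    have hmain : ∫⁻ x, ‖v k x - v i x‖ₑ ^ p < ENNReal.ofReal (δ ^ p) := by
      calc ∫⁻ x, ‖v k x - v i x‖ₑ ^ p
          ≤ 2 ^ p * ((∫⁻ x, ‖(v k x - moll η σ (v k) x) - (v i x - moll η σ (v i) x)‖ₑ ^ p)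
              + ∫⁻ x, ‖moll η σ (v k) x - moll η σ (v i) x‖ₑ ^ p) := by
            refine lintegral_le_mul_add h2t (((hmm k).sub (hmm i)).enorm.pow_const p) fun x => ?_
            refine le_trans (le_of_eq ?_) (enorm_add_rpow_le hp _ _)
            congr 2; abel
        _ ≤ 2 ^ p * (2 ^ p * (ENNReal.ofReal (σ ^ p * C) + ENNReal.ofReal (σ ^ p * C))
              + ENNReal.ofReal (δ' ^ p) * volume (Metric.closedBall (0 : Euc d) (R + 1))) := by
            gcongr
            · refine (lintegral_le_mul_add h2t (((hsm i).sub (hmm i)).enorm.pow_const p)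
                fun x => enorm_sub_rpow_le hp _ _).trans ?_
              gcongr
              · exact hclose k
              · exact hclose i
            · rw [← setLIntegral_const, ← lintegral_indicator measurableSet_closedBall]
              refine lintegral_mono fun x => ?_
              by_cases hx : x ∈ Metric.closedBall (0 : Euc d) (R + 1)
              · rw [indicator_of_mem hx, ← ofReal_norm,
                  ENNReal.ofReal_rpow_of_nonneg (norm_nonneg _) hp0.le]
                gcongr
                exact (hki x hx).le
              · rw [hout k x hx, hout i x hx]; simp [hp0]
        _ = ENNReal.ofReal (σ ^ p * (2 ^ p * 2 ^ p * 2 * C) + δ' ^ p *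
              (2 ^ p * (volume (Metric.closedBall (0 : Euc d) (R + 1))).toReal)) := by
            rw [← ENNReal.ofReal_toReal (measure_closedBall_lt_top (μ := volume) (x := (0 : Euc d)) (r := R + 1)).ne,
              ENNReal.toReal_ofReal ENNReal.toReal_nonneg]
            have h7 : (2 : ℝ≥0∞) ^ p = ENNReal.ofReal (2 ^ p) := by
              rw [← ENNReal.ofReal_rpow_of_nonneg (by norm_num) hp0.le]; simp
            rw [h7, ← ENNReal.ofReal_add (by positivity) (by positivity),
              ← ENNReal.ofReal_mul (by positivity), ← ENNReal.ofReal_mul (by positivity),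
              ← ENNReal.ofReal_add (by positivity) (by positivity), ← ENNReal.ofReal_mul (by positivity)]
            congr 1; ring
        _ < _ := by
            rw [ENNReal.ofReal_lt_ofReal_iff (by positivity)]
            linarith
    rw [Metric.mem_ball, dist_edist, Lp.edist_toLp_toLp]
    refine ENNReal.toReal_lt_of_lt_ofReal ?_
    rw [← ENNReal.rpow_lt_rpow_iff hp0, eLpNorm_ofReal_rpow hp0,
      ENNReal.ofReal_rpow_of_nonneg hδ.le hp0.le]
    exact hmain
  obtain ⟨a, -, φ, hφ, hlim⟩ := (htb.closure.isCompact_of_isClosed isClosed_closure).tendsto_subseq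
    (x := f) (fun n => subset_closure (mem_range_self n))
  refine ⟨φ, hφ, a, Lp.memLp a, ?_⟩
  have h1 : a = (Lp.memLp a).toLp a := (Lp.toLp_coeFn a _).symm
  rw [h1] at hlim
  have h2 := (Lp.tendsto_Lp_iff_tendsto_eLpNorm'' (fun k => v (φ k)) (fun k => hmem (φ k)) a
    (Lp.memLp a)).1 hlim
  exact (tendsto_eLpNorm_zero_iff hp0).1 h2

end rellich


/-! ### Quantitative uniform convexity of the p-th power of a norm -/

section mazur

/-- If the norms agree, strictness comes from strict convexity of the space; if they differ, from
strict convexity of `t ↦ t ^ p` after the triangle inequality. -/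
theorem norm_half_add_rpow_lt {F : Type*} [NormedAddCommGroup F] [NormedSpace ℝ F]
    [StrictConvexSpace ℝ F] {p : ℝ} (hp : 1 < p) {a b : F} (hab : a ≠ b) :
    ‖(1 / 2 : ℝ) • (a + b)‖ ^ p < (‖a‖ ^ p + ‖b‖ ^ p) / 2 := by
  by_cases h : ‖a‖ = ‖b‖
  · have := (norm_midpoint_lt_iff h).2 hab
    calc _ < ‖a‖ ^ p := Real.rpow_lt_rpow (norm_nonneg _) this (by linarith)
      _ = _ := by rw [← h]; ring
  · have h1 := (strictConvexOn_rpow hp).2 (norm_nonneg a) (norm_nonneg b) h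
      (by norm_num : (0 : ℝ) < 1 / 2) (by norm_num : (0 : ℝ) < 1 / 2) (by norm_num)
    simp only [smul_eq_mul] at h1
    refine lt_of_le_of_lt (Real.rpow_le_rpow (norm_nonneg _) ?_ (by linarith)) (h1.trans_eq (by ring))
    rw [norm_smul, Real.norm_of_nonneg (by norm_num)]
    nlinarith [norm_add_le a b]

/-- Uniform convexity of `|·|^p`. -/
theorem exists_norm_sub_rpow_le {F : Type*} [NormedAddCommGroup F] [NormedSpace ℝ F]
    [FiniteDimensional ℝ F] [StrictConvexSpace ℝ F] {p : ℝ} (hp : 1 < p) {δ : ℝ} (hδ : 0 < δ) :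
    ∃ C : ℝ, 0 ≤ C ∧ ∀ a b : F, ‖a - b‖ ^ p ≤ δ * (‖a‖ ^ p + ‖b‖ ^ p) +
      C * ((‖a‖ ^ p + ‖b‖ ^ p) / 2 - ‖(1 / 2 : ℝ) • (a + b)‖ ^ p) := by
  have hp0 : 0 < p := by linarith
  have : ProperSpace F := FiniteDimensional.proper ℝ F
  -- Both sides are `p`-homogeneous, so it suffices to treat normalized pairs. Those with `‖a - b‖ ^
  -- p ≥ δ` form a compact set on which the convexity gap, continuous and positive, has a positive
  -- lower bound `c`.
  let K : Set (F × F) := {q | ‖q.1‖ ^ p + ‖q.2‖ ^ p = 1 ∧ δ ≤ ‖q.1 - q.2‖ ^ p}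
  have hc1 : Continuous fun q : F × F => ‖q.1‖ ^ p :=
    (Real.continuous_rpow_const hp0.le).comp (by fun_prop)
  have hc2 : Continuous fun q : F × F => ‖q.2‖ ^ p :=
    (Real.continuous_rpow_const hp0.le).comp (by fun_prop)
  have hc3 : Continuous fun q : F × F => ‖q.1 - q.2‖ ^ p :=
    (Real.continuous_rpow_const hp0.le).comp (by fun_prop)
  have hc4 : Continuous fun q : F × F => ‖(1 / 2 : ℝ) • (q.1 + q.2)‖ ^ p :=
    (Real.continuous_rpow_const hp0.le).comp (by fun_prop)
  have hcl : IsClosed K := (isClosed_eq (hc1.add hc2) continuous_const).inter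
    (isClosed_le continuous_const hc3)
  have hle1 : ∀ x : ℝ, 0 ≤ x → x ^ p ≤ 1 → x ≤ 1 := fun x hx h => by
    by_contra h'
    exact absurd h (not_le.2 (Real.one_lt_rpow (not_le.1 h') hp0))
  have hK : IsCompact K := by
    refine (isCompact_closedBall (0 : F × F) 1).of_isClosed_subset hcl fun q hq => ?_
    rw [mem_closedBall_zero_iff, Prod.norm_def, max_le_iff]
    have h1 : 0 ≤ ‖q.1‖ ^ p := by positivity
    have h2 : 0 ≤ ‖q.2‖ ^ p := by positivity
    exact ⟨hle1 _ (norm_nonneg _) (by linarith [hq.1]), hle1 _ (norm_nonneg _) (by linarith [hq.1])⟩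
  obtain ⟨c, hc, hcK⟩ : ∃ c > 0, ∀ q ∈ K,
      c ≤ (‖q.1‖ ^ p + ‖q.2‖ ^ p) / 2 - ‖(1 / 2 : ℝ) • (q.1 + q.2)‖ ^ p := by
    rcases K.eq_empty_or_nonempty with h | h
    · exact ⟨1, one_pos, by simp [h]⟩
    · obtain ⟨q, hq, hmin⟩ := hK.exists_isMinOn h
        (((hc1.add hc2).div_const 2).sub hc4).continuousOn
      refine ⟨_, ?_, fun q' hq' => hmin hq'⟩
      have hne : q.1 ≠ q.2 := by
        intro h
        have := hq.2
        rw [h, sub_self, norm_zero, Real.zero_rpow hp0.ne'] at this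
        linarith
      have := norm_half_add_rpow_lt hp hne
      simp only [Pi.sub_apply, Pi.add_apply]
      linarith
  -- For pairs that are far apart, `‖a - b‖ ^ p ≤ 2 ^ p N` while the gap is at least `c N`, with `N
  -- = ‖a‖ ^ p + ‖b‖ ^ p`. For the other pairs the term with `δ` suffices.
  refine ⟨2 ^ p / c, by positivity, fun a b => ?_⟩
  have hconv : ‖(1 / 2 : ℝ) • (a + b)‖ ^ p ≤ (‖a‖ ^ p + ‖b‖ ^ p) / 2 := by
    by_cases hab : a = b
    · subst hab
      rw [← two_smul ℝ a, smul_smul]; norm_num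
    · exact (norm_half_add_rpow_lt hp hab).le
  set N := ‖a‖ ^ p + ‖b‖ ^ p with hN
  have hN0 : 0 ≤ N := by positivity
  rcases hN0.eq_or_lt with h0 | hNpos
  · have ha : ‖a‖ ^ p = 0 := by
      have h1 : 0 ≤ ‖a‖ ^ p := by positivity
      have h2 : 0 ≤ ‖b‖ ^ p := by positivity
      linarith
    have hb : ‖b‖ ^ p = 0 := by linarith
    rw [Real.rpow_eq_zero (norm_nonneg _) hp0.ne', norm_eq_zero] at ha hb
    subst ha hb
    simp [hp0.ne', N]
  -- The scaling factor that gives the pair `(l • a, l • b)` total `p`-mass one.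
  set l := N ^ (-(1 / p)) with hl
  have hl0 : 0 < l := by positivity
  have hlp : l ^ p = N⁻¹ := by
    rw [hl, ← Real.rpow_mul hNpos.le]
    rw [show -(1 / p) * p = -1 by field_simp, Real.rpow_neg_one]
  have hscale : ∀ z : F, ‖l • z‖ ^ p = N⁻¹ * ‖z‖ ^ p := fun z => by
    rw [norm_smul, Real.norm_of_nonneg hl0.le, Real.mul_rpow hl0.le (norm_nonneg _), hlp]
  have hC : 0 ≤ 2 ^ p / c := by positivity
  by_cases hd : δ * N ≤ ‖a - b‖ ^ p
  · have hmem : (l • a, l • b) ∈ K := by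
      refine ⟨?_, ?_⟩
      · simp only [hscale]; rw [← mul_add, ← hN, inv_mul_cancel₀ hNpos.ne']
      · simp only
        rw [← smul_sub, hscale, inv_mul_eq_div, le_div_iff₀ hNpos]; exact hd
    have h1 := hcK _ hmem
    simp only at h1
    rw [← smul_add, smul_comm, hscale, hscale, hscale, ← mul_add, ← hN,
      show N⁻¹ * N / 2 - N⁻¹ * ‖(1 / 2 : ℝ) • (a + b)‖ ^ p
        = (N / 2 - ‖(1 / 2 : ℝ) • (a + b)‖ ^ p) / N by field_simp, le_div_iff₀ hNpos] at h1
    have h2 : ‖a - b‖ ^ p ≤ 2 ^ p * N := by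
      have hab : ‖a - b‖ ≤ 2 * max ‖a‖ ‖b‖ := by
        have := norm_sub_le a b
        linarith [le_max_left ‖a‖ ‖b‖, le_max_right ‖a‖ ‖b‖]
      refine (Real.rpow_le_rpow (norm_nonneg _) hab hp0.le).trans ?_
      rw [Real.mul_rpow (by norm_num) (by positivity)]
      gcongr
      have h1 : 0 ≤ ‖a‖ ^ p := by positivity
      have h2 : 0 ≤ ‖b‖ ^ p := by positivity
      rcases max_choice ‖a‖ ‖b‖ with h | h <;> rw [h] <;> linarith
    have h3 : 2 ^ p * N ≤ 2 ^ p / c * (N / 2 - ‖(1 / 2 : ℝ) • (a + b)‖ ^ p) := by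
      rw [div_mul_eq_mul_div, le_div_iff₀ hc, mul_assoc]
      gcongr
      linarith
    nlinarith [mul_nonneg hδ.le hN0]
  · nlinarith [mul_nonneg hC (sub_nonneg.2 hconv), not_le.1 hd]

end mazur


/-! ### Test functions and convex combinations with Cauchy gradients -/

section weak

theorem integral_le_of_le_combination {α : Type*} [MeasurableSpace α] {μ : Measure α}
    {a b c e : α → ℝ} (ha : Integrable a μ) (hb : Integrable b μ) (hc : Integrable c μ)
    (he : Integrable e μ) {δ K : ℝ} (h : ∀ x, e x ≤ δ * (a x + b x) + K * ((a x + b x) / 2 - c x)) :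
    ∫ x, e x ∂μ ≤ δ * (∫ x, a x ∂μ + ∫ x, b x ∂μ)
      + K * ((∫ x, a x ∂μ + ∫ x, b x ∂μ) / 2 - ∫ x, c x ∂μ) := by
  have h1 : Integrable (fun x => (δ + K / 2) * a x + (δ + K / 2) * b x) μ :=
    (ha.const_mul _).add (hb.const_mul _)
  calc ∫ x, e x ∂μ ≤ ∫ x, ((δ + K / 2) * a x + (δ + K / 2) * b x) - K * c x ∂μ :=
        integral_mono he (h1.sub (hc.const_mul K)) fun x => (h x).trans_eq (by ring)
    _ = _ := by
        rw [integral_sub h1 (hc.const_mul K), integral_add (ha.const_mul _) (hb.const_mul _),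
          integral_const_mul, integral_const_mul, integral_const_mul]
        ring

variable {d : ℕ} {F : Type*} [NormedAddCommGroup F] [NormedSpace ℝ F]

/-- `φ ∈ C_c^∞(A; F)`. -/
def IsTest (A : Set (Euc d)) (φ : Euc d → F) : Prop :=
  ContDiff ℝ ∞ φ ∧ HasCompactSupport φ ∧ tsupport φ ⊆ A

theorem convex_isTest (A : Set (Euc d)) : Convex ℝ {φ : Euc d → F | IsTest A φ} := by
  intro φ hφ ψ hψ a b _ _ _
  have h1 : tsupport (a • φ + b • ψ) ⊆ tsupport φ ∪ tsupport ψ := by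
    refine (tsupport_add _ _).trans (union_subset_union ?_ ?_)
    · exact closure_mono (Function.support_const_smul_subset a φ)
    · exact closure_mono (Function.support_const_smul_subset b ψ)
  refine ⟨(contDiff_const.smul hφ.1).add (contDiff_const.smul hψ.1), ?_,
    h1.trans (union_subset hφ.2.2 hψ.2.2)⟩
  exact (hφ.2.1.isCompact.union hψ.2.1.isCompact).of_isClosed_subset (isClosed_tsupport _) h1

namespace IsTest

variable {A : Set (Euc d)} {φ ψ : Euc d → F}

theorem sub (hφ : IsTest A φ) (hψ : IsTest A ψ) : IsTest A (fun x => φ x - ψ x) := by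
  have h1 : tsupport (fun x => φ x - ψ x) ⊆ tsupport φ ∪ tsupport ψ := tsupport_sub φ ψ
  exact ⟨hφ.1.sub hψ.1, (hφ.2.1.isCompact.union hψ.2.1.isCompact).of_isClosed_subset
    (isClosed_tsupport _) h1, h1.trans (union_subset hφ.2.2 hψ.2.2)⟩

theorem differentiable (hφ : IsTest A φ) : Differentiable ℝ φ := hφ.1.differentiable (by simp)

theorem continuous_fderiv (hφ : IsTest A φ) : Continuous (fderiv ℝ φ) :=
  hφ.1.continuous_fderiv (by simp)

theorem memLp (hφ : IsTest A φ) (q : ℝ≥0∞) (μ : Measure (Euc d)) [IsFiniteMeasureOnCompacts μ] :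
    MemLp φ q μ := hφ.1.continuous.memLp_of_hasCompactSupport hφ.2.1

theorem memLp_fderiv (hφ : IsTest A φ) (q : ℝ≥0∞) (μ : Measure (Euc d))
    [IsFiniteMeasureOnCompacts μ] : MemLp (fderiv ℝ φ) q μ :=
  hφ.continuous_fderiv.memLp_of_hasCompactSupport (hφ.2.1.fderiv ℝ)

theorem eq_zero (hφ : IsTest A φ) {x : Euc d} (hx : x ∉ A) : φ x = 0 :=
  image_eq_zero_of_notMem_tsupport fun h => hx (hφ.2.2 h)

theorem fderiv_eq_zero (hφ : IsTest A φ) {x : Euc d} (hx : x ∉ A) : fderiv ℝ φ x = 0 := by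
  by_contra h
  exact hx (hφ.2.2 (support_fderiv_subset ℝ (f := φ) h))

end IsTest

/-- Tails of convex combinations of a sequence with bounded gradients contain a sequence whose
gradients are Cauchy in `L^p`. -/
theorem exists_convexHull_cauchy [FiniteDimensional ℝ F] {A : Set (Euc d)} {p : ℝ} (hp : 1 < p)
    {v : ℕ → Euc d → F}
    (hv : ∀ k, IsTest A (v k)) {C : ℝ}
    (hC : ∀ k, ∫⁻ x, ‖fderiv ℝ (v k) x‖ₑ ^ p ≤ ENNReal.ofReal C) :
    ∃ φ : ℕ → Euc d → F, (∀ k, φ k ∈ convexHull ℝ (v '' Ici k)) ∧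
      ∀ τ : ℝ≥0∞, 0 < τ → ∃ n, ∀ j ≥ n, ∀ k ≥ n,
        ∫⁻ x, ‖fderiv ℝ (φ j) x - fderiv ℝ (φ k) x‖ₑ ^ p ≤ τ := by
  have hp0 : 0 < p := by linarith
  -- The operator norm need not be strictly convex. Gradients are therefore measured in a Euclidean
  -- space through the linear isomorphism `T`; its inverse `T'` transfers the Cauchy estimate back.
  let T : (Euc d →L[ℝ] F) →L[ℝ]
      (EuclideanSpace ℝ (Fin (Module.finrank ℝ (Euc d →L[ℝ] F)))) := (toEuclidean (E := Euc d →L[ℝ] F)).toContinuousLinearMap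
  let T' : (EuclideanSpace ℝ (Fin (Module.finrank ℝ (Euc d →L[ℝ] F)))) →L[ℝ] (Euc d →L[ℝ] F) := (toEuclidean (E := Euc d →L[ℝ] F)).symm.toContinuousLinearMap
  have hT : ∀ z, T' (T z) = z := fun z => (toEuclidean (E := Euc d →L[ℝ] F)).symm_apply_apply z
  let N : (Euc d → F) → ℝ := fun φ => ∫ x, ‖T (fderiv ℝ φ x)‖ ^ p
  have hN0 : ∀ φ, 0 ≤ N φ := fun φ => integral_nonneg fun x => by positivity
  have hint : ∀ φ : Euc d → F, IsTest A φ → Integrable fun x => ‖T (fderiv ℝ φ x)‖ ^ p := by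
    intro φ hφ
    have h1 : Continuous fun x => ‖T (fderiv ℝ φ x)‖ ^ p :=
      (Real.continuous_rpow_const hp0.le).comp (T.continuous.comp hφ.continuous_fderiv).norm
    refine h1.integrable_of_hasCompactSupport ?_
    exact (hφ.2.1.fderiv ℝ).comp_left (g := fun z => ‖T z‖ ^ p) (by simp [hp0.ne'])
  let S : ℕ → Set (Euc d → F) := fun k => convexHull ℝ (v '' Ici k)
  have hS : ∀ k, ∀ φ ∈ S k, IsTest A φ := by
    intro k φ hφ
    have h1 : v '' Ici k ⊆ {φ : Euc d → F | IsTest A φ} := by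
      rintro _ ⟨j, -, rfl⟩; exact hv j
    exact convexHull_min h1 (convex_isTest A) hφ
  have hSanti : ∀ j k, j ≤ k → S k ⊆ S j := fun j k hjk =>
    convexHull_mono (image_mono (Ici_subset_Ici.2 hjk))
  have hvS : ∀ k, v k ∈ S k := fun k => subset_convexHull _ _ (mem_image_of_mem _ (mem_Ici.2 le_rfl))
  obtain ⟨C', hC'0, hC'⟩ : ∃ C' : ℝ, 0 ≤ C' ∧ ∀ k, N (v k) ≤ C' := by
    set L := ‖T‖ with hL
    refine ⟨(ENNReal.ofReal L ^ p * ENNReal.ofReal C).toReal, ENNReal.toReal_nonneg, fun k => ?_⟩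
    show ∫ x, _ ≤ _
    rw [integral_eq_lintegral_of_nonneg_ae (Eventually.of_forall fun x => by positivity)
      (hint _ (hv k)).1]
    refine ENNReal.toReal_mono (by finiteness) ?_
    calc ∫⁻ x, ENNReal.ofReal (‖T (fderiv ℝ (v k) x)‖ ^ p)
        ≤ ∫⁻ x, ENNReal.ofReal L ^ p * ‖fderiv ℝ (v k) x‖ₑ ^ p := by
          refine lintegral_mono fun x => ?_
          rw [← ofReal_norm, ← ENNReal.mul_rpow_of_nonneg _ _ hp0.le,
            ← ENNReal.ofReal_mul (p := L) (by positivity),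
            ENNReal.ofReal_rpow_of_nonneg (by positivity) hp0.le]
          gcongr
          exact T.le_opNorm _
      _ ≤ _ := by
          rw [lintegral_const_mul' _ _ (by finiteness)]
          gcongr
          exact hC k
  -- The infima of the gradient functional over the hulls of the tails increase with the tail and
  -- stay bounded, so they converge to some `M`. A near-minimizer is taken in each hull.
  let m : ℕ → ℝ := fun k => sInf (N '' S k)
  have hbdd : ∀ k, BddBelow (N '' S k) := fun k => ⟨0, by rintro _ ⟨φ, -, rfl⟩; exact hN0 φ⟩
  have hmle : ∀ k, ∀ φ ∈ S k, m k ≤ N φ := fun k φ hφ => csInf_le (hbdd k) (mem_image_of_mem _ hφ)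
  have hmC : ∀ k, m k ≤ C' := fun k => (hmle k _ (hvS k)).trans (hC' k)
  have hmmono : Monotone m := fun j k hjk =>
    csInf_le_csInf (hbdd j) ⟨_, mem_image_of_mem _ (hvS k)⟩ (image_mono (hSanti j k hjk))
  have hbA : BddAbove (range m) := ⟨C', by rintro _ ⟨k, rfl⟩; exact hmC k⟩
  have hlim := tendsto_atTop_ciSup hmmono hbA
  set M := ⨆ k, m k with hM
  have hmM : ∀ k, m k ≤ M := fun k => le_ciSup hbA k
  have hex : ∀ k : ℕ, ∃ φ ∈ S k, N φ < m k + 1 / ((k : ℝ) + 1) := by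
    intro k
    obtain ⟨_, ⟨φ, hφ, rfl⟩, h⟩ := exists_lt_of_csInf_lt (s := N '' S k)
      ⟨_, mem_image_of_mem _ (hvS k)⟩
      (show sInf (N '' S k) < m k + 1 / ((k : ℝ) + 1) from lt_add_of_pos_right _ (by positivity))
    exact ⟨φ, hφ, h⟩
  choose φ hφS hφN using hex
  refine ⟨φ, hφS, fun τ hτ => ?_⟩
  wlog hτt : τ ≠ ⊤ generalizing τ
  · obtain ⟨n, hn⟩ := this 1 one_pos (by simp)
    exact ⟨n, fun j hj k hk => (hn j hj k hk).trans (by rw [not_not.1 hτt]; exact le_top)⟩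
  have hτr : 0 < τ.toReal := ENNReal.toReal_pos hτ.ne' hτt
  set L := ‖T'‖ ^ p + 1 with hL
  have hL0 : 0 < L := by positivity
  -- Since `N (φ i) ≤ C' + 1` for all `i`, this `δ` makes the first term of the convexity inequality
  -- at most `τ / (2L)`; the convexity gap accounts for the other half.
  set δ := τ.toReal / (L * (4 * (C' + 1))) with hδ
  have hδ0 : 0 < δ := by positivity
  obtain ⟨K, hK0, hK⟩ := exists_norm_sub_rpow_le
    (F := (EuclideanSpace ℝ (Fin (Module.finrank ℝ (Euc d →L[ℝ] F))))) hp hδ0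
  have hlim2 : Tendsto (fun n : ℕ => K * (M + 1 / ((n : ℝ) + 1) - m n)) atTop (𝓝 0) := by
    have := (((tendsto_one_div_add_atTop_nhds_zero_nat (𝕜 := ℝ)).const_add M).sub hlim).const_mul K
    simpa using this
  obtain ⟨n, hn⟩ := (hlim2.eventually (gt_mem_nhds (show 0 < τ.toReal / (2 * L) by positivity))).exists
  refine ⟨n, fun j hj k hk => ?_⟩
  have htj := hS j _ (hφS j)
  have htk := hS k _ (hφS k)
  -- The midpoint still lies in the hull of the tail from `n`, so its functional is at least `m n`,
  -- while those of `φ j` and `φ k` are at most `M + 1/(n+1)`. The convexity gap therefore tends to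
  -- zero, and with it the distance of the gradients.
  have hmid : (1 / 2 : ℝ) • (φ j + φ k) ∈ S n := by
    rw [smul_add]
    exact (convex_convexHull ℝ _) (hSanti n j hj (hφS j)) (hSanti n k hk (hφS k)) (by norm_num)
      (by norm_num) (by norm_num)
  have htm := hS n _ hmid
  have hfm : ∀ x, fderiv ℝ ((1 / 2 : ℝ) • (φ j + φ k)) x
      = (1 / 2 : ℝ) • (fderiv ℝ (φ j) x + fderiv ℝ (φ k) x) := fun x => by
    rw [fderiv_const_smul ((htj.differentiable x).add (htk.differentiable x)),
      fderiv_add (htj.differentiable x) (htk.differentiable x)]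
  have hlow := hmle n _ hmid
  have h1n : ∀ i ≥ n, N (φ i) ≤ M + 1 / ((n : ℝ) + 1) := fun i hi => by
    have : 1 / ((i : ℝ) + 1) ≤ 1 / ((n : ℝ) + 1) := by gcongr
    linarith [hφN i, hmM i]
  have h2n : ∀ i, N (φ i) ≤ C' + 1 := fun i => by
    have : 1 / ((i : ℝ) + 1) ≤ 1 := by
      rw [div_le_one (by positivity)]
      linarith [(Nat.cast_nonneg i : (0 : ℝ) ≤ i)]
    linarith [hφN i, hmC i]
  have htest := htj.sub htk
  have hfd : ∀ x, fderiv ℝ (fun x => φ j x - φ k x) x = fderiv ℝ (φ j) x - fderiv ℝ (φ k) x := fun x =>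
    fderiv_sub (htj.differentiable x) (htk.differentiable x)
  have hmain : N (fun x => φ j x - φ k x) ≤ δ * (N (φ j) + N (φ k)) +
      K * ((N (φ j) + N (φ k)) / 2 - N ((1 / 2 : ℝ) • (φ j + φ k))) := by
    refine integral_le_of_le_combination (hint _ htj) (hint _ htk) (hint _ htm) (hint _ htest)
      fun x => ?_
    have := hK (T (fderiv ℝ (φ j) x)) (T (fderiv ℝ (φ k) x))
    simp only [hfd, hfm, map_sub, map_smul, map_add]
    exact this
  have hsmall : N (fun x => φ j x - φ k x) ≤ τ.toReal / L := by
    have h3 : δ * (N (φ j) + N (φ k)) ≤ τ.toReal / (2 * L) := by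
      calc δ * (N (φ j) + N (φ k)) ≤ δ * (2 * (C' + 1)) := by
            gcongr
            linarith [h2n j, h2n k]
        _ = _ := by rw [hδ]; field_simp; norm_num
    have h4 : K * ((N (φ j) + N (φ k)) / 2 - N ((1 / 2 : ℝ) • (φ j + φ k)))
        ≤ K * (M + 1 / ((n : ℝ) + 1) - m n) := by
      gcongr
      linarith [h1n j hj, h1n k hk]
    have h5 : τ.toReal / L = τ.toReal / (2 * L) + τ.toReal / (2 * L) := by field_simp; norm_num
    linarith
  calc ∫⁻ x, ‖fderiv ℝ (φ j) x - fderiv ℝ (φ k) x‖ₑ ^ p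
      ≤ ∫⁻ x, ENNReal.ofReal (L * ‖T (fderiv ℝ (fun x => φ j x - φ k x) x)‖ ^ p) := by
        refine lintegral_mono fun x => ?_
        rw [← hfd, ← ofReal_norm, ENNReal.ofReal_rpow_of_nonneg (norm_nonneg _) hp0.le]
        refine ENNReal.ofReal_le_ofReal ?_
        set z := fderiv ℝ (fun x => φ j x - φ k x) x
        have h6 : ‖z‖ ≤ ‖T'‖ * ‖T z‖ := by
          have := T'.le_opNorm (T z)
          rwa [hT] at this
        refine (Real.rpow_le_rpow (norm_nonneg _) h6 hp0.le).trans ?_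
        rw [Real.mul_rpow (x := ‖T'‖) (y := ‖T z‖) (by positivity) (by positivity)]
        gcongr
        rw [hL]; linarith
    _ = ENNReal.ofReal (L * N (fun x => φ j x - φ k x)) := by
        rw [← ofReal_integral_eq_lintegral_ofReal ((hint _ htest).const_mul L)
          (Eventually.of_forall fun x => by positivity), integral_const_mul]
    _ ≤ τ := by
        refine ENNReal.ofReal_le_of_le_toReal ?_
        calc _ ≤ L * (τ.toReal / L) := by gcongr
          _ = _ := by field_simp

end weak


/-! ### Weak gradients and closedness of W^{1,p}_0 -/

section weakgrad

variable {d m : ℕ} {A : Set (Euc d)} {p : ℝ}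

theorem MemLp.integrable_ofReal {α F : Type*} [MeasurableSpace α] {μ : Measure α} [IsFiniteMeasure μ]
    [NormedAddCommGroup F] (hp : 1 < p) {f : α → F} (hf : MemLp f (ENNReal.ofReal p) μ) :
    Integrable f μ :=
  hf.integrable (by simpa using hp.le)

/-- On a finite measure space `L^p` convergence implies `L¹` convergence, and a bounded factor
preserves it. This passes to the limit in the integration-by-parts formula. -/
theorem tendsto_integral_smul_of_lp {α F : Type*} [MeasurableSpace α] {μ : Measure α}
    [IsFiniteMeasure μ] [NormedAddCommGroup F] [NormedSpace ℝ F] (hp : 1 < p) {a : α → ℝ} {C : ℝ}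
    (ham : AEStronglyMeasurable a μ) (ha : ∀ x, ‖a x‖ ≤ C) {g : ℕ → α → F} {g₀ : α → F}
    (hg : ∀ k, MemLp (g k) (ENNReal.ofReal p) μ) (hg₀ : MemLp g₀ (ENNReal.ofReal p) μ)
    (h : Tendsto (fun k => ∫⁻ x, ‖g k x - g₀ x‖ₑ ^ p ∂μ) atTop (𝓝 0)) :
    Tendsto (fun k => ∫ x, a x • g k x ∂μ) atTop (𝓝 (∫ x, a x • g₀ x ∂μ)) := by
  have hp0 : 0 < p := by linarith
  refine tendsto_integral_of_L1 _ (ham.smul hg₀.1)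
    (Eventually.of_forall fun k => (MemLp.integrable_ofReal hp (hg k)).bdd_smul C ham
      (Eventually.of_forall ha)) ?_
  have h1 : ∀ k, ∫⁻ x, ‖a x • g k x - a x • g₀ x‖ₑ ∂μ ≤ ENNReal.ofReal C *
      (eLpNorm (fun x => g k x - g₀ x) (ENNReal.ofReal p) μ
        * μ univ ^ (1 / (1 : ℝ≥0∞).toReal - 1 / (ENNReal.ofReal p).toReal)) := by
    intro k
    calc ∫⁻ x, ‖a x • g k x - a x • g₀ x‖ₑ ∂μ ≤ ∫⁻ x, ENNReal.ofReal C * ‖g k x - g₀ x‖ₑ ∂μ := by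
          refine lintegral_mono fun x => ?_
          rw [← smul_sub, enorm_smul]
          gcongr
          rw [← ofReal_norm]
          exact ENNReal.ofReal_le_ofReal (ha x)
      _ ≤ _ := by
          rw [lintegral_const_mul' _ _ (by finiteness)]
          gcongr
          rw [← eLpNorm_one_eq_lintegral_enorm]
          exact eLpNorm_le_eLpNorm_mul_rpow_measure_univ (by simpa using hp.le)
            ((hg k).1.sub hg₀.1)
  have h2 := (tendsto_eLpNorm_zero_iff hp0).2 h
  refine tendsto_of_tendsto_of_tendsto_of_le_of_le tendsto_const_nhds ?_ (fun _ => zero_le) h1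
  have hfin : μ univ ^ (1 / (1 : ℝ≥0∞).toReal - 1 / (ENNReal.ofReal p).toReal) ≠ ⊤ := by
    refine ENNReal.rpow_ne_top_of_nonneg ?_ (measure_ne_top _ _)
    rw [ENNReal.toReal_ofReal hp0.le]
    simp only [ENNReal.toReal_one, div_one, sub_nonneg, one_div]
    exact inv_le_one_of_one_le₀ hp.le
  have h3 := ENNReal.Tendsto.const_mul (a := ENNReal.ofReal C)
    (ENNReal.Tendsto.mul_const h2 (Or.inr hfin)) (Or.inr ENNReal.ofReal_ne_top)
  simpa using h3

theorem IsTest.integral_by_parts {φ : Euc d → Euc m} (hφ : IsTest A φ) {ψ : Euc d → ℝ}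
    (hψ : IsTest A ψ) (v : Euc d) :
    ∫ x in A, (fderiv ℝ ψ x v) • φ x = - ∫ x in A, ψ x • fderiv ℝ φ x v := by
  have e1 : ∫ x in A, (fderiv ℝ ψ x v) • φ x = ∫ x, (fderiv ℝ ψ x v) • φ x :=
    setIntegral_eq_integral_of_forall_compl_eq_zero fun x hx => by rw [hφ.eq_zero hx, smul_zero]
  have e2 : ∫ x in A, ψ x • fderiv ℝ φ x v = ∫ x, ψ x • fderiv ℝ φ x v :=
    setIntegral_eq_integral_of_forall_compl_eq_zero fun x hx => by rw [hψ.eq_zero hx, zero_smul]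
  have hc1 : Continuous fun x => fderiv ℝ ψ x v := hψ.continuous_fderiv.clm_apply continuous_const
  have hc2 : Continuous fun x => fderiv ℝ φ x v := hφ.continuous_fderiv.clm_apply continuous_const
  rw [e1, e2, integral_smul_fderiv_eq_neg_fderiv_smul_of_integrable (𝕜 := ℝ), neg_neg]
  · exact (hc1.smul hφ.1.continuous).integrable_of_hasCompactSupport hφ.2.1.smul_left
  · exact (hψ.1.continuous.smul hc2).integrable_of_hasCompactSupport hψ.2.1.smul_right
  · exact (hψ.1.continuous.smul hφ.1.continuous).integrable_of_hasCompactSupport hψ.2.1.smul_right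
  · exact fun x _ => hψ.differentiable x
  · exact fun x _ => hφ.differentiable x

/-- The strong limit of test functions in `W^{1,p}` has a weak gradient. -/
theorem isWeakGrad_of_tendsto (hp : 1 < p) (hA : volume A < ⊤) {φ : ℕ → Euc d → Euc m}
    (hφ : ∀ k, IsTest A (φ k)) {w : Euc d → Euc m} {V : Euc d → (Euc d →L[ℝ] Euc m)}
    (hw : MemLp w (ENNReal.ofReal p) (volume.restrict A))
    (hV : MemLp V (ENNReal.ofReal p) (volume.restrict A))
    (h1 : Tendsto (fun k => ∫⁻ x in A, ‖φ k x - w x‖ₑ ^ p) atTop (𝓝 0))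
    (h2 : Tendsto (fun k => ∫⁻ x in A, ‖fderiv ℝ (φ k) x - V x‖ₑ ^ p) atTop (𝓝 0)) :
    IsWeakGrad A p w V := by
  have hp0 : 0 < p := by linarith
  have : IsFiniteMeasure (volume.restrict A) := ⟨by simpa using hA⟩
  refine ⟨hw, hV, fun ψ hψ1 hψ2 hψ3 v => ?_⟩
  have hψ : IsTest A ψ := ⟨hψ1, hψ2, hψ3⟩
  have hc1 : Continuous fun x => fderiv ℝ ψ x v := hψ.continuous_fderiv.clm_apply continuous_const
  obtain ⟨C₁, hC₁⟩ := hc1.bounded_above_of_compact_support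
    ((hψ2.fderiv ℝ).comp_left (g := fun z : Euc d →L[ℝ] ℝ => z v) (by simp))
  obtain ⟨C₂, hC₂⟩ := hψ1.continuous.bounded_above_of_compact_support hψ2
  have l1 := tendsto_integral_smul_of_lp hp hc1.aestronglyMeasurable hC₁
    (fun k => (hφ k).memLp _ _) hw h1
  have h3 : Tendsto (fun k => ∫⁻ x in A, ‖fderiv ℝ (φ k) x v - V x v‖ₑ ^ p) atTop (𝓝 0) := by
    have h4 := ENNReal.Tendsto.const_mul (a := ‖v‖ₑ ^ p) h2 (Or.inr (by finiteness))
    rw [mul_zero] at h4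
    refine tendsto_of_tendsto_of_tendsto_of_le_of_le tendsto_const_nhds h4 (fun _ => zero_le) fun k => ?_
    rw [← lintegral_const_mul' _ _ (by finiteness)]
    refine lintegral_mono fun x => ?_
    rw [← ENNReal.mul_rpow_of_nonneg _ _ hp0.le, mul_comm]
    gcongr
    exact (fderiv ℝ (φ k) x - V x).le_opENorm v
  have hev : ∀ {U : Euc d → (Euc d →L[ℝ] Euc m)}, MemLp U (ENNReal.ofReal p) (volume.restrict A) →
      MemLp (fun x => U x v) (ENNReal.ofReal p) (volume.restrict A) := fun hU =>
    (ContinuousLinearMap.apply ℝ (Euc m) v).comp_memLp' hU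
  have l2 := tendsto_integral_smul_of_lp hp hψ1.continuous.aestronglyMeasurable hC₂
    (fun k => hev ((hφ k).memLp_fderiv _ _)) (hev hV) h3
  refine tendsto_nhds_unique l1 ?_
  simp only [fun k => (hφ k).integral_by_parts hψ v]
  exact l2.neg

/-- The difference of two weak gradients integrates to zero against every scalar test function, so
the fundamental lemma of the calculus of variations applies. -/
theorem IsWeakGrad.ae_eq (hp : 1 < p) (hAo : IsOpen A) (hA : volume A < ⊤) {u : Euc d → Euc m}
    {V V' : Euc d → (Euc d →L[ℝ] Euc m)} (h : IsWeakGrad A p u V) (h' : IsWeakGrad A p u V') :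
    V =ᵐ[volume.restrict A] V' := by
  have : IsFiniteMeasure (volume.restrict A) := ⟨by simpa using hA⟩
  have hi : IntegrableOn (fun x => V x - V' x) A :=
    MemLp.integrable_ofReal hp (h.memLp_grad.sub h'.memLp_grad)
  have key := hAo.ae_eq_zero_of_integral_contDiff_smul_eq_zero (μ := volume)
    (f := fun x => V x - V' x) hi.locallyIntegrableOn fun ψ hψ1 hψ2 hψ3 => by
    have hψ : IsTest A ψ := ⟨hψ1, hψ2, hψ3⟩
    obtain ⟨C, hC⟩ := hψ1.continuous.bounded_above_of_compact_support hψ2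
    have hb : ∀ {U : Euc d → (Euc d →L[ℝ] Euc m)}, MemLp U (ENNReal.ofReal p) (volume.restrict A) →
        IntegrableOn (fun x => ψ x • U x) A := fun hU =>
      (MemLp.integrable_ofReal hp hU).bdd_smul C hψ1.continuous.aestronglyMeasurable
        (Eventually.of_forall hC)
    have e2 : ∫ x, ψ x • (V x - V' x) = ∫ x in A, ψ x • (V x - V' x) :=
      (setIntegral_eq_integral_of_forall_compl_eq_zero fun x hx => by
        rw [hψ.eq_zero hx]
        exact zero_smul ℝ (V x - V' x)).symm
    rw [e2]
    simp only [smul_sub]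
    rw [integral_sub (hb h.memLp_grad) (hb h'.memLp_grad), sub_eq_zero]
    ext1 v
    rw [ContinuousLinearMap.integral_apply (hb h.memLp_grad),
      ContinuousLinearMap.integral_apply (hb h'.memLp_grad)]
    exact neg_injective ((h.integral_eq ψ hψ1 hψ2 hψ3 v).symm.trans
      (h'.integral_eq ψ hψ1 hψ2 hψ3 v))
  rw [Filter.EventuallyEq, ae_restrict_iff' hAo.measurableSet]
  filter_upwards [key] with x hx hxA
  exact sub_eq_zero.1 (hx hxA)

theorem IsWeakGrad.congr {u u' : Euc d → Euc m} {V : Euc d → (Euc d →L[ℝ] Euc m)}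
    (h : IsWeakGrad A p u V) (huu' : u =ᵐ[volume.restrict A] u') : IsWeakGrad A p u' V := by
  refine ⟨h.memLp.ae_eq huu', h.memLp_grad, fun φ h1 h2 h3 v => ?_⟩
  rw [← h.integral_eq φ h1 h2 h3 v]
  refine integral_congr_ae ?_
  filter_upwards [huu'] with x hx
  rw [hx]

/-- Frees membership in `W^{1,p}_0` from the particular representative chosen by `weakGrad`: by
uniqueness, any weak gradient may serve as the limit of the gradients. -/
theorem memWZero_iff (hp : 1 < p) (hAo : IsOpen A) (hA : volume A < ⊤) {w : Euc d → Euc m} :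
    MemWZero A p w ↔ ∃ V, IsWeakGrad A p w V ∧ ∃ φ : ℕ → Euc d → Euc m, (∀ n, IsTest A (φ n)) ∧
      Tendsto (fun k => ∫⁻ x in A, ‖φ k x - w x‖ₑ ^ p) atTop (𝓝 0) ∧
      Tendsto (fun k => ∫⁻ x in A, ‖fderiv ℝ (φ k) x - V x‖ₑ ^ p) atTop (𝓝 0) := by
  have hp0 : 0 < p := by linarith
  constructor
  · rintro ⟨hw, φ, h1, h2, h3⟩
    refine ⟨weakGrad A p w, ?_, φ, h1, (tendsto_eLpNorm_zero_iff hp0).1 h2,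
      (tendsto_eLpNorm_zero_iff hp0).1 h3⟩
    rw [weakGrad, dif_pos hw]
    exact hw.choose_spec
  · rintro ⟨V, hV, φ, h1, h2, h3⟩
    have hw : MemW A p w := ⟨V, hV⟩
    refine ⟨hw, φ, h1, (tendsto_eLpNorm_zero_iff hp0).2 h2, (tendsto_eLpNorm_zero_iff hp0).2 ?_⟩
    refine h3.congr fun k => lintegral_congr_ae ?_
    have h4 : IsWeakGrad A p w (weakGrad A p w) := by
      rw [weakGrad, dif_pos hw]
      exact hw.choose_spec
    filter_upwards [hV.ae_eq hp hAo hA h4] with x hx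
    rw [hx]

theorem MemWZero.congr (hp : 1 < p) (hAo : IsOpen A) (hA : volume A < ⊤) {w w' : Euc d → Euc m}
    (h : MemWZero A p w) (hww' : w =ᵐ[volume.restrict A] w') : MemWZero A p w' := by
  obtain ⟨V, hV, φ, h1, h2, h3⟩ := (memWZero_iff hp hAo hA).1 h
  refine (memWZero_iff hp hAo hA).2 ⟨V, hV.congr hww', φ, h1, ?_, h3⟩
  refine h2.congr fun k => lintegral_congr_ae ?_
  filter_upwards [hww'] with x hx
  rw [hx]

/-- A strong `L^p` limit of test functions with bounded gradients belongs to `W^{1,p}_0`. -/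
theorem memWZero_of_tendsto (hp : 1 < p) (hAo : IsOpen A) (hA : volume A < ⊤)
    {v : ℕ → Euc d → Euc m} (hv : ∀ k, IsTest A (v k)) {C : ℝ}
    (hC : ∀ k, ∫⁻ x, ‖fderiv ℝ (v k) x‖ₑ ^ p ≤ ENNReal.ofReal C) {w : Euc d → Euc m}
    (hw : MemLp w (ENNReal.ofReal p) (volume.restrict A))
    (h1 : Tendsto (fun k => ∫⁻ x in A, ‖v k x - w x‖ₑ ^ p) atTop (𝓝 0)) : MemWZero A p w := by
  have hp0 : 0 < p := by linarith
  have hP1 : 1 ≤ ENNReal.ofReal p := by simpa using hp.le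
  have : Fact (1 ≤ ENNReal.ofReal p) := ⟨hP1⟩
  obtain ⟨φ, hφ, hcauchy⟩ := exists_convexHull_cauchy hp hv hC
  have hφt : ∀ k, IsTest A (φ k) := by
    intro k
    have h1 : v '' Ici k ⊆ {φ : Euc d → Euc m | IsTest A φ} := by
      rintro _ ⟨j, -, rfl⟩; exact hv j
    exact convexHull_min h1 (convex_isTest A) (hφ k)
  have hφw : Tendsto (fun k => eLpNorm (fun x => φ k x - w x) (ENNReal.ofReal p) (volume.restrict A))
      atTop (𝓝 0) := by
    rw [ENNReal.tendsto_atTop_zero]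
    intro τ hτ
    obtain ⟨n, hn⟩ := ENNReal.tendsto_atTop_zero.1 ((tendsto_eLpNorm_zero_iff hp0).2 h1) τ hτ
    refine ⟨n, fun k hk => ?_⟩
    -- An `L^p` ball around `w` is convex, so it contains the hull of every tail that it contains.
    -- Hence passing to convex combinations does not change the `L^p` limit.
    let B : Set (Euc d → Euc m) := {ψ | AEStronglyMeasurable ψ (volume.restrict A) ∧
      eLpNorm (fun x => ψ x - w x) (ENNReal.ofReal p) (volume.restrict A) ≤ τ}
    have hB : Convex ℝ B := by
      intro ψ hψ χ hχ a b ha hb hab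
      refine ⟨(hψ.1.const_smul a).add (hχ.1.const_smul b), ?_⟩
      have e : (fun x => (a • ψ + b • χ) x - w x)
          = a • (fun x => ψ x - w x) + b • (fun x => χ x - w x) := by
        ext1 x
        have : w x = a • w x + b • w x := by rw [← add_smul, hab, one_smul]
        simp only [Pi.add_apply, Pi.smul_apply, smul_sub]
        nth_rw 1 [this]
        abel
      rw [e]
      refine (eLpNorm_add_le ((hψ.1.sub hw.1).const_smul a) ((hχ.1.sub hw.1).const_smul b) hP1).trans ?_
      rw [eLpNorm_const_smul, eLpNorm_const_smul]
      calc _ ≤ ‖a‖ₑ * τ + ‖b‖ₑ * τ := by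
            gcongr
            · exact hψ.2
            · exact hχ.2
        _ = τ := by
            rw [← add_mul, Real.enorm_eq_ofReal ha, Real.enorm_eq_ofReal hb,
              ← ENNReal.ofReal_add ha hb, hab, ENNReal.ofReal_one, one_mul]
    have hsub : v '' Ici k ⊆ B := by
      rintro _ ⟨j, hj, rfl⟩
      exact ⟨(hv j).1.continuous.aestronglyMeasurable, hn j (hk.trans hj)⟩
    exact (convexHull_min hsub hB (hφ k)).2
  have hmem : ∀ k, MemLp (fderiv ℝ (φ k)) (ENNReal.ofReal p) (volume : Measure (Euc d)) := fun k =>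
    (hφt k).memLp_fderiv _ _
  have hcs : CauchySeq fun k => (hmem k).toLp (fderiv ℝ (φ k)) := by
    rw [EMetric.cauchySeq_iff]
    intro τ hτ
    obtain ⟨τ', hτ'0, hτ'⟩ := exists_between hτ
    obtain ⟨n, hn⟩ := hcauchy (τ' ^ p) (ENNReal.rpow_pos_of_nonneg hτ'0 hp0.le)
    refine ⟨n, fun j hj k hk => ?_⟩
    rw [Lp.edist_toLp_toLp]
    refine lt_of_le_of_lt ?_ hτ'
    rw [← ENNReal.rpow_le_rpow_iff hp0, eLpNorm_ofReal_rpow hp0]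
    exact hn j hj k hk
  obtain ⟨V, hV⟩ := cauchySeq_tendsto_of_complete hcs
  have hV1 : V = (Lp.memLp V).toLp V := (Lp.toLp_coeFn V _).symm
  rw [hV1] at hV
  have hV2 := (tendsto_eLpNorm_zero_iff hp0).1
    ((Lp.tendsto_Lp_iff_tendsto_eLpNorm'' (fun k => fderiv ℝ (φ k)) hmem V (Lp.memLp V)).1 hV)
  have hV3 : Tendsto (fun k => ∫⁻ x in A, ‖fderiv ℝ (φ k) x - V x‖ₑ ^ p) atTop (𝓝 0) :=
    tendsto_of_tendsto_of_tendsto_of_le_of_le tendsto_const_nhds hV2 (fun _ => zero_le)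
      fun k => setLIntegral_le_lintegral _ _
  have hφw' := (tendsto_eLpNorm_zero_iff hp0).1 hφw
  exact (memWZero_iff hp hAo hA).2 ⟨V, isWeakGrad_of_tendsto hp hA hφt hw
    ((Lp.memLp V).mono_measure Measure.restrict_le_self) hφw' hV3, φ, hφt, hφw', hV3⟩

end weakgrad


/-! ### Smooth approximation of W^{1,p}_loc functions -/

section approx

variable {d m : ℕ} {p : ℝ}

theorem two_rpow_ne_top (p : ℝ) : (2 : ℝ≥0∞) ^ p ≠ ⊤ := by finiteness

/-- Continuity of translations in `L^p`. -/
theorem exists_shiftInt_le {F : Type*} [NormedAddCommGroup F] [NormedSpace ℝ F] (hp : 1 < p)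
    {V : Euc d → F} (hV : MemLp V (ENNReal.ofReal p) volume) (hVm : StronglyMeasurable V)
    {τ : ℝ≥0∞} (hτ : 0 < τ) : ∃ s : ℝ, 0 < s ∧ s ≤ 1 ∧ ∀ h, ‖h‖ ≤ s → shiftInt p V h ≤ τ := by
  have hp0 : 0 < p := by linarith
  wlog hτt : τ ≠ ⊤ generalizing τ
  · obtain ⟨s, h1, h2, h3⟩ := this one_pos (by simp)
    exact ⟨s, h1, h2, fun h hh => (h3 h hh).trans (by rw [not_not.1 hτt]; exact le_top)⟩
  have h2t := two_rpow_ne_top p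
  have h20 : (2 : ℝ≥0∞) ^ p ≠ 0 := by simp [ENNReal.rpow_eq_zero_iff]
  -- `V` is replaced by a compactly supported continuous `K`. The denominator is the total constant
  -- obtained when the error `V - K` and the increments of `K` are both bounded by `τ'`.
  set τ' := τ / (2 ^ p * (2 ^ p * 2) + 2 ^ p) with hτ'
  have hden0 : (2 : ℝ≥0∞) ^ p * (2 ^ p * 2) + 2 ^ p ≠ 0 := by simp [h20]
  have hdent : (2 : ℝ≥0∞) ^ p * (2 ^ p * 2) + 2 ^ p ≠ ⊤ := by finiteness
  have hτ'0 : 0 < τ' := ENNReal.div_pos hτ.ne' hdent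
  have hτ't : τ' ≠ ⊤ := ENNReal.div_ne_top hτt hden0
  obtain ⟨K, hKc, hKe, hKcont, -⟩ := hV.exists_hasCompactSupport_eLpNorm_sub_le
    ENNReal.ofReal_ne_top (ε := τ' ^ p⁻¹) (by
      exact (ENNReal.rpow_pos hτ'0 hτ't).ne')
  have hKe' : ∫⁻ x, ‖V x - K x‖ₑ ^ p ≤ τ' := by
    have := ENNReal.rpow_le_rpow hKe hp0.le
    rw [eLpNorm_ofReal_rpow hp0, ← ENNReal.rpow_mul, inv_mul_cancel₀ hp0.ne', ENNReal.rpow_one] at this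
    exact this
  obtain ⟨R, hR⟩ := hKc.isCompact.isBounded.subset_closedBall (0 : Euc d)
  have hball : volume (Metric.closedBall (0 : Euc d) (R + 1)) ≠ ⊤ := measure_closedBall_lt_top.ne
  have huc : UniformContinuous K := hKc.uniformContinuous_of_continuous hKcont
  obtain ⟨c, hc0, -, hc⟩ := exists_rpow_mul_lt hp0
    (volume (Metric.closedBall (0 : Euc d) (R + 1))).toReal (ENNReal.toReal_pos hτ'0.ne' hτ't)
  obtain ⟨s, hs0, hs⟩ := Metric.uniformContinuous_iff.1 huc c hc0
  refine ⟨min (s / 2) 1, by positivity, min_le_right _ _, fun h hh => ?_⟩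
  have hK : shiftInt p K h ≤ τ' := by
    calc shiftInt p K h
        ≤ ∫⁻ x, (Metric.closedBall (0 : Euc d) (R + 1)).indicator (fun _ => ENNReal.ofReal (c ^ p)) x := by
          refine lintegral_mono fun x => ?_
          by_cases hx : x ∈ Metric.closedBall (0 : Euc d) (R + 1)
          · rw [indicator_of_mem hx, ← ofReal_norm,
              ENNReal.ofReal_rpow_of_nonneg (norm_nonneg _) hp0.le]
            gcongr
            have := hs (a := x + h) (b := x) (by
              rw [dist_eq_norm, add_sub_cancel_left]
              linarith [min_le_left (s / 2) 1])
            rw [dist_eq_norm] at this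
            exact this.le
          · have hx' : R + 1 < ‖x‖ := by simpa using hx
            have h1 : K x = 0 := image_eq_zero_of_notMem_tsupport fun hm => by
              have := hR hm; simp at this; linarith
            have h2 : K (x + h) = 0 := image_eq_zero_of_notMem_tsupport fun hm => by
              have h3 := hR hm; simp only [mem_closedBall_zero_iff] at h3
              have h4 := norm_sub_le (x + h) h
              rw [add_sub_cancel_right] at h4
              linarith [min_le_right (s / 2) 1]
            simp [h1, h2, hp0]
      _ = ENNReal.ofReal (c ^ p * (volume (Metric.closedBall (0 : Euc d) (R + 1))).toReal) := by
          rw [lintegral_indicator measurableSet_closedBall, setLIntegral_const,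
            ENNReal.ofReal_mul (by positivity), ENNReal.ofReal_toReal hball]
      _ ≤ τ' := ENNReal.ofReal_le_of_le_toReal hc.le
  calc shiftInt p V h ≤ _ := shiftInt_le_of_sub hp hVm hKcont.stronglyMeasurable h
    _ ≤ 2 ^ p * (2 ^ p * (2 * τ') + τ') := by gcongr
    _ = τ' * (2 ^ p * (2 ^ p * 2) + 2 ^ p) := by ring
    _ = τ := ENNReal.div_mul_cancel hden0 hdent

/-- The mollification error is an average, with weight `η`, of translation integrals over steps of
length at most `σ`, so smallness of the latter passes to it. -/
theorem IsMollifier.lintegral_moll_sub_le {F : Type*} [NormedAddCommGroup F] [NormedSpace ℝ F]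
    [CompleteSpace F] {η : Euc d → ℝ} (hη : IsMollifier η 1) (hp : 1 < p) {V : Euc d → F}
    (hV : Integrable V) (hVm : StronglyMeasurable V) {s : ℝ} {τ : ℝ≥0∞}
    (hs : ∀ h, ‖h‖ ≤ s → shiftInt p V h ≤ τ) {σ : ℝ} (hσ0 : 0 < σ) (hσ : σ ≤ s) :
    ∫⁻ x, ‖moll η σ V x - V x‖ₑ ^ p ≤ τ := by
  calc _ ≤ _ := moll_sub_lintegral_le hp hη hV hVm hσ0.ne'
    _ ≤ ∫⁻ ζ, ‖η ζ‖ₑ * τ := by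
      refine lintegral_mono fun ζ => ?_
      by_cases hζ : ‖ζ‖ ≤ 1
      · gcongr
        refine hs _ ?_
        rw [norm_smul, Real.norm_of_nonneg hσ0.le]
        nlinarith
      · rw [hη.eq_zero ζ (not_le.1 hζ)]; simp
    _ = τ := by
      rw [lintegral_mul_const _ hη.contDiff.continuous.enorm.measurable, hη.lintegral_enorm, one_mul]

/-- The gradient of a mollified Sobolev function is the mollified weak gradient. -/
theorem IsWeakGrad.fderiv_moll {η : Euc d → ℝ} (hη : IsMollifier η 1) (hp : 1 < p) {U : Set (Euc d)}
    (hU : MeasurableSet U) (hUf : volume U < ⊤) {g : Euc d → Euc m} {V V₁ : Euc d → (Euc d →L[ℝ] Euc m)}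
    (h : IsWeakGrad U p g V) (hV₁ : V =ᵐ[volume.restrict U] V₁) {σ : ℝ} (hσ : 0 < σ) {x : Euc d}
    (hx : Metric.closedBall x σ ⊆ U) :
    fderiv ℝ (moll η σ (U.indicator g)) x = moll η σ (U.indicator V₁) x := by
  have : IsFiniteMeasure (volume.restrict U) := ⟨by simpa using hUf⟩
  have hgi : Integrable (U.indicator g) :=
    (integrable_indicator_iff hU).2 (MemLp.integrable_ofReal hp h.memLp)
  have hVi : Integrable (U.indicator V₁) :=
    (integrable_indicator_iff hU).2 ((MemLp.integrable_ofReal hp h.memLp_grad).congr hV₁)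
  have cov : ∀ H : Euc d → Euc m, ∫ ζ, H (x - σ • ζ)
      = |(σ ^ Module.finrank ℝ (Euc d))⁻¹| • ∫ y, H y := fun H => by
    rw [Measure.integral_comp_smul volume (fun ζ => H (x - ζ)), integral_sub_left_eq_self]
  -- The rescaled kernel centred at `x`, up to normalization. It is supported in the closed ball of
  -- radius `σ` around `x`, hence in `U`, and is an admissible test function for the weak gradient.
  let ψ : Euc d → ℝ := fun y => η (σ⁻¹ • (x - y))
  have hψc : ContDiff ℝ ∞ ψ := hη.contDiff.comp (by fun_prop)
  have hψs : tsupport ψ ⊆ Metric.closedBall x σ := by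
    refine closure_minimal (fun y hy => ?_) Metric.isClosed_closedBall
    by_contra hy'
    refine hy (hη.eq_zero _ ?_)
    rw [Metric.mem_closedBall, dist_comm, dist_eq_norm, not_le] at hy'
    rw [norm_smul, Real.norm_of_nonneg (by positivity), ← div_eq_inv_mul, lt_div_iff₀ hσ]
    linarith
  have hψk : HasCompactSupport ψ :=
    (isCompact_closedBall x σ).of_isClosed_subset (isClosed_tsupport _) hψs
  have hψd : ∀ y e, fderiv ℝ ψ y e = - (σ⁻¹ * fderiv ℝ η (σ⁻¹ • (x - y)) e) := by
    intro y e
    have h1 : HasFDerivAt (fun y : Euc d => σ⁻¹ • (x - y))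
        (σ⁻¹ • (0 - ContinuousLinearMap.id ℝ (Euc d))) y :=
      ((hasFDerivAt_const x y).sub (hasFDerivAt_id y)).const_smul σ⁻¹
    have h2 := ((hη.contDiff.differentiable (by simp) (σ⁻¹ • (x - y))).hasFDerivAt).comp y h1
    have h3 : fderiv ℝ ψ y = _ := h2.fderiv
    rw [h3]
    simp
  have hscale : ∀ ζ, σ⁻¹ • (x - (x - σ • ζ)) = ζ := fun ζ => by
    rw [sub_sub_cancel, smul_smul, inv_mul_cancel₀ hσ.ne', one_smul]
  ext1 e
  rw [(moll_hasFDerivAt hη hgi hσ.ne' x).fderiv, smul_apply,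
    ContinuousLinearMap.integral_apply (integrable_moll_fderiv_integrand hη hgi hσ.ne' x), moll,
    ContinuousLinearMap.integral_apply (integrable_moll_integrand hη hVi hσ.ne' x)]
  have e1 := cov fun y => fderiv ℝ η (σ⁻¹ • (x - y)) e • U.indicator g y
  have e2 := cov fun y => ψ y • U.indicator V₁ y e
  simp only [hscale, ψ] at e1 e2
  simp only [ContinuousLinearMap.smulRight_apply, smul_apply]
  rw [e1, e2, smul_comm]
  congr 1
  have e3 := h.integral_eq ψ hψc hψk (hψs.trans hx) e
  have e4 : ∫ y, fderiv ℝ η (σ⁻¹ • (x - y)) e • U.indicator g y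
      = ∫ y in U, fderiv ℝ η (σ⁻¹ • (x - y)) e • g y := by
    rw [← integral_indicator hU]
    congr 1; ext1 y
    by_cases hy : y ∈ U <;> simp [hy]
  have e5 : ∫ y, η (σ⁻¹ • (x - y)) • U.indicator V₁ y e = ∫ y in U, ψ y • V y e := by
    rw [setIntegral_congr_ae₀ (g := fun y => ψ y • V₁ y e) hU.nullMeasurableSet
      ((ae_restrict_iff' hU).1 (hV₁.mono fun y hy => by rw [hy])), ← integral_indicator hU]
    congr 1; ext1 y
    by_cases hy : y ∈ U <;> simp [hy, ψ]
  rw [e4, e5, ← neg_eq_iff_eq_neg.2 e3.symm.symm]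
  rw [← integral_smul, ← integral_neg]
  congr 1; ext1 y
  rw [hψd, neg_smul, neg_neg, mul_smul]

theorem memLp_indicator_of_restrict {α F : Type*} [MeasurableSpace α] {μ : Measure α}
    [NormedAddCommGroup F] {q : ℝ≥0∞} {U : Set α} (hU : MeasurableSet U) {f : α → F}
    (hf : MemLp f q (μ.restrict U)) : MemLp (U.indicator f) q μ :=
  (memLp_indicator_iff_restrict hU).2 hf

/-- A `W^{1,p}_loc` function coincides on a ball with an `L^p` function whose mollifications have
mollified gradients. -/
theorem MemWLoc.exists_local_extension (hp : 1 < p) {g : Euc d → Euc m} (hg : MemWLoc p g)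
    (hgm : StronglyMeasurable g) (R : ℝ) :
    ∃ (g' : Euc d → Euc m) (W : Euc d → (Euc d →L[ℝ] Euc m)),
      (StronglyMeasurable g' ∧ MemLp g' (ENNReal.ofReal p) volume ∧ Integrable g') ∧
      (StronglyMeasurable W ∧ MemLp W (ENNReal.ofReal p) volume ∧ Integrable W) ∧
      (∀ x, ‖x‖ < R + 2 → g' x = g x) ∧
      ∀ η : Euc d → ℝ, IsMollifier η 1 → ∀ σ, 0 < σ → σ ≤ 1 → ∀ x, ‖x‖ < R + 1 →
        fderiv ℝ (moll η σ g') x = moll η σ W x := by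
  have hU : MeasurableSet (Metric.ball (0 : Euc d) (R + 2)) := measurableSet_ball
  have hUf : volume (Metric.ball (0 : Euc d) (R + 2)) < ⊤ := measure_ball_lt_top
  have : IsFiniteMeasure (volume.restrict (Metric.ball (0 : Euc d) (R + 2))) := ⟨by simpa using hUf⟩
  obtain ⟨V, hV⟩ := hg (Metric.ball 0 (R + 2)) Metric.isOpen_ball Metric.isBounded_ball
  obtain ⟨V₁, hV₁m, hV₁⟩ := hV.memLp_grad.1
  -- Truncating at radius `R + 2` makes everything globally integrable. A mollification at scale at
  -- most one, evaluated at a point of norm below `R + 1`, does not see the truncation.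
  refine ⟨(Metric.ball (0 : Euc d) (R + 2)).indicator g, (Metric.ball (0 : Euc d) (R + 2)).indicator V₁,
    ⟨hgm.indicator hU, memLp_indicator_of_restrict hU hV.memLp,
      (integrable_indicator_iff hU).2 (MemLp.integrable_ofReal hp hV.memLp)⟩,
    ⟨hV₁m.indicator hU, memLp_indicator_of_restrict hU (hV.memLp_grad.ae_eq hV₁),
      (integrable_indicator_iff hU).2 ((MemLp.integrable_ofReal hp hV.memLp_grad).congr hV₁)⟩,
    fun x hx => indicator_of_mem (mem_ball_zero_iff.2 hx) g, ?_⟩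
  intro η hη σ hσ0 hσ1 x hx
  refine hV.fderiv_moll hη hp hU hUf hV₁ hσ0 fun y hy => ?_
  rw [mem_ball_zero_iff]
  rw [Metric.mem_closedBall, dist_eq_norm] at hy
  have := norm_sub_norm_le y x
  linarith

/-- Approximation of a `W^{1,p}_loc` function by smooth ones, in the sense of difference
quotients. -/
theorem MemWLoc.exists_smooth_approx (hp : 1 < p) {g : Euc d → Euc m} (hg : MemWLoc p g)
    (hgm : StronglyMeasurable g) (R : ℝ) {κ : ℝ≥0∞} (hκ : 0 < κ) :
    ∃ Φ : Euc d → Euc m, ContDiff ℝ ∞ Φ ∧ ∀ h, ‖h‖ ≤ 1 →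
      ∫⁻ x in Metric.ball 0 R, ‖(g (x + h) - Φ (x + h)) - (g x - Φ x)‖ₑ ^ p ≤ ‖h‖ₑ ^ p * κ := by
  have hp0 : 0 < p := by linarith
  have h2t := two_rpow_ne_top p
  have h20 : (2 : ℝ≥0∞) ^ p ≠ 0 := by simp [ENNReal.rpow_eq_zero_iff]
  obtain ⟨g', W, ⟨hg'm, hg'L, hg'i⟩, ⟨hWm, hWL, hWi⟩, hgg', hfd'⟩ :=
    hg.exists_local_extension hp hgm R
  obtain ⟨η, hη⟩ := exists_isMollifier d (zero_lt_one' ℝ)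
  set τ := κ / (2 ^ p * (2 ^ p * 2)) with hτ
  have hden0 : (2 : ℝ≥0∞) ^ p * (2 ^ p * 2) ≠ 0 := by simp [h20]
  have hdent : (2 : ℝ≥0∞) ^ p * (2 ^ p * 2) ≠ ⊤ := by finiteness
  have hτ0 : 0 < τ := ENNReal.div_pos hκ.ne' hdent
  obtain ⟨s, hs0, hs1, hs⟩ := exists_shiftInt_le hp hWL hWm hτ0
  have hsm : ∀ σ, 0 < σ → ContDiff ℝ ∞ (moll η σ g') := fun σ hσ => moll_contDiff hη hg'i hσ.ne'
  have hfd : ∀ σ, 0 < σ → σ ≤ 1 → ∀ x ∈ Metric.ball (0 : Euc d) (R + 1),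
      fderiv ℝ (moll η σ g') x = moll η σ W x := by
    intro σ hσ0 hσ1 x hx
    exact hfd' η hη σ hσ0 hσ1 x (mem_ball_zero_iff.1 hx)
  have hmm : ∀ σ, 0 < σ → StronglyMeasurable (moll η σ W) := fun σ hσ =>
    (moll_contDiff hη hWi hσ.ne').continuous.stronglyMeasurable
  have hgrad : ∀ σ, 0 < σ → σ ≤ s → ∫⁻ x in Metric.ball 0 (R + 1),
      ‖fderiv ℝ (fun x => moll η σ g' x - moll η s g' x) x‖ₑ ^ p ≤ 2 ^ p * (2 * τ) := by
    intro σ hσ0 hσ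
    calc _ = ∫⁻ x in Metric.ball 0 (R + 1), ‖(moll η σ W x - W x) - (moll η s W x - W x)‖ₑ ^ p := by
          refine setLIntegral_congr_fun measurableSet_ball fun x hx => ?_
          rw [fderiv_fun_sub ((hsm σ hσ0).differentiable (by simp) x) ((hsm s hs0).differentiable (by simp) x),
            hfd σ hσ0 (hσ.trans hs1) x hx, hfd s hs0 hs1 x hx, sub_sub_sub_cancel_right]
      _ ≤ ∫⁻ x, ‖(moll η σ W x - W x) - (moll η s W x - W x)‖ₑ ^ p := setLIntegral_le_lintegral _ _
      _ ≤ 2 ^ p * (τ + τ) := by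
          refine (lintegral_le_mul_add h2t (((hmm s hs0).sub hWm).enorm.pow_const p)
            fun x => enorm_sub_rpow_le hp _ _).trans ?_
          gcongr
          · exact hη.lintegral_moll_sub_le hp hWi hWm hs hσ0 hσ
          · exact hη.lintegral_moll_sub_le hp hWi hWm hs hs0 le_rfl
      _ = _ := by rw [two_mul]
  -- `Φ` is the mollification at the fixed scale `s`. For an extra error `e`, `g` is compared with a
  -- finer mollification at scale `σ`: the gradient of the difference of the two mollifications is
  -- small uniformly in `σ`, which gives the factor `|h|^p`, and the remaining error, with no such
  -- factor, is at most `e`. Then `e` is arbitrary.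
  refine ⟨moll η s g', hsm s hs0, fun h hh => ?_⟩
  refine ENNReal.le_of_forall_pos_le_add fun e he _ => ?_
  set τ₂ := (e : ℝ≥0∞) / (2 ^ p * (2 ^ p * 2)) with hτ₂
  have hτ₂0 : 0 < τ₂ := ENNReal.div_pos (by simpa using he.ne') hdent
  obtain ⟨s₂, hs₂0, hs₂1, hs₂⟩ := exists_shiftInt_le hp hg'L hg'm hτ₂0
  set σ := min s s₂ with hσdef
  have hσ0 : 0 < σ := lt_min hs0 hs₂0
  have hdiff := hη.lintegral_moll_sub_le hp hg'i hg'm hs₂ hσ0 (min_le_right _ _)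
  have hm0 : Measurable fun x => ‖moll η σ g' x - g' x‖ₑ ^ p :=
    ((hsm σ hσ0).continuous.stronglyMeasurable.sub hg'm).enorm.pow_const p
  set v := fun x => moll η σ g' x - moll η s g' x with hvdef
  have hvs : ContDiff ℝ ∞ v := (hsm σ hσ0).sub (hsm s hs0)
  calc ∫⁻ x in Metric.ball 0 R, ‖(g (x + h) - moll η s g' (x + h)) - (g x - moll η s g' x)‖ₑ ^ p
      = ∫⁻ x in Metric.ball 0 R, ‖(v (x + h) - v x) -
          ((moll η σ g' (x + h) - g' (x + h)) - (moll η σ g' x - g' x))‖ₑ ^ p := by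
        refine setLIntegral_congr_fun measurableSet_ball fun x hx => ?_
        rw [mem_ball_zero_iff] at hx
        have e1 : g' x = g x := hgg' x (by linarith)
        have e2 : g' (x + h) = g (x + h) := hgg' _ (by linarith [norm_add_le x h])
        rw [e1, e2]
        simp only [hvdef]
        congr 2; abel
    _ ≤ 2 ^ p * ((∫⁻ x in Metric.ball 0 R, ‖v (x + h) - v x‖ₑ ^ p) + ∫⁻ x in Metric.ball 0 R,
          ‖(moll η σ g' (x + h) - g' (x + h)) - (moll η σ g' x - g' x)‖ₑ ^ p) := by
        refine lintegral_le_mul_add h2t ?_ fun x => enorm_sub_rpow_le hp _ _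
        have h0 := (hsm σ hσ0).continuous.stronglyMeasurable.sub hg'm
        exact ((h0.comp_measurable (measurable_id.add_const h)).sub h0).enorm.pow_const p
    _ ≤ 2 ^ p * (‖h‖ₑ ^ p * (2 ^ p * (2 * τ)) + 2 ^ p * (τ₂ + τ₂)) := by
        gcongr
        · refine (lintegral_shift_le_of_contDiff hp (hvs.of_le (by simp)) measurableSet_ball
            measurableSet_ball (S' := Metric.ball 0 (R + 1)) fun x hx t ht => ?_).trans ?_
          · rw [mem_ball_zero_iff] at hx ⊢
            have h1 : ‖t • h‖ ≤ 1 := by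
              rw [norm_smul, Real.norm_of_nonneg ht.1.le]
              nlinarith [ht.2, norm_nonneg h, ht.1]
            linarith [norm_add_le x (t • h)]
          · gcongr
            exact hgrad σ hσ0 (min_le_left _ _)
        · refine (setLIntegral_le_lintegral _ _).trans ?_
          refine (lintegral_le_mul_add h2t hm0 fun x => enorm_sub_rpow_le hp _ _).trans ?_
          gcongr
          rw [lintegral_add_right_eq_self (fun x => ‖moll η σ g' x - g' x‖ₑ ^ p) h]
          exact hdiff
    _ = ‖h‖ₑ ^ p * (τ * (2 ^ p * (2 ^ p * 2))) + τ₂ * (2 ^ p * (2 ^ p * 2)) := by ring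
    _ = _ := by rw [hτ, hτ₂, ENNReal.div_mul_cancel hden0 hdent, ENNReal.div_mul_cancel hden0 hdent]

end approx


/-! ### From bounded energy to test functions with bounded gradients -/

section compactness

variable {d m : ℕ} {p : ℝ} {A Ω : Set (Euc d)}

/-- `{x ∈ A | x + h ∈ A}`. -/
def shiftSet (A : Set (Euc d)) (h : Euc d) : Set (Euc d) := {x | x ∈ A ∧ x + h ∈ A}

theorem shiftSet_subset (A : Set (Euc d)) (h : Euc d) : shiftSet A h ⊆ A := fun _ hx => hx.1

theorem measurableSet_shiftSet (hA : MeasurableSet A) (h : Euc d) :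
    MeasurableSet (shiftSet A h) := hA.inter ((measurable_id.add_const h) hA)

theorem ae_shift {P : Euc d → Prop} (h : ∀ᵐ x, P x) (y : Euc d) : ∀ᵐ x : Euc d, P (x + y) :=
  (measurePreserving_add_right volume y).quasiMeasurePreserving.ae h

/-- Obtained from the smooth approximation with tolerance one: the remainder already has the right
bound, and the smooth part has a bounded derivative on a slightly larger ball. -/
theorem MemWLoc.exists_shift_le (hp : 1 < p) {g : Euc d → Euc m} (hg : MemWLoc p g)
    (hgm : StronglyMeasurable g) (R : ℝ) : ∃ C : ℝ≥0∞, C ≠ ⊤ ∧ ∀ h, ‖h‖ ≤ 1 →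
      ∫⁻ x in Metric.ball 0 R, ‖g (x + h) - g x‖ₑ ^ p ≤ ‖h‖ₑ ^ p * C := by
  have hp0 : 0 < p := by linarith
  obtain ⟨Φ, hΦ, h1⟩ := hg.exists_smooth_approx hp hgm R one_pos
  have hΦm := hΦ.continuous.stronglyMeasurable
  obtain ⟨B, hB⟩ := (isCompact_closedBall (0 : Euc d) (R + 1)).exists_bound_of_continuousOn
    (hΦ.continuous_fderiv (by simp)).continuousOn
  refine ⟨2 ^ p * (1 + ENNReal.ofReal B ^ p * volume (Metric.closedBall (0 : Euc d) (R + 1))), ?_,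
    fun h hh => ?_⟩
  · have := (measure_closedBall_lt_top (μ := volume) (x := (0 : Euc d)) (r := R + 1)).ne
    finiteness
  have hΦh : Measurable fun x => ‖Φ (x + h) - Φ x‖ₑ ^ p :=
    ((hΦm.comp_measurable (measurable_id.add_const h)).sub hΦm).enorm.pow_const p
  calc ∫⁻ x in Metric.ball 0 R, ‖g (x + h) - g x‖ₑ ^ p
      ≤ 2 ^ p * ((∫⁻ x in Metric.ball 0 R, ‖(g (x + h) - Φ (x + h)) - (g x - Φ x)‖ₑ ^ p)
          + ∫⁻ x in Metric.ball 0 R, ‖Φ (x + h) - Φ x‖ₑ ^ p) := by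
        refine lintegral_le_mul_add (two_rpow_ne_top p) hΦh fun x => ?_
        refine le_trans (le_of_eq ?_) (enorm_add_rpow_le hp _ _)
        congr 2; abel
    _ ≤ 2 ^ p * (‖h‖ₑ ^ p * 1 + ‖h‖ₑ ^ p *
          (ENNReal.ofReal B ^ p * volume (Metric.closedBall (0 : Euc d) (R + 1)))) := by
        gcongr
        · exact h1 h hh
        · refine (lintegral_shift_le_of_contDiff hp (hΦ.of_le (by simp)) measurableSet_ball
            measurableSet_closedBall (S' := Metric.closedBall 0 (R + 1)) fun x hx t ht => ?_).trans ?_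
          · rw [mem_ball_zero_iff] at hx
            rw [mem_closedBall_zero_iff]
            have h1 : ‖t • h‖ ≤ 1 := by
              rw [norm_smul, Real.norm_of_nonneg ht.1.le]
              nlinarith [ht.2, norm_nonneg h, ht.1]
            linarith [norm_add_le x (t • h)]
          · gcongr
            rw [← setLIntegral_const]
            refine setLIntegral_mono' measurableSet_closedBall fun x hx => ?_
            gcongr
            rw [← ofReal_norm]
            exact ENNReal.ofReal_le_ofReal (hB x hx)
    _ = _ := by ring

/-- The interior part of the difference-quotient energy. -/
noncomputable def localEnergy (p r ε : ℝ) (u : Euc d → Euc m) (A : Set (Euc d)) : ℝ≥0∞ :=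
  ∫⁻ ζ in Metric.closedBall (0 : Euc d) r, ∫⁻ x in shiftSet A (ε • ζ),
    ‖ε⁻¹ • (u (x + ε • ζ) - u x)‖ₑ ^ p

theorem enorm_smul_sub_rpow (hp : 0 ≤ p) (c : ℝ) (a : Euc m) :
    ‖c • a‖ₑ ^ p = ‖c‖ₑ ^ p * ‖a‖ₑ ^ p := by
  rw [enorm_smul, ENNReal.mul_rpow_of_nonneg _ _ hp]

theorem rpow_enorm_inv_ne_top {ε : ℝ} (hε : 0 < ε) (p : ℝ) : ‖ε⁻¹‖ₑ ^ p ≠ ⊤ :=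
  ENNReal.rpow_ne_top_of_ne_zero (by simpa using hε.ne') (by finiteness)

theorem enorm_inv_mul_enorm_smul {ε : ℝ} (hp : 0 ≤ p) (hε : 0 < ε) (ξ : Euc d) :
    ‖ε⁻¹‖ₑ ^ p * ‖ε • ξ‖ₑ ^ p = ‖ξ‖ₑ ^ p := by
  rw [← ENNReal.mul_rpow_of_nonneg _ _ hp, ← enorm_smul, smul_smul, inv_mul_cancel₀ hε.ne', one_smul]

/-- The lower bound (H0) controls the difference quotients. -/
theorem localEnergy_le_energy (hp : 0 ≤ p) (hA : A ⊆ Ω) (hAm : MeasurableSet A)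
    {f : ℝ → Euc d → Euc d → Euc m → ℝ≥0}
    {r₀ c₀ r₁ ε : ℝ} (hc₀ : 0 < c₀) (hr₁ : r₁ < r₀) {ρ : ℝ → Euc d → ℝ≥0}
    (hρ : Measurable (ρ ε))
    (h0 : ∀ x ∈ Ω, ∀ ξ ∈ Metric.ball (0 : Euc d) r₀, ∀ z : Euc m,
      c₀ * (‖z‖ ^ p - ρ ε ξ) ≤ f ε x ξ z) (u : Euc d → Euc m) :
    localEnergy p r₁ ε u A ≤ ENNReal.ofReal c₀⁻¹ * energy f ε u A +
      volume A * ∫⁻ ξ in Metric.ball (0 : Euc d) r₀, (ρ ε ξ : ℝ≥0∞) := by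
  have hsub : Metric.closedBall (0 : Euc d) r₁ ⊆ Metric.ball 0 r₀ :=
    Metric.closedBall_subset_ball hr₁
  have hρ' : Measurable fun ξ => (ρ ε ξ : ℝ≥0∞) := hρ.coe_nnreal_ennreal
  calc localEnergy p r₁ ε u A
      ≤ ∫⁻ ξ in Metric.closedBall (0 : Euc d) r₁, (ENNReal.ofReal c₀⁻¹ *
          (∫⁻ x in shiftSet A (ε • ξ), (f ε x ξ (ε⁻¹ • (u (x + ε • ξ) - u x)) : ℝ≥0∞))
            + volume A * (ρ ε ξ : ℝ≥0∞)) := by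
        refine setLIntegral_mono' measurableSet_closedBall fun ξ hξ => ?_
        calc ∫⁻ x in shiftSet A (ε • ξ), ‖ε⁻¹ • (u (x + ε • ξ) - u x)‖ₑ ^ p
            ≤ ∫⁻ x in shiftSet A (ε • ξ), (ENNReal.ofReal c₀⁻¹ *
                (f ε x ξ (ε⁻¹ • (u (x + ε • ξ) - u x)) : ℝ≥0∞) + (ρ ε ξ : ℝ≥0∞)) := by
              refine setLIntegral_mono' (measurableSet_shiftSet hAm _) fun x hx => ?_
              have h1 := h0 x (hA hx.1) ξ (hsub hξ) (ε⁻¹ • (u (x + ε • ξ) - u x))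
              set z := ε⁻¹ • (u (x + ε • ξ) - u x)
              rw [← ofReal_norm, ENNReal.ofReal_rpow_of_nonneg (norm_nonneg _) hp,
                ← ENNReal.ofReal_coe_nnreal, ← ENNReal.ofReal_coe_nnreal,
                ← ENNReal.ofReal_mul (by positivity), ← ENNReal.ofReal_add (by positivity) (by positivity)]
              refine ENNReal.ofReal_le_ofReal ?_
              have h2 : ‖z‖ ^ p - ρ ε ξ ≤ c₀⁻¹ * f ε x ξ z := by
                rw [inv_mul_eq_div, le_div_iff₀ hc₀]; linarith
              linarith
          _ ≤ _ := by
              rw [lintegral_add_right _ measurable_const, lintegral_const_mul' _ _ (by finiteness),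
                setLIntegral_const, mul_comm (ρ ε ξ : ℝ≥0∞)]
              gcongr
              exact shiftSet_subset _ _
    _ ≤ _ := by
        rw [lintegral_add_right _ (hρ'.const_mul _), lintegral_const_mul' _ _ (by finiteness),
          lintegral_const_mul _ hρ']
        gcongr
        · exact setLIntegral_le_lintegral _ _


/-- A step of length at most `εr₁ < εr` whose two endpoints are not both in `A` has both of them at
distance less than `εr` from the complement, where `w` vanishes. Such steps contribute nothing. -/
theorem quotEnergy_le_localEnergy (hp : 0 < p) {r r₁ ε : ℝ} (hε : 0 < ε) (hr : r₁ < r)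
    (hAm : MeasurableSet A)
    {w : Euc d → Euc m} (hw : ∀ x, Metric.infDist x Aᶜ < ε * r → w x = 0) :
    quotEnergy p r₁ ε w ≤ localEnergy p r₁ ε w A := by
  have hr0 : ∀ {ζ : Euc d}, ‖ζ‖ ≤ r₁ → ε * ‖ζ‖ < ε * r := fun h => by gcongr; linarith
  refine setLIntegral_mono' measurableSet_closedBall fun ζ hζ => ?_
  rw [mem_closedBall_zero_iff] at hζ
  rw [shiftInt, ← lintegral_const_mul' _ _ (rpow_enorm_inv_ne_top hε p),
    ← lintegral_indicator (measurableSet_shiftSet hAm _)]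
  refine lintegral_mono fun x => ?_
  have hout : ∀ x ∉ A, w x = 0 := fun x hx => hw x (by
    rw [Metric.infDist_zero_of_mem (mem_compl hx)]
    exact lt_of_le_of_lt (by positivity) (hr0 hζ))
  by_cases hx : x ∈ shiftSet A (ε • ζ)
  · rw [indicator_of_mem hx, enorm_smul_sub_rpow hp.le]
  · have hn : ‖ε • ζ‖ = ε * ‖ζ‖ := by rw [norm_smul, Real.norm_of_nonneg hε.le]
    have h12 : w x = 0 ∧ w (x + ε • ζ) = 0 := by
      by_cases hxA : x ∈ A
      · have hxA' : x + ε • ζ ∉ A := fun h => hx ⟨hxA, h⟩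
        refine ⟨hw x ?_, hout _ hxA'⟩
        refine lt_of_le_of_lt (Metric.infDist_le_dist_of_mem (mem_compl hxA')) ?_
        rw [dist_eq_norm, sub_add_cancel_left, norm_neg, hn]
        exact hr0 hζ
      · refine ⟨hout x hxA, hw _ ?_⟩
        refine lt_of_le_of_lt (Metric.infDist_le_dist_of_mem (mem_compl hxA)) ?_
        rw [dist_eq_norm, add_sub_cancel_left, hn]
        exact hr0 hζ
    rw [h12.1, h12.2]; simp [hp]

/-- Mollification with a kernel of radius `εr₁` enlarges the support by at most that amount, so a
margin `ε(r - r₁)` to the complement of `A` remains. Boundedness of `A` gives compactness. -/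
theorem isTest_moll {η : Euc d → ℝ} {r r₁ ε : ℝ} (hη : IsMollifier η r₁) (hε : 0 < ε) (hr : r₁ < r)
    (hAb : Bornology.IsBounded A) {w : Euc d → Euc m} (hwi : Integrable w)
    (hw : ∀ x, Metric.infDist x Aᶜ < ε * r → w x = 0) : IsTest A (moll η ε w) := by
  have hclosed : IsClosed {x : Euc d | ε * (r - r₁) ≤ Metric.infDist x Aᶜ} :=
    isClosed_le continuous_const (Metric.continuous_infDist_pt _)
  have hsub : {x : Euc d | ε * (r - r₁) ≤ Metric.infDist x Aᶜ} ⊆ A := by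
    intro x hx
    by_contra hxA
    have h1 : ε * (r - r₁) ≤ Metric.infDist x Aᶜ := hx
    rw [Metric.infDist_zero_of_mem (mem_compl hxA)] at h1
    have : 0 < ε * (r - r₁) := mul_pos hε (by linarith)
    linarith
  have hts : tsupport (moll η ε w) ⊆ {x : Euc d | ε * (r - r₁) ≤ Metric.infDist x Aᶜ} := by
    refine closure_minimal (fun x hx => ?_) hclosed
    by_contra hx'
    refine hx (moll_eq_zero hη hε fun y hy => hw y ?_)
    have h1 : Metric.infDist x Aᶜ < ε * (r - r₁) := not_le.1 hx'
    have h2 := Metric.infDist_le_infDist_add_dist (s := Aᶜ) (x := y) (y := x)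
    rw [dist_comm] at h2
    linarith
  exact ⟨moll_contDiff hη hwi hε.ne', Metric.isCompact_of_isClosed_isBounded (isClosed_tsupport _)
    (hAb.subset (hts.trans hsub)), hts.trans hsub⟩

/-- Transfers the bound from `u` to `u - g`. The identity for `w` is needed only almost everywhere
in `A`, because a null set stays null after each translation. -/
theorem localEnergy_sub_le (hp : 1 < p) (hAm : MeasurableSet A) {ε r₁ : ℝ}
    {w u g : Euc d → Euc m} (hgm : StronglyMeasurable g)
    (hae : ∀ᵐ x : Euc d, x ∈ A → w x = u x - g x) {G : ℝ≥0∞}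
    (hG : ∀ ζ : Euc d, ‖ζ‖ ≤ r₁ → ∫⁻ x in shiftSet A (ε • ζ), ‖ε⁻¹ • (g (x + ε • ζ) - g x)‖ₑ ^ p ≤ G) :
    localEnergy p r₁ ε w A ≤ 2 ^ p * (localEnergy p r₁ ε u A
        + G * volume (Metric.closedBall (0 : Euc d) r₁)) := by
  have h2 : localEnergy p r₁ ε w A ≤ ∫⁻ ζ in Metric.closedBall (0 : Euc d) r₁, 2 ^ p *
      ((∫⁻ x in shiftSet A (ε • ζ), ‖ε⁻¹ • (u (x + ε • ζ) - u x)‖ₑ ^ p) + G) := by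
    refine setLIntegral_mono' measurableSet_closedBall fun ζ hζ => ?_
    rw [mem_closedBall_zero_iff] at hζ
    have hgmz : Measurable fun x => ‖ε⁻¹ • (g (x + ε • ζ) - g x)‖ₑ ^ p :=
      (((hgm.comp_measurable (measurable_id.add_const (ε • ζ))).sub hgm).const_smul ε⁻¹).enorm.pow_const p
    calc ∫⁻ x in shiftSet A (ε • ζ), ‖ε⁻¹ • (w (x + ε • ζ) - w x)‖ₑ ^ p
        ≤ ∫⁻ x in shiftSet A (ε • ζ), 2 ^ p * (‖ε⁻¹ • (u (x + ε • ζ) - u x)‖ₑ ^ p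
            + ‖ε⁻¹ • (g (x + ε • ζ) - g x)‖ₑ ^ p) := by
          refine setLIntegral_mono_ae' (measurableSet_shiftSet hAm _) ?_
          filter_upwards [hae, ae_shift hae (ε • ζ)] with x h3 h4 hx
          rw [h3 hx.1, h4 hx.2]
          refine le_trans (le_of_eq ?_) (enorm_sub_rpow_le hp _ _)
          rw [← smul_sub]
          congr 3; abel
      _ ≤ _ := by
          refine (lintegral_le_mul_add (two_rpow_ne_top p) hgmz fun x => le_rfl).trans ?_
          gcongr
          exact hG ζ hζ
  refine h2.trans ?_
  rw [lintegral_const_mul' _ _ (two_rpow_ne_top p), lintegral_add_right _ measurable_const,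
    setLIntegral_const]
  rfl

theorem lintegral_shiftSet_quot_le (hp : 0 < p) {g : Euc d → Euc m} {R : ℝ}
    (hR : A ⊆ Metric.ball 0 R) {Cg : ℝ≥0∞} (hgs : ∀ h, ‖h‖ ≤ 1 →
      ∫⁻ x in Metric.ball 0 R, ‖g (x + h) - g x‖ₑ ^ p ≤ ‖h‖ₑ ^ p * Cg) {ε : ℝ} (hε0 : 0 < ε)
    {ζ : Euc d} (hζ : ε * ‖ζ‖ ≤ 1) :
    ∫⁻ x in shiftSet A (ε • ζ), ‖ε⁻¹ • (g (x + ε • ζ) - g x)‖ₑ ^ p ≤ ‖ζ‖ₑ ^ p * Cg := by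
  simp only [enorm_smul_sub_rpow hp.le]
  rw [lintegral_const_mul' _ _ (rpow_enorm_inv_ne_top hε0 p)]
  calc _ ≤ ‖ε⁻¹‖ₑ ^ p * ∫⁻ x in Metric.ball 0 R, ‖g (x + ε • ζ) - g x‖ₑ ^ p := by
        gcongr
        exact (shiftSet_subset _ _).trans hR
    _ ≤ ‖ε⁻¹‖ₑ ^ p * (‖ε • ζ‖ₑ ^ p * Cg) := by
        gcongr
        refine hgs _ ?_
        rwa [norm_smul, Real.norm_of_nonneg hε0.le]
    _ = _ := by rw [← mul_assoc, enorm_inv_mul_enorm_smul hp.le hε0]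

/-- Functions in the Dirichlet class with bounded energy are close to test functions with
bounded gradients, up to the boundary datum. -/
theorem exists_isTest_of_energy_le (hp : 1 < p) (hAΩ : A ⊆ Ω) (hAo : IsOpen A)
    (hAb : Bornology.IsBounded A) {f : ℝ → Euc d → Euc d → Euc m → ℝ≥0}
    (hf : GrowthAssumptions Ω p f) {g : Euc d → Euc m} (hg : MemWLoc p g)
    (hgm : StronglyMeasurable g) {r : ℝ} (hr : 0 < r) {M : ℝ≥0∞} (hM : M ≠ ⊤) :
    ∃ C : ℝ, ∀ᶠ ε in 𝓝[>] (0 : ℝ), ∀ u ∈ dirichletClass Ω p (ε * r) g A, energy f ε u A ≤ M →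
      ∃ v : Euc d → Euc m, IsTest A v ∧ ∫⁻ x, ‖fderiv ℝ v x‖ₑ ^ p ≤ ENNReal.ofReal C ∧
        ∫⁻ x in A, ‖v x - (u x - g x)‖ₑ ^ p ≤ ENNReal.ofReal (C * ε ^ p) := by
  have hp0 : 0 < p := by linarith
  have hAm := hAo.measurableSet
  obtain ⟨-, r₀, hr₀, c₀, hc₀, ρ, ψ, hρm, -, hρ, -, h0, -, -⟩ := hf
  obtain ⟨R, hR⟩ := hAb.subset_ball (0 : Euc d)
  have hAf : volume A < ⊤ := hAb.measure_lt_top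
  have : IsFiniteMeasure (volume.restrict A) := ⟨by simpa using hAf⟩
  -- Smaller than `r₀`, so that (H0) applies on the closed ball, and smaller than `r`, so that the
  -- mollified function is still compactly supported in `A`.
  set r₁ := min r₀ r / 2 with hr₁
  have hmin : 0 < min r₀ r := lt_min hr₀ hr
  have hr₁0 : 0 < r₁ := by positivity
  have hr₁r₀ : r₁ < r₀ := by linarith [min_le_left r₀ r]
  have hr₁r : r₁ < r := by linarith [min_le_right r₀ r]
  obtain ⟨η, hη⟩ := exists_isMollifier d hr₁0
  obtain ⟨C₁, hC₁, hmoll⟩ := hη.exists_const (F := Euc m) hp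
  obtain ⟨Cg, hCg, hgs⟩ := hg.exists_shift_le hp hgm R
  obtain ⟨B, hB1, hB2⟩ := exists_between hρ
  have hρB := eventually_lt_of_limsup_lt hB1
  set G : ℝ≥0∞ := ENNReal.ofReal r₁ ^ p * Cg with hG
  set Q : ℝ≥0∞ := 2 ^ p * ((ENNReal.ofReal c₀⁻¹ * M + volume A * B)
    + G * volume (Metric.closedBall (0 : Euc d) r₁)) with hQ
  have hQt : Q ≠ ⊤ := by
    have h1 := (measure_closedBall_lt_top (μ := volume) (x := (0 : Euc d)) (r := r₁)).ne
    have h2 := hB2.ne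
    have h3 := hAf.ne
    finiteness
  refine ⟨C₁ * Q.toReal, ?_⟩
  have hsmall : ∀ᶠ ε in 𝓝[>] (0 : ℝ), ε * r₁ < 1 := by
    have : Tendsto (fun ε : ℝ => ε * r₁) (𝓝[>] 0) (𝓝 0) := by
      have := (continuous_id.mul_const r₁).tendsto (0 : ℝ)
      simp only [id, zero_mul] at this
      exact this.mono_left nhdsWithin_le_nhds
    exact this.eventually (gt_mem_nhds one_pos)
  filter_upwards [hρB, hsmall, self_mem_nhdsWithin] with ε hερ hε1 hε u hu huM
  have hε0 : 0 < ε := hε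
  -- Outside `S` the boundary condition makes `u - g` vanish only almost everywhere. The indicator
  -- provides a strongly measurable representative that vanishes at every such point.
  set S : Set (Euc d) := {x | x ∈ A ∧ ε * r ≤ Metric.infDist x Aᶜ} with hS
  have hSm : MeasurableSet S := hAm.inter
    (isClosed_le continuous_const (Metric.continuous_infDist_pt _)).measurableSet
  obtain ⟨u₁, hu₁m, hu₁⟩ := hu.1.1
  set w : Euc d → Euc m := S.indicator fun x => u₁ x - g x with hw
  have hwm : StronglyMeasurable w := (hu₁m.sub hgm).indicator hSm
  have hgA : MemLp g (ENNReal.ofReal p) (volume.restrict A) := by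
    obtain ⟨V, hV⟩ := hg (Metric.ball 0 R) Metric.isOpen_ball Metric.isBounded_ball
    exact hV.memLp.mono_measure (Measure.restrict_mono hR le_rfl)
  have hae : ∀ᵐ x : Euc d, x ∈ A → w x = u x - g x := by
    have := (ae_restrict_iff' hAm).1 (ae_mono (Measure.restrict_mono hAΩ le_rfl) hu₁)
    filter_upwards [hu.2, this] with x h1 h2 hxA
    by_cases hx : x ∈ S
    · rw [hw, indicator_of_mem hx, h2 hxA]
    · rw [hw, indicator_of_notMem hx, h1 (hAΩ hxA), sub_self]
      by_contra h
      exact hx ⟨hxA, not_lt.1 h⟩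
  have hwz : ∀ x, Metric.infDist x Aᶜ < ε * r → w x = 0 := fun x hx =>
    indicator_of_notMem (fun h => absurd h.2 (not_le.2 hx)) _
  have hwA : MemLp w (ENNReal.ofReal p) (volume.restrict A) := by
    have h1 : MemLp (fun x => u x - g x) (ENNReal.ofReal p) (volume.restrict A) :=
      (hu.1.mono_measure (Measure.restrict_mono hAΩ le_rfl)).sub hgA
    exact h1.ae_eq (((ae_restrict_iff' hAm).2 hae).mono fun x hx => hx.symm)
  have hwi : Integrable w := by
    have h1 : IntegrableOn w A := MemLp.integrable_ofReal hp hwA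
    have h2 : A.indicator w = w := indicator_eq_self.2 fun x hx => by
      by_contra h
      exact hx (indicator_of_notMem (fun h' => h h'.1) _)
    rw [← h2]
    exact (integrable_indicator_iff hAm).2 h1
  have hloc : localEnergy p r₁ ε w A ≤ Q := by
    have h1 := localEnergy_sub_le (r₁ := r₁) hp hAm hgm hae (G := G) fun ζ hζ => by
      refine (lintegral_shiftSet_quot_le hp0 hR hgs hε0 (by nlinarith)).trans ?_
      rw [hG, ← ofReal_norm]
      gcongr
    refine h1.trans ?_
    rw [hQ]
    gcongr
    refine (localEnergy_le_energy hp0.le hAΩ hAm hc₀ hr₁r₀ (hρm ε hε0) (h0 ε hε0) u).trans ?_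
    gcongr
  have hquot : quotEnergy p r₁ ε w ≤ ENNReal.ofReal Q.toReal := by
    rw [ENNReal.ofReal_toReal hQt]
    exact (quotEnergy_le_localEnergy hp0 hε0 hr₁r hAm hwz).trans hloc
  obtain ⟨h5, h6⟩ := hmoll ε w hε0 hwi hwm
  refine ⟨moll η ε w, isTest_moll hη hε0 hr₁r hAb hwi hwz, h6.trans ?_, ?_⟩
  · rw [ENNReal.ofReal_mul hC₁.le]
    gcongr
  · calc ∫⁻ x in A, ‖moll η ε w x - (u x - g x)‖ₑ ^ p = ∫⁻ x in A, ‖moll η ε w x - w x‖ₑ ^ p := by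
          refine lintegral_congr_ae (((ae_restrict_iff' hAm).2 hae).mono fun x hx => ?_)
          dsimp only
          rw [hx]
      _ ≤ ENNReal.ofReal (C₁ * ε ^ p) * ENNReal.ofReal Q.toReal :=
          (setLIntegral_le_lintegral _ _).trans (h5.trans (by gcongr))
      _ = _ := by
          rw [← ENNReal.ofReal_mul (by positivity)]
          congr 1; ring

end compactness


/-! ### Joining two functions with a cut-off: estimates for fixed ξ -/

section cutoff

variable {d m : ℕ} {p : ℝ} {A Ω : Set (Euc d)}

/-- The `p`-th power of the difference quotient. -/
noncomputable def quotPow (p ε : ℝ) (u : Euc d → Euc m) (ξ x : Euc d) : ℝ≥0∞ :=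
  ‖ε⁻¹ • (u (x + ε • ξ) - u x)‖ₑ ^ p

theorem measurable_quotPow (p ε : ℝ) {u : Euc d → Euc m} (hu : StronglyMeasurable u) :
    Measurable fun q : Euc d × Euc d => quotPow p ε u q.1 q.2 := by
  unfold quotPow
  exact (((hu.comp_measurable (by fun_prop : Measurable fun q : Euc d × Euc d => q.2 + ε • q.1)).sub
    (hu.comp_measurable measurable_snd)).const_smul ε⁻¹).enorm.pow_const p

theorem measurable_quotPow_right (p ε : ℝ) {u : Euc d → Euc m} (hu : StronglyMeasurable u)
    (ξ : Euc d) : Measurable fun x => quotPow p ε u ξ x := by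
  unfold quotPow
  exact (((hu.comp_measurable (measurable_id.add_const (ε • ξ))).sub hu).const_smul
    ε⁻¹).enorm.pow_const p

/-- A discrete product rule: the quotient of `θu + (1 - θ)v` is a convex combination, with weights
taken at the endpoint, of the quotients of `u` and `v`, plus the quotient of `θ` times `u - v`. The
last is at most `L|ξ||u - v|`, as the factor `ε` cancels. -/
theorem quotPow_cutoff_le (hp : 1 < p) {ε L : ℝ} (hε : 0 < ε) {θ : Euc d → ℝ}
    (hθ0 : ∀ x, 0 ≤ θ x) (hθ1 : ∀ x, θ x ≤ 1) (hθL : ∀ x y, |θ y - θ x| ≤ L * ‖y - x‖)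
    (u v : Euc d → Euc m) (ξ x : Euc d) :
    quotPow p ε (fun x => θ x • u x + (1 - θ x) • v x) ξ x ≤ 2 ^ p * 2 ^ p *
      (quotPow p ε u ξ x + quotPow p ε v ξ x
        + (ENNReal.ofReal L ^ p * ‖ξ‖ₑ ^ p) * ‖u x - v x‖ₑ ^ p) := by
  have hp0 : 0 ≤ p := by linarith
  have h21 : (1 : ℝ≥0∞) ≤ 2 ^ p := ENNReal.one_le_rpow (by norm_num) (by linarith)
  unfold quotPow
  set y := x + ε • ξ with hy
  have e : ε⁻¹ • ((θ y • u y + (1 - θ y) • v y) - (θ x • u x + (1 - θ x) • v x))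
      = (θ y • (ε⁻¹ • (u y - u x)) + (1 - θ y) • (ε⁻¹ • (v y - v x)))
        + (ε⁻¹ * (θ y - θ x)) • (u x - v x) := by module
  dsimp only
  rw [e]
  refine (enorm_add_rpow_le hp _ _).trans ?_
  have h1 : ∀ (t : ℝ) (z : Euc m), 0 ≤ t → t ≤ 1 → ‖t • z‖ₑ ^ p ≤ ‖z‖ₑ ^ p := by
    intro t z h0 h1
    refine ENNReal.rpow_le_rpow ?_ hp0
    rw [enorm_smul, Real.enorm_eq_ofReal h0]
    exact mul_le_of_le_one_left' (ENNReal.ofReal_le_one.2 h1)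
  have h2 : ‖(ε⁻¹ * (θ y - θ x)) • (u x - v x)‖ₑ ^ p
      ≤ (ENNReal.ofReal L ^ p * ‖ξ‖ₑ ^ p) * ‖u x - v x‖ₑ ^ p := by
    rw [← ENNReal.mul_rpow_of_nonneg _ _ hp0, ← ENNReal.mul_rpow_of_nonneg _ _ hp0, enorm_smul]
    gcongr
    rw [← ofReal_norm, ← ofReal_norm, ← ENNReal.ofReal_mul' (norm_nonneg _)]
    refine ENNReal.ofReal_le_ofReal ?_
    have h3 := hθL x y
    rw [hy, add_sub_cancel_left, norm_smul, Real.norm_of_nonneg hε.le, ← hy] at h3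
    rw [Real.norm_eq_abs, abs_mul, abs_of_pos (by positivity), inv_mul_eq_div, div_le_iff₀ hε]
    linarith
  calc _ ≤ 2 ^ p * (2 ^ p * (‖ε⁻¹ • (u y - u x)‖ₑ ^ p + ‖ε⁻¹ • (v y - v x)‖ₑ ^ p)
        + 2 ^ p * ((ENNReal.ofReal L ^ p * ‖ξ‖ₑ ^ p) * ‖u x - v x‖ₑ ^ p)) := by
        refine mul_le_mul' le_rfl (add_le_add ((enorm_add_rpow_le hp _ _).trans
          (mul_le_mul' le_rfl (add_le_add (h1 _ _ (hθ0 y) (hθ1 y)) (h1 _ _ ?_ ?_))))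
          (h2.trans (le_mul_of_one_le_left' h21)))
        · linarith [hθ1 y]
        · linarith [hθ0 y]
    _ = _ := by ring

/-- The crude bound for difference quotients over long distances. -/
theorem lintegral_quotPow_far_le (hp : 1 < p) (hAm : MeasurableSet A) {ε s : ℝ} (hε : 0 < ε)
    (hs : 0 < s) {u : Euc d → Euc m} (hu : StronglyMeasurable u) {ξ : Euc d} (hξ : s ≤ ε * ‖ξ‖) :
    ∫⁻ x in shiftSet A (ε • ξ), quotPow p ε u ξ x ≤
      ‖ξ‖ₑ ^ p * (ENNReal.ofReal s⁻¹ ^ p * (2 ^ p * (2 * ∫⁻ x in A, ‖u x‖ₑ ^ p))) := by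
  have hp0 : 0 ≤ p := by linarith
  have hinv : ‖ε⁻¹‖ₑ ^ p ≤ ‖ξ‖ₑ ^ p * ENNReal.ofReal s⁻¹ ^ p := by
    rw [← ENNReal.mul_rpow_of_nonneg _ _ hp0]
    refine ENNReal.rpow_le_rpow ?_ hp0
    rw [← ofReal_norm, ← ofReal_norm, ← ENNReal.ofReal_mul (norm_nonneg _)]
    refine ENNReal.ofReal_le_ofReal ?_
    rw [Real.norm_of_nonneg (by positivity), ← div_eq_mul_inv, le_div_iff₀ hs, inv_mul_eq_div,
      div_le_iff₀ hε]
    linarith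
  have hum : Measurable fun x => ‖u x‖ₑ ^ p := hu.enorm.pow_const p
  have hshift : ∫⁻ x in shiftSet A (ε • ξ), ‖u (x + ε • ξ)‖ₑ ^ p ≤ ∫⁻ x in A, ‖u x‖ₑ ^ p := by
    rw [← lintegral_indicator (measurableSet_shiftSet hAm _), ← lintegral_indicator hAm,
      ← lintegral_add_right_eq_self (A.indicator fun x => ‖u x‖ₑ ^ p) (ε • ξ)]
    refine lintegral_mono fun x => ?_
    by_cases hx : x ∈ shiftSet A (ε • ξ)
    · rw [indicator_of_mem hx, indicator_of_mem hx.2]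
    · rw [indicator_of_notMem hx]; exact zero_le
  calc ∫⁻ x in shiftSet A (ε • ξ), quotPow p ε u ξ x
      = ‖ε⁻¹‖ₑ ^ p * ∫⁻ x in shiftSet A (ε • ξ), ‖u (x + ε • ξ) - u x‖ₑ ^ p := by
        unfold quotPow
        simp only [enorm_smul_sub_rpow hp0]
        rw [lintegral_const_mul' _ _ (rpow_enorm_inv_ne_top hε p)]
    _ ≤ (‖ξ‖ₑ ^ p * ENNReal.ofReal s⁻¹ ^ p) * (2 ^ p * ((∫⁻ x in A, ‖u x‖ₑ ^ p)
          + ∫⁻ x in A, ‖u x‖ₑ ^ p)) := by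
        gcongr
        refine (lintegral_le_mul_add (two_rpow_ne_top p) hum
          fun x => enorm_sub_rpow_le hp _ _).trans ?_
        gcongr
        exact shiftSet_subset _ _
    _ = _ := by ring

variable {f : Euc d → Euc d → Euc m → ℝ≥0} {ψ : Euc d → ℝ≥0}

theorem coe_le_of_growth (hp : 0 ≤ p)
    (h1 : ∀ x ∈ Ω, ∀ ξ : Euc d, ∀ z : Euc m, (f x ξ z : ℝ) ≤ ψ ξ * (‖z‖ ^ p + 1)) {x : Euc d}
    (hx : x ∈ Ω) (ξ : Euc d) (z : Euc m) :
    (f x ξ z : ℝ≥0∞) ≤ (ψ ξ : ℝ≥0∞) * (‖z‖ₑ ^ p + 1) := by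
  rw [← ofReal_norm, ENNReal.ofReal_rpow_of_nonneg (norm_nonneg _) hp, ← ENNReal.ofReal_one,
    ← ENNReal.ofReal_add (by positivity) (by norm_num), ← ENNReal.ofReal_coe_nnreal,
    ← ENNReal.ofReal_coe_nnreal, ← ENNReal.ofReal_mul (by positivity)]
  exact ENNReal.ofReal_le_ofReal (h1 x hx ξ z)

/-- Short-range contribution to the energy of a convex combination. -/
theorem lintegral_cutoff_near_le (hp : 1 < p) (hAΩ : A ⊆ Ω) (hAm : MeasurableSet A)
    (h1 : ∀ x ∈ Ω, ∀ ξ : Euc d, ∀ z : Euc m, (f x ξ z : ℝ) ≤ ψ ξ * (‖z‖ ^ p + 1))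
    {ε L : ℝ} (hε : 0 < ε) {θ : Euc d → ℝ}
    (hθ0 : ∀ x, 0 ≤ θ x) (hθ1 : ∀ x, θ x ≤ 1) (hθL : ∀ x y, |θ y - θ x| ≤ L * ‖y - x‖)
    {u v u' : Euc d → Euc m} (hu : StronglyMeasurable u) (hv : StronglyMeasurable v)
    (hu' : StronglyMeasurable u') {T S : Set (Euc d)} (hT : MeasurableSet T) (hS : MeasurableSet S)
    {ξ : Euc d}
    (hT1 : ∀ x ∈ shiftSet A (ε • ξ), x ∉ T → θ x = 1 ∧ θ (x + ε • ξ) = 1)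
    (hS1 : ∀ x ∈ shiftSet A (ε • ξ), (θ x = 1 ∧ θ (x + ε • ξ) = 1) ∨
      (θ x = 0 ∧ θ (x + ε • ξ) = 0) ∨ (x ∈ S ∧ u' x = u x ∧ u' (x + ε • ξ) = u (x + ε • ξ)))
    {β : ℝ≥0∞} (hβ : ∫⁻ x in T, quotPow p ε v ξ x ≤ ‖ξ‖ₑ ^ p * β) :
    ∫⁻ x in shiftSet A (ε • ξ), (f x ξ (ε⁻¹ • ((θ (x + ε • ξ) • u (x + ε • ξ)
        + (1 - θ (x + ε • ξ)) • v (x + ε • ξ)) - (θ x • u x + (1 - θ x) • v x))) : ℝ≥0∞)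
      ≤ (∫⁻ x in shiftSet A (ε • ξ), (f x ξ (ε⁻¹ • (u (x + ε • ξ) - u x)) : ℝ≥0∞)) +
        ψ ξ * ((‖ξ‖ₑ ^ p + 1) * (volume T + 2 ^ p * 2 ^ p * β + 2 ^ p * 2 ^ p *
          ENNReal.ofReal L ^ p * ∫⁻ x in A, ‖u x - v x‖ₑ ^ p) +
          2 ^ p * 2 ^ p * ∫⁻ x in S, quotPow p ε u' ξ x) := by
  have hp0 : 0 ≤ p := by linarith
  have hKt : (2 : ℝ≥0∞) ^ p * 2 ^ p ≠ ⊤ := by finiteness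
  have hK1 : (1 : ℝ≥0∞) ≤ 2 ^ p * 2 ^ p :=
    one_le_mul (ENNReal.one_le_rpow (by norm_num) (by linarith))
      (ENNReal.one_le_rpow (by norm_num) (by linarith))
  set K : ℝ≥0∞ := 2 ^ p * 2 ^ p with hK
  set c : ℝ≥0∞ := ENNReal.ofReal L ^ p * ‖ξ‖ₑ ^ p with hc
  have hct : c ≠ ⊤ := by finiteness
  have hD := measurableSet_shiftSet hAm (ε • ξ)
  have hm1 : Measurable fun x => T.indicator (fun x => 1 + K * quotPow p ε v ξ x) x :=
    (measurable_const.add ((measurable_quotPow_right p ε hv ξ).const_mul K)).indicator hT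
  have hm2 : Measurable fun x => S.indicator (fun x => K * quotPow p ε u' ξ x) x :=
    ((measurable_quotPow_right p ε hu' ξ).const_mul K).indicator hS
  have hm3 : Measurable fun x => K * c * ‖u x - v x‖ₑ ^ p :=
    ((hu.sub hv).enorm.pow_const p).const_mul _
  have hm12 : Measurable fun x => T.indicator (fun x => 1 + K * quotPow p ε v ξ x) x +
      S.indicator (fun x => K * quotPow p ε u' ξ x) x := hm1.add hm2
  have hm123 : Measurable fun x => (ψ ξ : ℝ≥0∞) * (T.indicator
      (fun x => 1 + K * quotPow p ε v ξ x) x + S.indicator (fun x => K * quotPow p ε u' ξ x) x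
      + K * c * ‖u x - v x‖ₑ ^ p) := (hm12.add hm3).const_mul (ψ ξ : ℝ≥0∞)
  have hpt : ∀ x ∈ shiftSet A (ε • ξ), (f x ξ (ε⁻¹ • ((θ (x + ε • ξ) • u (x + ε • ξ)
        + (1 - θ (x + ε • ξ)) • v (x + ε • ξ)) - (θ x • u x + (1 - θ x) • v x))) : ℝ≥0∞)
      ≤ (f x ξ (ε⁻¹ • (u (x + ε • ξ) - u x)) : ℝ≥0∞) + ψ ξ * (T.indicator
        (fun x => 1 + K * quotPow p ε v ξ x) x + S.indicator (fun x => K * quotPow p ε u' ξ x) x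
          + K * c * ‖u x - v x‖ₑ ^ p) := by
    intro x hx
    -- Three kinds of interaction: where `θ` is one at both ends the integrand is that of `u`; where
    -- it is zero at both ends it involves only `v`; otherwise `x` is in the transition layer `S`,
    -- where `u'` may replace `u`.
    by_cases hone : θ x = 1 ∧ θ (x + ε • ξ) = 1
    · rw [hone.1, hone.2]
      simp only [one_smul, sub_self, zero_smul, add_zero]
      exact le_self_add
    have hxT : x ∈ T := by
      by_contra h
      exact hone (hT1 x hx h)
    have hgr := coe_le_of_growth hp0 h1 (hAΩ hx.1) ξ (ε⁻¹ • ((θ (x + ε • ξ) • u (x + ε • ξ)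
        + (1 - θ (x + ε • ξ)) • v (x + ε • ξ)) - (θ x • u x + (1 - θ x) • v x)))
    refine (hgr.trans (mul_le_mul' le_rfl ?_)).trans le_add_self
    rw [indicator_of_mem hxT]
    rcases hS1 x hx with h | h | ⟨hxS, h2, h3⟩
    · exact absurd h hone
    · rw [h.1, h.2]
      simp only [zero_smul, sub_zero, one_smul, zero_add]
      change quotPow p ε v ξ x + 1 ≤ _
      rw [add_assoc]
      refine le_trans ?_ le_self_add
      rw [add_comm]
      exact add_le_add le_rfl (le_mul_of_one_le_left' hK1)
    · rw [indicator_of_mem hxS]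
      have h4 : quotPow p ε u' ξ x = quotPow p ε u ξ x := by rw [quotPow, quotPow, h2, h3]
      rw [h4]
      have h5 := quotPow_cutoff_le hp hε hθ0 hθ1 hθL u v ξ x
      calc _ ≤ K * (quotPow p ε u ξ x + quotPow p ε v ξ x + c * ‖u x - v x‖ₑ ^ p) + 1 := by
            exact add_le_add h5 le_rfl
        _ = _ := by ring
  calc _ ≤ _ := setLIntegral_mono' hD hpt
    _ = (∫⁻ x in shiftSet A (ε • ξ), (f x ξ (ε⁻¹ • (u (x + ε • ξ) - u x)) : ℝ≥0∞)) + ψ ξ *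
        ((∫⁻ x in shiftSet A (ε • ξ), T.indicator (fun x => 1 + K * quotPow p ε v ξ x) x)
          + (∫⁻ x in shiftSet A (ε • ξ), S.indicator (fun x => K * quotPow p ε u' ξ x) x)
          + ∫⁻ x in shiftSet A (ε • ξ), K * c * ‖u x - v x‖ₑ ^ p) := by
        rw [lintegral_add_right _ hm123,
          lintegral_const_mul' _ _ ENNReal.coe_ne_top, lintegral_add_right _ hm3,
          lintegral_add_right _ hm2]
    _ ≤ (∫⁻ x in shiftSet A (ε • ξ), (f x ξ (ε⁻¹ • (u (x + ε • ξ) - u x)) : ℝ≥0∞)) + ψ ξ *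
        ((volume T + K * (‖ξ‖ₑ ^ p * β)) + (K * ∫⁻ x in S, quotPow p ε u' ξ x)
          + K * c * ∫⁻ x in A, ‖u x - v x‖ₑ ^ p) := by
        gcongr
        · refine (setLIntegral_le_lintegral _ _).trans ?_
          rw [lintegral_indicator hT, lintegral_add_left measurable_const, setLIntegral_const, one_mul,
            lintegral_const_mul' _ _ hKt]
          gcongr
        · refine (setLIntegral_le_lintegral _ _).trans ?_
          rw [lintegral_indicator hS, lintegral_const_mul' _ _ hKt]
        · rw [lintegral_const_mul' _ _ (by finiteness)]
          gcongr
          exact shiftSet_subset _ _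
    _ ≤ _ := by
        refine add_le_add le_rfl (mul_le_mul' le_rfl ?_)
        rw [hc]
        set U := ∫⁻ x in A, ‖u x - v x‖ₑ ^ p
        set J := ∫⁻ x in S, quotPow p ε u' ξ x
        calc _ = volume T + ‖ξ‖ₑ ^ p * (K * β + K * ENNReal.ofReal L ^ p * U) + K * J := by ring
          -- The added nonnegative terms complete the product with the factor `‖ξ‖ₑ ^ p + 1`, the
          -- weight integrated against `ψ`.
          _ ≤ (volume T + ‖ξ‖ₑ ^ p * (K * β + K * ENNReal.ofReal L ^ p * U) + K * J)
              + (‖ξ‖ₑ ^ p * volume T + (K * β + K * ENNReal.ofReal L ^ p * U)) := le_self_add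
          _ = _ := by ring

/-- Long-range contribution to the energy of a convex combination. -/
theorem lintegral_cutoff_far_le (hp : 1 < p) (hAΩ : A ⊆ Ω) (hAm : MeasurableSet A)
    (h1 : ∀ x ∈ Ω, ∀ ξ : Euc d, ∀ z : Euc m, (f x ξ z : ℝ) ≤ ψ ξ * (‖z‖ ^ p + 1))
    {ε L s : ℝ} (hε : 0 < ε) (hε1 : ε ≤ 1) (hs : 0 < s) {θ : Euc d → ℝ}
    (hθ0 : ∀ x, 0 ≤ θ x) (hθ1 : ∀ x, θ x ≤ 1) (hθL : ∀ x y, |θ y - θ x| ≤ L * ‖y - x‖)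
    {u v : Euc d → Euc m} (hu : StronglyMeasurable u) (hv : StronglyMeasurable v)
    {ξ : Euc d} (hξ : s ≤ ε * ‖ξ‖) :
    ∫⁻ x in shiftSet A (ε • ξ), (f x ξ (ε⁻¹ • ((θ (x + ε • ξ) • u (x + ε • ξ)
        + (1 - θ (x + ε • ξ)) • v (x + ε • ξ)) - (θ x • u x + (1 - θ x) • v x))) : ℝ≥0∞)
      ≤ ψ ξ * (‖ξ‖ₑ ^ p * (ENNReal.ofReal s⁻¹ ^ p * volume A + 2 ^ p * 2 ^ p *
        (ENNReal.ofReal s⁻¹ ^ p * (2 ^ p * (2 * ∫⁻ x in A, ‖u x‖ₑ ^ p))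
        + ENNReal.ofReal s⁻¹ ^ p * (2 ^ p * (2 * ∫⁻ x in A, ‖v x‖ₑ ^ p))
        + ENNReal.ofReal L ^ p * ∫⁻ x in A, ‖u x - v x‖ₑ ^ p))) := by
  have hp0 : 0 ≤ p := by linarith
  have hKt : (2 : ℝ≥0∞) ^ p * 2 ^ p ≠ ⊤ := by finiteness
  set K : ℝ≥0∞ := 2 ^ p * 2 ^ p with hK
  set c : ℝ≥0∞ := ENNReal.ofReal L ^ p * ‖ξ‖ₑ ^ p with hc
  have hct : c ≠ ⊤ := by finiteness
  have hD := measurableSet_shiftSet hAm (ε • ξ)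
  have hm2 := measurable_quotPow_right p ε hv ξ
  have hm1 := measurable_quotPow_right p ε hu ξ
  have hm3 : Measurable fun x => c * ‖u x - v x‖ₑ ^ p :=
    ((hu.sub hv).enorm.pow_const p).const_mul _
  -- Since `ε ≤ 1`, a step with `ε‖ξ‖ ≥ s` has `‖ξ‖ ≥ s`. The constant term in (H1) is thereby
  -- absorbed into `‖ξ‖ ^ p`, as the tail in (H2) carries no constant weight.
  have hone : 1 ≤ ‖ξ‖ₑ ^ p * ENNReal.ofReal s⁻¹ ^ p := by
    rw [← ENNReal.mul_rpow_of_nonneg _ _ hp0]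
    refine ENNReal.one_le_rpow ?_ (by linarith)
    rw [← ofReal_norm, ← ENNReal.ofReal_mul (norm_nonneg _), ENNReal.one_le_ofReal,
      ← div_eq_mul_inv, le_div_iff₀ hs]
    nlinarith [norm_nonneg ξ]
  calc _ ≤ ∫⁻ x in shiftSet A (ε • ξ), ψ ξ * (K * (quotPow p ε u ξ x + quotPow p ε v ξ x
        + c * ‖u x - v x‖ₑ ^ p) + 1) := by
        refine setLIntegral_mono' hD fun x hx => ?_
        refine (coe_le_of_growth hp0 h1 (hAΩ hx.1) ξ _).trans
          (mul_le_mul' le_rfl (add_le_add ?_ le_rfl))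
        exact quotPow_cutoff_le hp hε hθ0 hθ1 hθL u v ξ x
    _ = ψ ξ * (K * ((∫⁻ x in shiftSet A (ε • ξ), quotPow p ε u ξ x) +
          (∫⁻ x in shiftSet A (ε • ξ), quotPow p ε v ξ x)
          + c * ∫⁻ x in shiftSet A (ε • ξ), ‖u x - v x‖ₑ ^ p) + volume (shiftSet A (ε • ξ))) := by
        rw [lintegral_const_mul' _ _ ENNReal.coe_ne_top, lintegral_add_right _ measurable_const,
          lintegral_const_mul' _ _ hKt, lintegral_add_right _ hm3, lintegral_add_right _ hm2,
          lintegral_const_mul' _ _ hct, setLIntegral_const, one_mul]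
    _ ≤ ψ ξ * (K * (‖ξ‖ₑ ^ p * (ENNReal.ofReal s⁻¹ ^ p * (2 ^ p * (2 * ∫⁻ x in A, ‖u x‖ₑ ^ p))) +
          ‖ξ‖ₑ ^ p * (ENNReal.ofReal s⁻¹ ^ p * (2 ^ p * (2 * ∫⁻ x in A, ‖v x‖ₑ ^ p)))
          + c * ∫⁻ x in A, ‖u x - v x‖ₑ ^ p) + (‖ξ‖ₑ ^ p * ENNReal.ofReal s⁻¹ ^ p) * volume A) := by
        gcongr
        · exact lintegral_quotPow_far_le hp hAm hε hs hu hξ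
        · exact lintegral_quotPow_far_le hp hAm hε hs hv hξ
        · exact shiftSet_subset _ _
        · exact (measure_mono (shiftSet_subset _ _)).trans (le_mul_of_one_le_left' hone)
    _ = _ := by rw [hc]; ring

end cutoff


/-! ### The energy of a function modified by a cut-off -/

section cutoffEnergy

variable {d m : ℕ} {p : ℝ} {A Ω : Set (Euc d)}

theorem enorm_rpow_add_one (hp : 0 ≤ p) (ξ : Euc d) :
    ‖ξ‖ₑ ^ p + 1 = ENNReal.ofReal (‖ξ‖ ^ p + 1) := by
  rw [← ofReal_norm, ENNReal.ofReal_rpow_of_nonneg (norm_nonneg _) hp,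
    ENNReal.ofReal_add (by positivity) zero_le_one, ENNReal.ofReal_one]

variable {f : ℝ → Euc d → Euc d → Euc m → ℝ≥0} {ψ : Euc d → ℝ≥0}

/-- Energy of the convex combination of two functions. -/
theorem energy_cutoff_le (hp : 1 < p) (hAΩ : A ⊆ Ω) (hAm : MeasurableSet A)
    {ε L s : ℝ} (hε : 0 < ε) (hε1 : ε ≤ 1) (hs : 0 < s)
    (h1 : ∀ x ∈ Ω, ∀ ξ : Euc d, ∀ z : Euc m, (f ε x ξ z : ℝ) ≤ ψ ξ * (‖z‖ ^ p + 1))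
    (hψ : Measurable ψ) {θ : Euc d → ℝ}
    (hθ0 : ∀ x, 0 ≤ θ x) (hθ1 : ∀ x, θ x ≤ 1) (hθL : ∀ x y, |θ y - θ x| ≤ L * ‖y - x‖)
    {u v u' : Euc d → Euc m} (hu : StronglyMeasurable u) (hv : StronglyMeasurable v)
    (hu' : StronglyMeasurable u') {T S : Set (Euc d)} (hT : MeasurableSet T) (hS : MeasurableSet S)
    (hT1 : ∀ x y, y ∈ A → x ∈ A → ‖y - x‖ < s → x ∉ T → θ x = 1 ∧ θ y = 1)
    (hS1 : ∀ x y, y ∈ A → x ∈ A → ‖y - x‖ < s → (θ x = 1 ∧ θ y = 1) ∨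
      (θ x = 0 ∧ θ y = 0) ∨ (x ∈ S ∧ u' x = u x ∧ u' y = u y))
    {β : ℝ≥0∞} (hβ : ∀ ξ : Euc d, ε * ‖ξ‖ < s → ∫⁻ x in T, quotPow p ε v ξ x ≤ ‖ξ‖ₑ ^ p * β) :
    energy f ε (fun x => θ x • u x + (1 - θ x) • v x) A ≤ energy f ε u A
      + (volume T + 2 ^ p * 2 ^ p * β + 2 ^ p * 2 ^ p *
          ENNReal.ofReal L ^ p * ∫⁻ x in A, ‖u x - v x‖ₑ ^ p)
        * (∫⁻ ξ : Euc d, (ψ ξ : ℝ≥0∞) * ENNReal.ofReal (‖ξ‖ ^ p + 1))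
      + 2 ^ p * 2 ^ p * (∫⁻ ξ, (ψ ξ : ℝ≥0∞) * ∫⁻ x in S, quotPow p ε u' ξ x)
      + (ENNReal.ofReal s⁻¹ ^ p * volume A + 2 ^ p * 2 ^ p *
        (ENNReal.ofReal s⁻¹ ^ p * (2 ^ p * (2 * ∫⁻ x in A, ‖u x‖ₑ ^ p))
        + ENNReal.ofReal s⁻¹ ^ p * (2 ^ p * (2 * ∫⁻ x in A, ‖v x‖ₑ ^ p))
        + ENNReal.ofReal L ^ p * ∫⁻ x in A, ‖u x - v x‖ₑ ^ p))
        * ∫⁻ ξ in (Metric.ball (0 : Euc d) (s / ε))ᶜ,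
            (ψ ξ : ℝ≥0∞) * ENNReal.ofReal (‖ξ‖ ^ p) := by
  have hp0 : 0 ≤ p := by linarith
  have hKt : (2 : ℝ≥0∞) ^ p * 2 ^ p ≠ ⊤ := by finiteness
  set X := volume T + 2 ^ p * 2 ^ p * β + 2 ^ p * 2 ^ p *
          ENNReal.ofReal L ^ p * ∫⁻ x in A, ‖u x - v x‖ₑ ^ p with hX
  set Z := ENNReal.ofReal s⁻¹ ^ p * volume A + 2 ^ p * 2 ^ p *
        (ENNReal.ofReal s⁻¹ ^ p * (2 ^ p * (2 * ∫⁻ x in A, ‖u x‖ₑ ^ p))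
        + ENNReal.ofReal s⁻¹ ^ p * (2 ^ p * (2 * ∫⁻ x in A, ‖v x‖ₑ ^ p))
        + ENNReal.ofReal L ^ p * ∫⁻ x in A, ‖u x - v x‖ₑ ^ p) with hZ
  have hψ' : Measurable fun ξ => (ψ ξ : ℝ≥0∞) := hψ.coe_nnreal_ennreal
  have hn : Measurable fun ξ : Euc d => ‖ξ‖ := measurable_norm
  have hψ1 : Measurable fun ξ : Euc d => (ψ ξ : ℝ≥0∞) * ENNReal.ofReal (‖ξ‖ ^ p + 1) :=
    hψ'.mul ((hn.pow_const p).add_const 1).ennreal_ofReal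
  have hψ2 : Measurable fun ξ : Euc d => (ψ ξ : ℝ≥0∞) * ENNReal.ofReal (‖ξ‖ ^ p) :=
    hψ'.mul (hn.pow_const p).ennreal_ofReal
  have hJ : Measurable fun ξ : Euc d => ∫⁻ x in S, quotPow p ε u' ξ x :=
    (measurable_quotPow p ε hu').lintegral_prod_right'
  have hball : MeasurableSet (Metric.ball (0 : Euc d) (s / ε))ᶜ := measurableSet_ball.compl
  have hm1 : Measurable fun ξ : Euc d => X * ((ψ ξ : ℝ≥0∞) * ENNReal.ofReal (‖ξ‖ ^ p + 1)) :=
    hψ1.const_mul X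
  have hm2 : Measurable fun ξ : Euc d =>
      2 ^ p * 2 ^ p * ((ψ ξ : ℝ≥0∞) * ∫⁻ x in S, quotPow p ε u' ξ x) :=
    (hψ'.mul hJ).const_mul _
  have hm3' : Measurable ((Metric.ball (0 : Euc d) (s / ε))ᶜ.indicator
      (fun ξ : Euc d => (ψ ξ : ℝ≥0∞) * ENNReal.ofReal (‖ξ‖ ^ p))) := hψ2.indicator hball
  have hm3 : Measurable fun ξ : Euc d => Z * (Metric.ball (0 : Euc d) (s / ε))ᶜ.indicator
      (fun ξ : Euc d => (ψ ξ : ℝ≥0∞) * ENNReal.ofReal (‖ξ‖ ^ p)) ξ := hm3'.const_mul Z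
  calc energy f ε (fun x => θ x • u x + (1 - θ x) • v x) A
      ≤ ∫⁻ ξ : Euc d, ((∫⁻ x in shiftSet A (ε • ξ), (f ε x ξ (ε⁻¹ • (u (x + ε • ξ) - u x)) : ℝ≥0∞))
        + X * ((ψ ξ : ℝ≥0∞) * ENNReal.ofReal (‖ξ‖ ^ p + 1))
        + 2 ^ p * 2 ^ p * ((ψ ξ : ℝ≥0∞) * ∫⁻ x in S, quotPow p ε u' ξ x)
        + Z * (Metric.ball (0 : Euc d) (s / ε))ᶜ.indicator
            (fun ξ : Euc d => (ψ ξ : ℝ≥0∞) * ENNReal.ofReal (‖ξ‖ ^ p)) ξ) := by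
        refine lintegral_mono fun ξ => ?_
        -- Steps shorter than `s` cannot jump across a transition layer, and the layer estimate
        -- applies. Longer ones have `‖ξ‖ ≥ s / ε` and fall into the tail controlled by (H2).
        by_cases hξ : ε * ‖ξ‖ < s
        · have hns : ∀ x : Euc d, ‖x + ε • ξ - x‖ < s := fun x => by
            rwa [add_sub_cancel_left, norm_smul, Real.norm_of_nonneg hε.le]
          refine le_trans ?_ le_self_add
          refine (lintegral_cutoff_near_le hp hAΩ hAm h1 hε hθ0 hθ1 hθL hu hv hu' hT hS
            (fun x hx => hT1 x _ hx.2 hx.1 (hns x)) (fun x hx => hS1 x _ hx.2 hx.1 (hns x))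
            (hβ ξ hξ)).trans (le_of_eq ?_)
          rw [← enorm_rpow_add_one hp0, hX]
          ring
        · have hξ' : s ≤ ε * ‖ξ‖ := not_lt.1 hξ
          refine le_trans ?_ le_add_self
          rw [indicator_of_mem]
          · refine (lintegral_cutoff_far_le hp hAΩ hAm h1 hε hε1 hs hθ0 hθ1 hθL hu hv hξ').trans
              (le_of_eq ?_)
            rw [hZ, ← ofReal_norm ξ, ENNReal.ofReal_rpow_of_nonneg (norm_nonneg _) hp0]
            ring
          · rw [mem_compl_iff, mem_ball_zero_iff, not_lt, div_le_iff₀ hε]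
            linarith
    _ = _ := by
        rw [lintegral_add_right _ hm3, lintegral_add_right _ hm2, lintegral_add_right _ hm1,
          lintegral_const_mul _ hψ1, lintegral_const_mul' _ _ hKt, lintegral_const_mul _ hm3',
          lintegral_indicator hball]
        rfl

/-- Disjointness of the layers makes the sum at most one integral over the whole space. This is what
makes averaging over the layers gain a factor `1/N`. -/
theorem sum_lintegral_quotPow_le {ι : Type*} (I : Finset ι) {S : ι → Set (Euc d)}
    (hS : ∀ i, MeasurableSet (S i)) (hd : Pairwise (Function.onFun Disjoint S)) (hp : 0 ≤ p) {ε : ℝ}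
    (hε : 0 < ε) (u : Euc d → Euc m) (ξ : Euc d) :
    ∑ i ∈ I, ∫⁻ x in S i, quotPow p ε u ξ x ≤ ‖ε⁻¹‖ₑ ^ p * shiftInt p u (ε • ξ) := by
  rw [← lintegral_biUnion_finset (fun i _ j _ hij => hd hij) (fun i _ => hS i)]
  refine (setLIntegral_le_lintegral _ _).trans (le_of_eq ?_)
  rw [shiftInt, ← lintegral_const_mul' _ _ (rpow_enorm_inv_ne_top hε p)]
  unfold quotPow
  simp only [enorm_smul_sub_rpow hp]

end cutoffEnergy


/-! ### Cut-off functions of the distance to the complement, and averaging over layers -/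

/-- The piecewise linear function that is `0` before `0` and `1` after `1`. -/
noncomputable def ramp (t : ℝ) : ℝ := max 0 (min 1 t)

theorem ramp_nonneg (t : ℝ) : 0 ≤ ramp t := le_max_left _ _

theorem ramp_le_one (t : ℝ) : ramp t ≤ 1 := max_le zero_le_one (min_le_left _ _)

theorem ramp_of_nonpos {t : ℝ} (h : t ≤ 0) : ramp t = 0 := max_eq_left ((min_le_right _ _).trans h)

theorem ramp_of_one_le {t : ℝ} (h : 1 ≤ t) : ramp t = 1 := by
  rw [ramp, min_eq_left h, max_eq_right zero_le_one]

theorem continuous_ramp : Continuous ramp := by unfold ramp; fun_prop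

theorem abs_ramp_sub_le (s t : ℝ) : |ramp t - ramp s| ≤ |t - s| := by
  have h1 := abs_max_sub_max_le_max 0 (min 1 t) 0 (min 1 s)
  have h2 := abs_min_sub_min_le_max 1 t 1 s
  rw [sub_self, abs_zero, max_eq_right (abs_nonneg (min 1 t - min 1 s))] at h1
  rw [sub_self, abs_zero, max_eq_right (abs_nonneg (t - s))] at h2
  exact h1.trans h2

section cutoffFamily

variable {d m : ℕ} {p : ℝ} {A Ω : Set (Euc d)}

theorem infDist_le_add (A : Set (Euc d)) (x y : Euc d) :
    Metric.infDist x A ≤ Metric.infDist y A + ‖y - x‖ := by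
  have := Metric.infDist_le_infDist_add_dist (s := A) (x := x) (y := y)
  rwa [dist_comm, dist_eq_norm] at this

theorem abs_ramp_infDist_sub_le (A : Set (Euc d)) {L : ℝ} (hL : 0 ≤ L) (b : ℝ) (x y : Euc d) :
    |ramp (L * Metric.infDist y A - b) - ramp (L * Metric.infDist x A - b)| ≤ L * ‖y - x‖ := by
  refine (abs_ramp_sub_le _ _).trans ?_
  rw [sub_sub_sub_cancel_right, ← mul_sub, abs_mul, abs_of_nonneg hL]
  refine mul_le_mul_of_nonneg_left ?_ hL
  have h1 := infDist_le_add A x y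
  have h2 := infDist_le_add A y x
  rw [norm_sub_rev] at h2
  rw [abs_le]; constructor <;> linarith

theorem measurable_ramp_infDist (A : Set (Euc d)) (L b : ℝ) :
    Measurable fun x : Euc d => ramp (L * Metric.infDist x A - b) :=
  (continuous_ramp.comp ((continuous_const.mul (Metric.continuous_infDist_pt A)).sub
    continuous_const)).measurable

/-- A recovery sequence satisfies no boundary condition, so it has no useful extension by zero.
Multiplied by a ramp that vanishes near the complement of `A`, it has one, at the price of the
Lipschitz constant of the ramp times its `L^p` integral. -/
theorem quotEnergy_ramp_le (hp : 1 < p) (hAm : MeasurableSet A) {ε L r₁ r : ℝ} (hε : 0 < ε)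
    (hr : r₁ < r) (hL : 0 < L) (hεL : L * (ε * r) ≤ 1) {u : Euc d → Euc m}
    (hu : StronglyMeasurable u) :
    quotEnergy p r₁ ε (fun x => ramp (L * Metric.infDist x Aᶜ - 1) • u x) ≤
      2 ^ p * 2 ^ p * (localEnergy p r₁ ε u A + ENNReal.ofReal L ^ p * ENNReal.ofReal r₁ ^ p *
        (∫⁻ x in A, ‖u x‖ₑ ^ p) * volume (Metric.closedBall (0 : Euc d) r₁)) := by
  have hp0 : 0 < p := by linarith
  have hKt : (2 : ℝ≥0∞) ^ p * 2 ^ p ≠ ⊤ := by finiteness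
  refine (quotEnergy_le_localEnergy hp0 hε hr hAm fun x hx => ?_).trans ?_
  · rw [ramp_of_nonpos, zero_smul]
    have := mul_le_mul_of_nonneg_left hx.le hL.le
    linarith
  set χ : Euc d → ℝ := fun x => ramp (L * Metric.infDist x Aᶜ - 1)
  have hmu : Measurable fun x => ‖u x‖ₑ ^ p := hu.enorm.pow_const p
  have hpt : ∀ ζ x : Euc d, ‖ζ‖ ≤ r₁ → ‖ε⁻¹ • (χ (x + ε • ζ) • u (x + ε • ζ) - χ x • u x)‖ₑ ^ p ≤
      2 ^ p * 2 ^ p * (‖ε⁻¹ • (u (x + ε • ζ) - u x)‖ₑ ^ p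
        + ENNReal.ofReal L ^ p * ENNReal.ofReal r₁ ^ p * ‖u x‖ₑ ^ p) := by
    intro ζ x hζ
    have h := quotPow_cutoff_le hp hε (θ := χ) (fun x => ramp_nonneg _) (fun x => ramp_le_one _)
      (abs_ramp_infDist_sub_le Aᶜ hL.le 1) u (fun _ => 0) ζ x
    simp only [quotPow, smul_zero, add_zero, sub_zero, enorm_zero, ENNReal.zero_rpow_of_pos hp0] at h
    refine h.trans (mul_le_mul' le_rfl (add_le_add le_rfl ?_))
    gcongr
    rw [← ofReal_norm]
    exact ENNReal.ofReal_le_ofReal hζ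
  calc localEnergy p r₁ ε (fun x => χ x • u x) A
      ≤ ∫⁻ ζ in Metric.closedBall (0 : Euc d) r₁, 2 ^ p * 2 ^ p *
          ((∫⁻ x in shiftSet A (ε • ζ), ‖ε⁻¹ • (u (x + ε • ζ) - u x)‖ₑ ^ p) +
          ENNReal.ofReal L ^ p * ENNReal.ofReal r₁ ^ p * ∫⁻ x in A, ‖u x‖ₑ ^ p) := by
        refine setLIntegral_mono' measurableSet_closedBall fun ζ hζ => ?_
        rw [mem_closedBall_zero_iff] at hζ
        refine (lintegral_le_mul_add hKt (hmu.const_mul _) fun x => hpt ζ x hζ).trans ?_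
        rw [lintegral_const_mul' _ _ (by finiteness)]
        gcongr
        exact shiftSet_subset _ _
    _ = _ := by
        rw [lintegral_const_mul' _ _ hKt, lintegral_add_right _ measurable_const, setLIntegral_const]
        rfl

theorem integrable_ramp_smul (hp : 1 < p) (hAb : Bornology.IsBounded A)
    {L : ℝ} {u : Euc d → Euc m} (huA : MemLp u (ENNReal.ofReal p) (volume.restrict A))
    (hu : StronglyMeasurable u) :
    Integrable fun x => ramp (L * Metric.infDist x Aᶜ - 1) • u x := by
  have : IsFiniteMeasure (volume.restrict A) := ⟨by simpa using hAb.measure_lt_top⟩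
  have h1 : IntegrableOn (fun x => ramp (L * Metric.infDist x Aᶜ - 1) • u x) A := by
    refine (MemLp.integrable_ofReal hp huA).mono
      ((measurable_ramp_infDist Aᶜ L 1).stronglyMeasurable.smul hu).aestronglyMeasurable
      (Eventually.of_forall fun x => ?_)
    rw [norm_smul, Real.norm_of_nonneg (ramp_nonneg _)]
    exact mul_le_of_le_one_left (norm_nonneg _) (ramp_le_one _)
  refine (integrableOn_iff_integrable_of_support_subset fun x hx => ?_).1 h1
  by_contra hxA
  refine hx ?_
  dsimp only
  rw [Metric.infDist_zero_of_mem (mem_compl hxA), mul_zero, ramp_of_nonpos (by norm_num), zero_smul]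

variable {f : ℝ → Euc d → Euc d → Euc m → ℝ≥0} {ψ : Euc d → ℝ≥0}

/-- Averaging over `N` cut-off layers. -/
theorem nat_mul_le_of_forall_cutoff (hp : 1 < p) (hAΩ : A ⊆ Ω) (hAm : MeasurableSet A)
    {ε T s : ℝ} {N : ℕ} (hN : 0 < N) (hT : 0 < T) (hsT : s ≤ T / (16 * N))
    (hε : 0 < ε) (hε1 : ε ≤ 1) (hs : 0 < s)
    (h1 : ∀ x ∈ Ω, ∀ ξ : Euc d, ∀ z : Euc m, (f ε x ξ z : ℝ) ≤ ψ ξ * (‖z‖ ^ p + 1))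
    (hψ : Measurable ψ)
    {u v u' : Euc d → Euc m} (hu : StronglyMeasurable u) (hv : StronglyMeasurable v)
    (hu' : StronglyMeasurable u') (huu' : ∀ x, T / 8 ≤ Metric.infDist x Aᶜ → u' x = u x)
    {β : ℝ≥0∞} (hβ : ∀ ξ : Euc d, ε * ‖ξ‖ < s →
      ∫⁻ x in A ∩ {x | Metric.infDist x Aᶜ < T}, quotPow p ε v ξ x ≤ ‖ξ‖ₑ ^ p * β)
    {Q : ℝ≥0∞} (hQ : ∀ ξ : Euc d, ‖ε⁻¹‖ₑ ^ p * shiftInt p u' (ε • ξ) ≤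
      ENNReal.ofReal (‖ξ‖ ^ p + 1) * Q)
    {I : ℝ≥0∞} (hI : ∀ θ : Euc d → ℝ, Measurable θ → (∀ x, 0 ≤ θ x) → (∀ x, θ x ≤ 1) →
      (∀ x, Metric.infDist x Aᶜ ≤ T / 4 → θ x = 0) →
      I ≤ energy f ε (fun x => θ x • u x + (1 - θ x) • v x) A) :
    N * I ≤ N * (energy f ε u A
      + (volume (A ∩ {x | Metric.infDist x Aᶜ < T}) + 2 ^ p * 2 ^ p * β + 2 ^ p * 2 ^ p *
          ENNReal.ofReal (16 * N / T) ^ p * ∫⁻ x in A, ‖u x - v x‖ₑ ^ p)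
        * (∫⁻ ξ : Euc d, (ψ ξ : ℝ≥0∞) * ENNReal.ofReal (‖ξ‖ ^ p + 1))
      + (ENNReal.ofReal s⁻¹ ^ p * volume A + 2 ^ p * 2 ^ p *
        (ENNReal.ofReal s⁻¹ ^ p * (2 ^ p * (2 * ∫⁻ x in A, ‖u x‖ₑ ^ p))
        + ENNReal.ofReal s⁻¹ ^ p * (2 ^ p * (2 * ∫⁻ x in A, ‖v x‖ₑ ^ p))
        + ENNReal.ofReal (16 * N / T) ^ p * ∫⁻ x in A, ‖u x - v x‖ₑ ^ p))
        * ∫⁻ ξ in (Metric.ball (0 : Euc d) (s / ε))ᶜ,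
            (ψ ξ : ℝ≥0∞) * ENNReal.ofReal (‖ξ‖ ^ p))
      + 2 ^ p * 2 ^ p * ((∫⁻ ξ : Euc d, (ψ ξ : ℝ≥0∞) * ENNReal.ofReal (‖ξ‖ ^ p + 1)) * Q) := by
  have hp0 : 0 ≤ p := by linarith
  have hNr : (0 : ℝ) < N := by exact_mod_cast hN
  set δ : Euc d → ℝ := fun x => Metric.infDist x Aᶜ with hδ
  have hδm : Measurable δ := Metric.continuous_infDist_pt _ |>.measurable
  -- `τ` is the width of one ramp. Each layer takes `3τ`: the ramp and a margin `τ ≥ s` on either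
  -- side. The layers lie between the distances `T/4 - τ` and `T/4 + 3Nτ = 7T/16`, hence below `T`,
  -- and a step shorter than `s` from any of them stays above `T/8`, where `u' = u`.
  set τ : ℝ := T / (16 * N) with hτ
  have hτ0 : 0 < τ := by positivity
  have hNτ : N * τ = T / 16 := by rw [hτ]; field_simp
  have hτT : τ ≤ T / 16 := by
    rw [← hNτ]; exact le_mul_of_one_le_left hτ0.le (by exact_mod_cast hN)
  set L : ℝ := 16 * N / T with hL
  have hL0 : 0 < L := by positivity
  have hLτ : L * τ = 1 := by rw [hL, hτ]; field_simp
  set b : ℕ → ℝ := fun i => L * (T / 4 + 3 * i * τ) with hb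
  set θ : ℕ → Euc d → ℝ := fun i x => ramp (L * δ x - b i) with hθ
  -- The ramp of `θ i` occupies the middle third of `S i`; consecutive layers share only the value
  -- of the distance excluded from the lower one, so they are disjoint.
  set S : ℕ → Set (Euc d) := fun i =>
    {x | T / 4 + (3 * i - 1) * τ ≤ δ x} ∩ {x | δ x < T / 4 + (3 * i + 2) * τ} with hS
  have hSm : ∀ i, MeasurableSet (S i) := fun i =>
    (measurableSet_le measurable_const hδm).inter (measurableSet_lt hδm measurable_const)
  have hθone : ∀ (i : ℕ) x, T / 4 + (3 * i + 1) * τ ≤ δ x → θ i x = 1 := by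
    intro i x hx
    refine ramp_of_one_le ?_
    have := mul_le_mul_of_nonneg_left hx hL0.le
    rw [hb]; dsimp only
    nlinarith
  have hθzero : ∀ (i : ℕ) x, δ x ≤ T / 4 + 3 * i * τ → θ i x = 0 := by
    intro i x hx
    refine ramp_of_nonpos ?_
    have := mul_le_mul_of_nonneg_left hx hL0.le
    rw [hb]; dsimp only
    linarith
  have hSd : Pairwise (Function.onFun Disjoint S) := by
    have key : ∀ i j : ℕ, i < j → Disjoint (S i) (S j) := by
      intro i j hij
      refine Set.disjoint_left.2 fun x hx hx' => ?_
      have h2 := hx.2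
      have h3 := hx'.1
      simp only [mem_ofPred_eq] at h2 h3
      have h4 : (i : ℝ) + 1 ≤ j := by exact_mod_cast hij
      nlinarith
    intro i j hij
    rcases lt_or_gt_of_ne hij with h | h
    · exact key i j h
    · exact (key j i h).symm
  have hTm : MeasurableSet (A ∩ {x | δ x < T}) := hAm.inter (measurableSet_lt hδm measurable_const)
  have hψ' : Measurable fun ξ => (ψ ξ : ℝ≥0∞) := hψ.coe_nnreal_ennreal
  have hn : Measurable fun ξ : Euc d => ‖ξ‖ := measurable_norm
  have hψ1 : Measurable fun ξ : Euc d => (ψ ξ : ℝ≥0∞) * ENNReal.ofReal (‖ξ‖ ^ p + 1) :=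
    hψ'.mul ((hn.pow_const p).add_const 1).ennreal_ofReal
  have hJ : ∀ i, Measurable fun ξ : Euc d => (ψ ξ : ℝ≥0∞) * ∫⁻ x in S i, quotPow p ε u' ξ x :=
    fun i => hψ'.mul (measurable_quotPow p ε hu').lintegral_prod_right'
  have hsum : ∑ i ∈ Finset.range N, (∫⁻ ξ, (ψ ξ : ℝ≥0∞) * ∫⁻ x in S i, quotPow p ε u' ξ x)
      ≤ (∫⁻ ξ : Euc d, (ψ ξ : ℝ≥0∞) * ENNReal.ofReal (‖ξ‖ ^ p + 1)) * Q := by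
    rw [← lintegral_finsetSum _ (fun i _ => hJ i), ← lintegral_mul_const _ hψ1]
    refine lintegral_mono fun ξ => ?_
    dsimp only
    rw [← Finset.mul_sum, mul_assoc]
    exact mul_le_mul' le_rfl ((sum_lintegral_quotPow_le _ hSm hSd hp0 hε u' ξ).trans (hQ ξ))
  -- Both sides become sums over the `N` cut-offs, and the single-layer estimate is used for each of
  -- them. Only the transition term depends on the index.
  refine le_trans ?_ (add_le_add le_rfl (mul_le_mul' le_rfl hsum))
  have hNc : ∀ c : ℝ≥0∞, (N : ℝ≥0∞) * c = ∑ _i ∈ Finset.range N, c := fun c => by simp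
  rw [Finset.mul_sum, hNc, hNc, ← Finset.sum_add_distrib]
  refine Finset.sum_le_sum fun i hi => ?_
  have hiN : (i : ℝ) + 1 ≤ N := by exact_mod_cast Finset.mem_range.1 hi
  have hi0 : (0 : ℝ) ≤ i := Nat.cast_nonneg i
  have hiτ : (i + 1) * τ ≤ T / 16 := by
    rw [← hNτ]; exact mul_le_mul_of_nonneg_right hiN hτ0.le
  have hi0τ : 0 ≤ i * τ := by positivity
  refine (hI (θ i) (measurable_ramp_infDist _ _ _) (fun x => ramp_nonneg _) (fun x => ramp_le_one _)
    fun x hx => hθzero i x (by nlinarith)).trans ?_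
  refine (energy_cutoff_le hp hAΩ hAm hε hε1 hs h1 hψ (fun x => ramp_nonneg _)
    (fun x => ramp_le_one _) (abs_ramp_infDist_sub_le Aᶜ hL0.le (b i)) hu hv hu' hTm (hSm i)
    ?_ ?_ hβ).trans (le_of_eq ?_)
  · intro x y hy hx hxy hxT
    have hxT' : T ≤ δ x := by
      by_contra h
      exact hxT ⟨hx, not_le.1 h⟩
    have h2 : δ x ≤ δ y + ‖y - x‖ := infDist_le_add Aᶜ x y
    exact ⟨hθone i x (by nlinarith), hθone i y (by nlinarith)⟩
  · intro x y hy hx hxy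
    have h2 : δ x ≤ δ y + ‖y - x‖ := infDist_le_add Aᶜ x y
    have h3 : δ y ≤ δ x + ‖y - x‖ := by
      have := infDist_le_add Aᶜ y x
      rwa [norm_sub_rev] at this
    by_cases h4 : δ x < T / 4 + (3 * i - 1) * τ
    · exact Or.inr (Or.inl ⟨hθzero i x (by linarith), hθzero i y (by linarith)⟩)
    by_cases h5 : T / 4 + (3 * i + 2) * τ ≤ δ x
    · exact Or.inl ⟨hθone i x (by linarith), hθone i y (by linarith)⟩
    · rw [not_lt] at h4
      exact Or.inr (Or.inr ⟨⟨h4, not_le.1 h5⟩, huu' x (by change T / 8 ≤ δ x; linarith),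
        huu' y (by change T / 8 ≤ δ y; linarith)⟩)
  · ring

end cutoffFamily


/-! ### Boundary layers, the boundary datum and its approximations -/

section auxiliary

variable {d m : ℕ} {p : ℝ} {A Ω : Set (Euc d)}

/-- The choice of a small parameter after a finite constant is known. Dividing by `C + 1` includes
the case `C = 0`. -/
theorem exists_pos_mul_le {C e : ℝ≥0∞} (hC : C ≠ ⊤) (he : e ≠ 0) (het : e ≠ ⊤) :
    ∃ t, 0 < t ∧ t ≠ ⊤ ∧ C * t ≤ e := by
  have h1 : C + 1 ≠ 0 := by simp
  have h2 : C + 1 ≠ ⊤ := by finiteness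
  refine ⟨e / (C + 1), ENNReal.div_pos he h2, ENNReal.div_ne_top het h1, ?_⟩
  calc C * (e / (C + 1)) ≤ (C + 1) * (e / (C + 1)) := mul_le_mul' le_self_add le_rfl
    _ = e := ENNReal.mul_div_cancel h1 h2

theorem lintegral_le_mul_add_of_aemeasurable {α : Type*} [MeasurableSpace α] {μ : Measure α}
    {f a b : α → ℝ≥0∞} {C : ℝ≥0∞} (hC : C ≠ ⊤) (hb : AEMeasurable b μ)
    (h : ∀ x, f x ≤ C * (a x + b x)) :
    ∫⁻ x, f x ∂μ ≤ C * ((∫⁻ x, a x ∂μ) + ∫⁻ x, b x ∂μ) := by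
  refine (lintegral_mono h).trans_eq ?_
  rw [lintegral_const_mul' _ _ hC, lintegral_add_right' _ hb]

theorem nonempty_compl_of_isBounded (hd : 0 < d) (hAb : Bornology.IsBounded A) : Aᶜ.Nonempty := by
  have : Nonempty (Fin d) := ⟨⟨0, hd⟩⟩
  rw [nonempty_compl]
  rintro rfl
  exact NormedSpace.unbounded_univ ℝ (Euc d) hAb

theorem infDist_compl_pos (hd : 0 < d) (hAo : IsOpen A) (hAb : Bornology.IsBounded A) {x : Euc d}
    (hx : x ∈ A) : 0 < Metric.infDist x Aᶜ := by
  rw [← hAo.isClosed_compl.notMem_iff_infDist_pos (nonempty_compl_of_isBounded hd hAb)]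
  exact fun h => h hx

/-- Every point of the open set `A` has positive distance to the complement, so the layers shrink to
the empty set, and their volumes are finite. -/
theorem exists_volume_layer_le (hd : 0 < d) (hAo : IsOpen A) (hAb : Bornology.IsBounded A)
    {t : ℝ≥0∞} (ht : 0 < t) :
    ∃ T : ℝ, 0 < T ∧ volume (A ∩ {x | Metric.infDist x Aᶜ < T}) ≤ t := by
  have hm : ∀ n : ℕ, MeasurableSet (A ∩ {x | Metric.infDist x Aᶜ < 1 / ((n : ℝ) + 1)}) := fun n =>
    hAo.measurableSet.inter
      (measurableSet_lt (Metric.continuous_infDist_pt _).measurable measurable_const)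
  have h1 := tendsto_measure_iInter_atTop (μ := volume) (fun n => (hm n).nullMeasurableSet)
    (fun i j hij x hx => ⟨hx.1, by
      have h3 : Metric.infDist x Aᶜ < 1 / ((j : ℝ) + 1) := hx.2
      exact h3.trans_le (Nat.one_div_le_one_div hij)⟩)
    ⟨0, ((measure_mono inter_subset_left).trans_lt hAb.measure_lt_top).ne⟩
  have h2 : ⋂ n : ℕ, (A ∩ {x | Metric.infDist x Aᶜ < 1 / ((n : ℝ) + 1)}) = ∅ := by
    refine eq_empty_of_forall_notMem fun x hx => ?_
    rw [mem_iInter] at hx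
    obtain ⟨n, hn⟩ := exists_nat_one_div_lt (infDist_compl_pos hd hAo hAb (hx 0).1)
    exact lt_asymm hn (hx n).2
  rw [h2, measure_empty] at h1
  obtain ⟨n, hn⟩ := (h1.eventually (gt_mem_nhds ht)).exists
  exact ⟨_, Nat.one_div_pos_of_nat, hn.le⟩

theorem IsTest.exists_eq_zero_of_infDist_lt (hd : 0 < d) (hAo : IsOpen A)
    (hAb : Bornology.IsBounded A) {φ : Euc d → Euc m} (hφ : IsTest A φ) :
    ∃ c : ℝ, 0 < c ∧ ∀ x, Metric.infDist x Aᶜ < c → φ x = 0 := by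
  rcases (tsupport φ).eq_empty_or_nonempty with h | h
  · exact ⟨1, one_pos, fun x _ => image_eq_zero_of_notMem_tsupport (by simp [h])⟩
  · obtain ⟨y, hy, hmin⟩ := hφ.2.1.isCompact.exists_isMinOn h
      (Metric.continuous_infDist_pt Aᶜ).continuousOn
    refine ⟨_, infDist_compl_pos hd hAo hAb (hφ.2.2 hy), fun x hx => ?_⟩
    refine image_eq_zero_of_notMem_tsupport fun hx' => ?_
    exact absurd (isMinOn_iff.1 hmin x hx') (not_le.2 hx)

/-- Uniform smallness of the difference quotients of the functions `g + φ` on small sets. -/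
theorem exists_lintegral_quotPow_add_le (hp : 1 < p) {g : Euc d → Euc m} (hg : MemWLoc p g)
    (hgm : StronglyMeasurable g) (R : ℝ) {φ₀ : Euc d → Euc m} (hφ₀ : IsTest A φ₀) {κ : ℝ≥0∞}
    (hκ : 0 < κ) :
    ∃ B : ℝ≥0∞, B ≠ ⊤ ∧ ∀ φ : Euc d → Euc m, IsTest A φ →
      ∫⁻ x, ‖fderiv ℝ (fun x => φ x - φ₀ x) x‖ₑ ^ p ≤ κ → ∀ W : Set (Euc d), MeasurableSet W →
      W ⊆ Metric.ball 0 R → ∀ (ε : ℝ) (ξ : Euc d), 0 < ε → ε * ‖ξ‖ ≤ 1 →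
      ∫⁻ x in W, quotPow p ε (fun x => g x + φ x) ξ x
        ≤ ‖ξ‖ₑ ^ p * (2 ^ p * (2 ^ p * (κ + κ) + B * volume W)) := by
  have hp0 : 0 < p := by linarith
  -- The sum `g + φ` is split as `(g - Φ) + (φ - φ₀) + (Φ + φ₀)`. The first two parts have small
  -- increments, in the sense of `κ`, and the last is a fixed smooth function with a bounded
  -- derivative, whose contribution is proportional to the volume. Hence `B` does not depend on `φ`.
  obtain ⟨Φ, hΦ, h1⟩ := hg.exists_smooth_approx hp hgm R hκ
  set G : Euc d → Euc m := fun x => Φ x + φ₀ x with hG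
  have hGs : ContDiff ℝ ∞ G := hΦ.add hφ₀.1
  have hGm : StronglyMeasurable G := hGs.continuous.stronglyMeasurable
  obtain ⟨B, hB⟩ := (isCompact_closedBall (0 : Euc d) (R + 1)).exists_bound_of_continuousOn
    (hGs.continuous_fderiv (by simp)).continuousOn
  refine ⟨ENNReal.ofReal B ^ p, by finiteness, fun φ hφ hD W hW hWR ε ξ hε hξ => ?_⟩
  set h : Euc d := ε • ξ with hh
  have hn : ‖h‖ ≤ 1 := by rwa [hh, norm_smul, Real.norm_of_nonneg hε.le]
  set χ : Euc d → Euc m := fun x => φ x - φ₀ x with hχ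
  have hχt : IsTest A χ := hφ.sub hφ₀
  have hχm : StronglyMeasurable χ := hχt.1.continuous.stronglyMeasurable
  have hm1 : Measurable fun x => ‖G (x + h) - G x‖ₑ ^ p :=
    ((hGm.comp_measurable (measurable_id.add_const h)).sub hGm).enorm.pow_const p
  have hm2 : Measurable fun x => ‖χ (x + h) - χ x‖ₑ ^ p :=
    ((hχm.comp_measurable (measurable_id.add_const h)).sub hχm).enorm.pow_const p
  have e1 : ∫⁻ x in W, ‖(g (x + h) - Φ (x + h)) - (g x - Φ x)‖ₑ ^ p ≤ ‖h‖ₑ ^ p * κ :=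
    (lintegral_mono_set hWR).trans (h1 h hn)
  have e2 : ∫⁻ x in W, ‖χ (x + h) - χ x‖ₑ ^ p ≤ ‖h‖ₑ ^ p * κ :=
    ((setLIntegral_le_lintegral _ _).trans
      (shiftInt_le_of_contDiff hp (hχt.1.of_le (by simp)) h)).trans (mul_le_mul' le_rfl hD)
  have e3 : ∫⁻ x in W, ‖G (x + h) - G x‖ₑ ^ p ≤ ‖h‖ₑ ^ p * (ENNReal.ofReal B ^ p * volume W) := by
    rw [← mul_assoc, ← setLIntegral_const]
    refine setLIntegral_mono' hW fun x hx => ?_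
    rw [← ENNReal.mul_rpow_of_nonneg _ _ hp0.le]
    refine ENNReal.rpow_le_rpow ?_ hp0.le
    have hxR := mem_ball_zero_iff.1 (hWR hx)
    have hB0 : 0 ≤ B := (norm_nonneg _).trans
      (hB 0 (by rw [mem_closedBall_zero_iff, norm_zero]; linarith [norm_nonneg x]))
    have := (convex_closedBall (0 : Euc d) (R + 1)).norm_image_sub_le_of_norm_fderiv_le (𝕜 := ℝ)
      (f := G) (fun y _ => hGs.differentiable (by simp) y) hB
      (mem_closedBall_zero_iff.2 (by linarith : ‖x‖ ≤ R + 1))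
      (mem_closedBall_zero_iff.2 (by linarith [norm_add_le x h] : ‖x + h‖ ≤ R + 1))
    rw [add_sub_cancel_left] at this
    rw [← ofReal_norm, ← ofReal_norm, ← ENNReal.ofReal_mul (norm_nonneg _), mul_comm]
    exact ENNReal.ofReal_le_ofReal this
  calc ∫⁻ x in W, quotPow p ε (fun x => g x + φ x) ξ x
      = ‖ε⁻¹‖ₑ ^ p * ∫⁻ x in W, ‖(g (x + h) + φ (x + h)) - (g x + φ x)‖ₑ ^ p := by
        unfold quotPow
        simp only [enorm_smul_sub_rpow hp0.le]
        rw [lintegral_const_mul' _ _ (rpow_enorm_inv_ne_top hε p)]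
    _ ≤ ‖ε⁻¹‖ₑ ^ p * (2 ^ p * ((2 ^ p * (‖h‖ₑ ^ p * κ + ‖h‖ₑ ^ p * κ))
          + ‖h‖ₑ ^ p * (ENNReal.ofReal B ^ p * volume W))) := by
        refine mul_le_mul' le_rfl ?_
        refine (lintegral_le_mul_add (a := fun x =>
          ‖((g (x + h) - Φ (x + h)) - (g x - Φ x)) + (χ (x + h) - χ x)‖ₑ ^ p)
          (two_rpow_ne_top p) hm1 fun x => ?_).trans ?_
        · refine le_trans (le_of_eq ?_) (enorm_add_rpow_le hp _ _)
          congr 2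
          simp only [hG, hχ]
          abel
        · refine mul_le_mul' le_rfl (add_le_add ?_ e3)
          refine (lintegral_le_mul_add (two_rpow_ne_top p) hm2
            fun x => enorm_add_rpow_le hp _ _).trans ?_
          exact mul_le_mul' le_rfl (add_le_add e1 e2)
    _ = (‖ε⁻¹‖ₑ ^ p * ‖h‖ₑ ^ p) * (2 ^ p * (2 ^ p * (κ + κ) + ENNReal.ofReal B ^ p * volume W)) := by
        ring
    _ = _ := by rw [hh, enorm_inv_mul_enorm_smul hp0.le hε]

theorem MemWLoc.memLp {g : Euc d → Euc m} (hg : MemWLoc p g) (hΩb : Bornology.IsBounded Ω) :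
    MemLp g (ENNReal.ofReal p) (volume.restrict Ω) := by
  obtain ⟨R, hR⟩ := hΩb.subset_ball (0 : Euc d)
  obtain ⟨V, hV⟩ := hg (Metric.ball 0 R) Metric.isOpen_ball Metric.isBounded_ball
  exact hV.memLp.mono_measure (Measure.restrict_mono hR le_rfl)

/-- The boundary datum has bounded energy. -/
theorem exists_energy_le (hp : 1 < p) (hAΩ : A ⊆ Ω) (hAo : IsOpen A)
    (hAb : Bornology.IsBounded A) {f : ℝ → Euc d → Euc d → Euc m → ℝ≥0}
    (hf : GrowthAssumptions Ω p f) {g : Euc d → Euc m} (hg : MemWLoc p g)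
    (hgm : StronglyMeasurable g) :
    ∃ M : ℝ≥0∞, M ≠ ⊤ ∧ ∀ᶠ ε in 𝓝[>] (0 : ℝ), energy f ε g A ≤ M := by
  have hp0 : 0 < p := by linarith
  have hAm := hAo.measurableSet
  obtain ⟨-, r₀, hr₀, c₀, hc₀, ρ, ψ, -, hψm, -, hψ, -, h1, -⟩ := hf
  obtain ⟨R, hR⟩ := hAb.subset_ball (0 : Euc d)
  obtain ⟨Cg, hCg, hgs⟩ := hg.exists_shift_le hp hgm R
  obtain ⟨B, hB1, hB2⟩ := exists_between hψ
  have hψB := eventually_lt_of_limsup_lt hB1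
  have hgA := ((memLp_ofReal_iff hp0).1 (hg.memLp hAb)).2.ne
  have hAf : volume A ≠ ⊤ := hAb.measure_lt_top.ne
  -- The first summand bounds the quotients for steps of length at most one, through the Sobolev
  -- regularity of `g`; the second bounds those for longer steps, through its `L^p` integral.
  set E : ℝ≥0∞ := Cg + ENNReal.ofReal (1 : ℝ)⁻¹ ^ p * (2 ^ p * (2 * ∫⁻ x in A, ‖g x‖ₑ ^ p)) with hE
  have hEt : E ≠ ⊤ := by finiteness
  have hB := hB2.ne
  refine ⟨B * (E + volume A), by finiteness, ?_⟩
  filter_upwards [hψB, self_mem_nhdsWithin] with ε hεB hε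
  have hε0 : 0 < ε := hε
  have hψ1 : Measurable fun ξ : Euc d => (ψ ε ξ : ℝ≥0∞) * ENNReal.ofReal (‖ξ‖ ^ p + 1) :=
    (hψm ε hε0).coe_nnreal_ennreal.mul
      (((measurable_norm : Measurable fun ξ : Euc d => ‖ξ‖).pow_const p).add_const 1).ennreal_ofReal
  refine le_trans ?_ (mul_le_mul' hεB.le le_rfl)
  rw [← lintegral_mul_const _ hψ1]
  refine lintegral_mono fun ξ => ?_
  have hq : ∫⁻ x in shiftSet A (ε • ξ), quotPow p ε g ξ x ≤ ‖ξ‖ₑ ^ p * E := by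
    rcases le_total (ε * ‖ξ‖) 1 with h | h
    · exact (lintegral_shiftSet_quot_le hp0 hR hgs hε0 h).trans (mul_le_mul' le_rfl le_self_add)
    · exact (lintegral_quotPow_far_le hp hAm hε0 one_pos hgm h).trans
        (mul_le_mul' le_rfl le_add_self)
  calc ∫⁻ x in shiftSet A (ε • ξ), (f ε x ξ (ε⁻¹ • (g (x + ε • ξ) - g x)) : ℝ≥0∞)
      ≤ ∫⁻ x in shiftSet A (ε • ξ), (ψ ε ξ : ℝ≥0∞) * (quotPow p ε g ξ x + 1) :=
        setLIntegral_mono' (measurableSet_shiftSet hAm _) fun x hx =>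
          coe_le_of_growth hp0.le (h1 ε hε0) (hAΩ hx.1) ξ _
    _ = (ψ ε ξ : ℝ≥0∞) * ((∫⁻ x in shiftSet A (ε • ξ), quotPow p ε g ξ x)
          + volume (shiftSet A (ε • ξ))) := by
        rw [lintegral_const_mul' _ _ ENNReal.coe_ne_top, lintegral_add_right _ measurable_const,
          setLIntegral_const, one_mul]
    _ ≤ (ψ ε ξ : ℝ≥0∞) * ((‖ξ‖ₑ ^ p + 1) * (E + volume A)) := by
        refine mul_le_mul' le_rfl ?_
        calc _ ≤ ‖ξ‖ₑ ^ p * E + volume A :=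
              add_le_add hq (measure_mono (shiftSet_subset _ _))
          _ ≤ (‖ξ‖ₑ ^ p * E + volume A) + (‖ξ‖ₑ ^ p * volume A + E) := le_self_add
          _ = _ := by ring
    _ = _ := by rw [enorm_rpow_add_one hp0.le, mul_assoc]

end auxiliary


/-! ### Imposing Dirichlet data on a recovery sequence -/

section upperBound

variable {d m : ℕ} {p : ℝ} {A Ω : Set (Euc d)}

/-- For fixed `s`, the radius `s / ε` eventually exceeds any radius given by (H2). -/
theorem eventually_tail_le {ψ : ℝ → Euc d → ℝ≥0}
    (h2 : ∀ δ > (0 : ℝ), ∃ rδ > (0 : ℝ),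
      limsup (fun ε => ∫⁻ ξ in (Metric.ball (0 : Euc d) rδ)ᶜ,
        (ψ ε ξ : ℝ≥0∞) * ENNReal.ofReal (‖ξ‖ ^ p)) (𝓝[>] (0 : ℝ)) < ENNReal.ofReal δ)
    {s : ℝ} (hs : 0 < s) {t : ℝ≥0∞} (ht : 0 < t) (htt : t ≠ ⊤) :
    ∀ᶠ ε in 𝓝[>] (0 : ℝ), ∫⁻ ξ in (Metric.ball (0 : Euc d) (s / ε))ᶜ,
      (ψ ε ξ : ℝ≥0∞) * ENNReal.ofReal (‖ξ‖ ^ p) ≤ t := by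
  obtain ⟨rδ, hrδ, h⟩ := h2 t.toReal (ENNReal.toReal_pos ht.ne' htt)
  rw [ENNReal.ofReal_toReal htt] at h
  have h3 : ∀ᶠ ε in 𝓝[>] (0 : ℝ), ε < s / rδ :=
    mem_nhdsWithin_of_mem_nhds (gt_mem_nhds (by positivity))
  filter_upwards [eventually_lt_of_limsup_lt h, h3, self_mem_nhdsWithin] with ε h4 h5 hε
  have hε0 : 0 < ε := hε
  refine le_trans (lintegral_mono_set (compl_subset_compl.2 (Metric.ball_subset_ball ?_))) h4.le
  rw [lt_div_iff₀ hrδ] at h5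
  rw [le_div_iff₀ hε0]
  linarith

theorem convexComb_mem_dirichletClass {u v g φ : Euc d → Euc m} {θ : Euc d → ℝ} {c r : ℝ}
    (hu : MemLp u (ENNReal.ofReal p) (volume.restrict Ω))
    (hg : MemLp g (ENNReal.ofReal p) (volume.restrict Ω))
    (hφ : MemLp φ (ENNReal.ofReal p) (volume.restrict Ω)) (hv : v = fun x => g x + φ x)
    (hθm : Measurable θ) (hθ0 : ∀ x, 0 ≤ θ x) (hθ1 : ∀ x, θ x ≤ 1)
    (hθ : ∀ x, Metric.infDist x Aᶜ ≤ c → θ x = 0) (hφ0 : ∀ x, Metric.infDist x Aᶜ < r → φ x = 0)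
    (hrc : r ≤ c) :
    (fun x => θ x • u x + (1 - θ x) • v x) ∈ dirichletClass Ω p r g A := by
  have key : ∀ {τ : Euc d → ℝ} {w : Euc d → Euc m}, Measurable τ → (∀ x, 0 ≤ τ x) →
      (∀ x, τ x ≤ 1) → MemLp w (ENNReal.ofReal p) (volume.restrict Ω) →
      MemLp (fun x => τ x • w x) (ENNReal.ofReal p) (volume.restrict Ω) := by
    intro τ w hτ h0 h1 hw
    refine hw.of_le (hτ.aestronglyMeasurable.smul hw.1) (Eventually.of_forall fun x => ?_)
    rw [norm_smul, Real.norm_of_nonneg (h0 x)]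
    exact mul_le_of_le_one_left (norm_nonneg _) (h1 x)
  refine ⟨(key hθm hθ0 hθ1 hu).add (key (hθm.const_sub 1) (fun x => by linarith [hθ1 x])
    (fun x => by linarith [hθ0 x]) (hv ▸ hg.add hφ)), Eventually.of_forall fun x _ hx => ?_⟩
  dsimp only
  rw [hθ x (hx.le.trans hrc), hv]
  simp [hφ0 x hx]

/-- The upper bound: Dirichlet data can be imposed on sequences with bounded energy. -/
theorem limsup_iInf_energy_le (hd : 0 < d) (hp : 1 < p) (hΩb : Bornology.IsBounded Ω)
    (hAΩ : A ⊆ Ω) (hAo : IsOpen A) {f : ℝ → Euc d → Euc d → Euc m → ℝ≥0}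
    (hf : GrowthAssumptions Ω p f) {ε : ℕ → ℝ} (hε : Tendsto ε atTop (𝓝[>] 0))
    {g : Euc d → Euc m} (hg : MemWLoc p g) (hgm : StronglyMeasurable g) {r : ℝ} (hr : 0 < r)
    {u : Euc d → Euc m} (hu : u ∈ admissible Ω p g A) (hum : StronglyMeasurable u)
    {uj : ℕ → Euc d → Euc m} (hconv : TendstoLp Ω p uj u) (hujm : ∀ j, StronglyMeasurable (uj j))
    {F : ℝ≥0∞} (hF : limsup (fun j => energy f (ε j) (uj j) A) atTop ≤ F) :
    limsup (fun j => ⨅ v ∈ dirichletClass Ω p (ε j * r) g A, energy f (ε j) v A) atTop ≤ F := by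
  have hp0 : 0 < p := by linarith
  have hAm := hAo.measurableSet
  have hAb : Bornology.IsBounded A := hΩb.subset hAΩ
  have hAf : volume A < ⊤ := hAb.measure_lt_top
  have hAt : volume A ≠ ⊤ := hAf.ne
  refine ENNReal.le_of_forall_pos_le_add fun η hη hFt => ?_
  -- the common error
  set e : ℝ≥0∞ := (η : ℝ≥0∞) / 7 with he
  have he0 : e ≠ 0 := (ENNReal.div_pos (by exact_mod_cast hη.ne') (by finiteness)).ne'
  have het : e ≠ ⊤ := ENNReal.div_ne_top ENNReal.coe_ne_top (by norm_num)
  -- The budget: one `e` for the energy of `uj j`, two for the boundary layer, two for the slope of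
  -- the cut-off, one for the long-range tail and one for the average over the layers.
  have he7 : 7 * e = η := ENNReal.mul_div_cancel (by norm_num) (by finiteness)
  have hFe : F < F + e := ENNReal.lt_add_right hFt.ne he0
  have hE := eventually_lt_of_limsup_lt (hF.trans_lt hFe)
  obtain ⟨-, r₀, hr₀, c₀, hc₀, ρ, ψ, hρm, hψm, hρ, hψ, h0, h1, h2⟩ := hf
  obtain ⟨M, hM1, hM2⟩ := exists_between hψ
  have hMe := hε.eventually (eventually_lt_of_limsup_lt hM1)
  obtain ⟨P, hP1, hP2⟩ := exists_between hρ
  have hPe := hε.eventually (eventually_lt_of_limsup_lt hP1)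
  have hMt := hM2.ne
  have hPt := hP2.ne
  obtain ⟨R, hR⟩ := hAb.subset_ball (0 : Euc d)
  set K : ℝ≥0∞ := 2 ^ p * 2 ^ p with hK
  have hKt : K ≠ ⊤ := by finiteness
  have h2t := two_rpow_ne_top p
  -- the approximating test functions
  obtain ⟨V, hV, φ, hφ, hφ1, hφ2⟩ := (memWZero_iff hp hAo hAf).1 hu.2.1
  obtain ⟨κ, hκ0, hκt, hκ⟩ := exists_pos_mul_le
    (C := K * (2 ^ p * (2 ^ p * 2)) * M) (by finiteness) he0 het
  obtain ⟨κ', hκ'0, hκ't, hκ'⟩ := exists_pos_mul_le (C := 2 ^ p * 2) (by finiteness) hκ0.ne' hκt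
  -- The order of choices matters. The index `n` of the test function used in the end depends on the
  -- slope of the cut-offs, hence on the layer width `T` and on `N`, while `T` depends on a bound
  -- for `g + φ n` in the layer. Comparing with the fixed `φ k` makes that bound uniform in `n ≥ k`
  -- and breaks the circle.
  obtain ⟨k, hk⟩ := eventually_atTop.1 (hφ2.eventually (gt_mem_nhds hκ'0))
  have hφk : ∀ n ≥ k, ∫⁻ x, ‖fderiv ℝ (fun x => φ n x - φ k x) x‖ₑ ^ p ≤ κ := by
    intro n hn
    have e1 : ∀ x, fderiv ℝ (fun x => φ n x - φ k x) x = fderiv ℝ (φ n) x - fderiv ℝ (φ k) x :=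
      fun x => fderiv_fun_sub ((hφ n).differentiable x) ((hφ k).differentiable x)
    have e2 : ∫⁻ x, ‖fderiv ℝ (fun x => φ n x - φ k x) x‖ₑ ^ p =
        ∫⁻ x in A, ‖fderiv ℝ (φ n) x - fderiv ℝ (φ k) x‖ₑ ^ p := by
      rw [← lintegral_indicator hAm]
      refine lintegral_congr fun x => ?_
      by_cases hx : x ∈ A
      · rw [indicator_of_mem hx, e1]
      · rw [indicator_of_notMem hx, ((hφ n).sub (hφ k)).fderiv_eq_zero hx,
          enorm_zero (E := Euc d →L[ℝ] Euc m), ENNReal.zero_rpow_of_pos hp0]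
    rw [e2]
    refine (lintegral_le_mul_add_of_aemeasurable (a := fun x => ‖fderiv ℝ (φ n) x - V x‖ₑ ^ p)
      (b := fun x => ‖fderiv ℝ (φ k) x - V x‖ₑ ^ p) h2t ?_ fun x => ?_).trans ?_
    · exact ((((hφ k).memLp_fderiv (ENNReal.ofReal p) (volume.restrict A)).sub
        hV.memLp_grad).1.enorm).pow_const p
    · refine le_trans (le_of_eq ?_) (enorm_sub_rpow_le hp _ _)
      rw [sub_sub_sub_cancel_right]
    · calc _ ≤ 2 ^ p * (κ' + κ') :=
            mul_le_mul' le_rfl (add_le_add (hk n hn).le (hk k le_rfl).le)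
        _ = 2 ^ p * 2 * κ' := by ring
        _ ≤ κ := hκ'
  obtain ⟨B, hBt, hB⟩ := exists_lintegral_quotPow_add_le hp hg hgm R (hφ k) hκ0
  -- the width of the boundary layer
  obtain ⟨t, ht0, htt, ht⟩ := exists_pos_mul_le
    (C := (1 + K * (2 ^ p * B)) * M) (by finiteness) he0 het
  obtain ⟨T, hT0, hT⟩ := exists_volume_layer_le hd hAo hAb ht0
  set W : Set (Euc d) := A ∩ {x | Metric.infDist x Aᶜ < T} with hW
  have hWm : MeasurableSet W := hAm.inter
    (measurableSet_lt (Metric.continuous_infDist_pt _).measurable measurable_const)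
  have hWR : W ⊆ Metric.ball 0 R := inter_subset_left.trans hR
  set β : ℝ≥0∞ := 2 ^ p * (2 ^ p * (κ + κ) + B * volume W) with hβ
  have hXM : (volume W + K * β) * M ≤ 2 * e := by
    calc (volume W + K * β) * M
        = K * (2 ^ p * (2 ^ p * 2)) * M * κ + (1 + K * (2 ^ p * B)) * M * volume W := by
          rw [hβ]; ring
      _ ≤ e + e := add_le_add hκ ((mul_le_mul' le_rfl hT).trans ht)
      _ = 2 * e := by ring
  -- the energy of the truncated functions
  obtain ⟨C, hC0, hC⟩ := exists_shiftInt_le_quotEnergy d (Euc m) (half_pos hr₀) hp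
  have hU0 : ∫⁻ x in A, ‖u x‖ₑ ^ p ≠ ⊤ :=
    ((memLp_ofReal_iff hp0).1 (hu.1.mono_measure (Measure.restrict_mono hAΩ le_rfl))).2.ne
  set Ub : ℝ≥0∞ := 2 ^ p * (1 + ∫⁻ x in A, ‖u x‖ₑ ^ p) with hUb
  have hUbt : Ub ≠ ⊤ := by finiteness
  have hvol : volume (Metric.closedBall (0 : Euc d) (r₀ / 2)) ≠ ⊤ := measure_closedBall_lt_top.ne
  set Q : ℝ≥0∞ := K * ((ENNReal.ofReal c₀⁻¹ * (F + e) + volume A * P) +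
    ENNReal.ofReal (16 / T) ^ p * ENNReal.ofReal (r₀ / 2) ^ p * Ub *
      volume (Metric.closedBall (0 : Euc d) (r₀ / 2))) with hQ
  have hFt' := hFt.ne
  have hQt : Q ≠ ⊤ := by finiteness
  -- The right-hand number bounds the total transition cost over all layers, so `N` layers leave an
  -- average cost below `e`.
  obtain ⟨N, hN⟩ := ENNReal.exists_nat_mul_gt he0
    (b := K * (M * (ENNReal.ofReal C * Q))) (by finiteness)
  have hN0 : 0 < N := by
    rcases Nat.eq_zero_or_pos N with h | h
    · simp [h] at hN
    · exact h
  have hNr : (0 : ℝ) < N := by exact_mod_cast hN0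
  -- At most one, as required by the estimates for the datum, and at most the margin of the layers.
  set s : ℝ := min 1 (T / (16 * N)) with hs
  have hs0 : 0 < s := lt_min one_pos (by positivity)
  set L : ℝ := 16 * N / T with hL
  -- the index of the test function
  obtain ⟨t₁, ht₁0, ht₁t, ht₁⟩ := exists_pos_mul_le
    (C := K * ENNReal.ofReal L ^ p * 2 ^ p * M) (by finiteness) he0 het
  -- Only now, with the slope `L` fixed, is `g + φ n` taken so close to `u` that the slope term is
  -- negligible.
  obtain ⟨n, hn1, hn2⟩ := ((hφ1.eventually (gt_mem_nhds ht₁0)).and (eventually_ge_atTop k)).exists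
  set v : Euc d → Euc m := fun x => g x + φ n x with hv
  have hvm : StronglyMeasurable v := hgm.add (hφ n).1.continuous.stronglyMeasurable
  have hgΩ := hg.memLp hΩb
  have hvA : ∫⁻ x in A, ‖v x‖ₑ ^ p ≠ ⊤ :=
    ((memLp_ofReal_iff hp0).1 (((hg.memLp hAb).add ((hφ n).memLp _ _)))).2.ne
  obtain ⟨c, hc0, hc⟩ := (hφ n).exists_eq_zero_of_infDist_lt hd hAo hAb
  set Z : ℝ≥0∞ := ENNReal.ofReal s⁻¹ ^ p * volume A + K *
        (ENNReal.ofReal s⁻¹ ^ p * (2 ^ p * (2 * Ub))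
        + ENNReal.ofReal s⁻¹ ^ p * (2 ^ p * (2 * ∫⁻ x in A, ‖v x‖ₑ ^ p))
        + ENNReal.ofReal L ^ p * (2 ^ p * (1 + t₁))) with hZ
  have hZt : Z ≠ ⊤ := by finiteness
  obtain ⟨t₂, ht₂0, ht₂t, ht₂⟩ := exists_pos_mul_le hZt he0 het
  have htail := hε.eventually (eventually_tail_le h2 hs0 ht₂0 ht₂t)
  -- convergence in `L^p(A)`
  have hUj : Tendsto (fun j => ∫⁻ x in A, ‖uj j x - u x‖ₑ ^ p) atTop (𝓝 0) :=
    tendsto_of_tendsto_of_tendsto_of_le_of_le tendsto_const_nhds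
      ((tendsto_eLpNorm_zero_iff hp0).1 hconv.2.2) (fun _ => zero_le)
      fun j => lintegral_mono_set hAΩ
  have hε1 : ∀ b > (0 : ℝ), ∀ᶠ j in atTop, ε j < b := fun b hb =>
    hε.eventually (mem_nhdsWithin_of_mem_nhds (gt_mem_nhds hb))
  have hmain : ∀ᶠ j in atTop, (⨅ v ∈ dirichletClass Ω p (ε j * r) g A, energy f (ε j) v A)
      ≤ F + 7 * e := by
    filter_upwards [hE, hMe, hPe, htail, hUj.eventually (gt_mem_nhds ht₁0),
      hUj.eventually (gt_mem_nhds one_pos), hε.eventually self_mem_nhdsWithin, hε1 1 one_pos,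
      hε1 (c / r) (by positivity), hε1 (T / 4 / r) (by positivity), hε1 (T / 16 / r₀) (by positivity)]
      with j hEj hMj hPj htailj hUj1 hUj2 hεj hεj1 hεjc hεjT hεjT'
    have hεj0 : 0 < ε j := hεj
    rw [lt_div_iff₀ hr] at hεjc hεjT
    rw [lt_div_iff₀ hr₀] at hεjT'
    have hump : Measurable fun x => ‖u x‖ₑ ^ p := hum.enorm.pow_const p
    have huvp : Measurable fun x => ‖u x - v x‖ₑ ^ p := (hum.sub hvm).enorm.pow_const p
    have hUjb : ∫⁻ x in A, ‖uj j x‖ₑ ^ p ≤ Ub := by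
      refine (lintegral_le_mul_add (a := fun x => ‖uj j x - u x‖ₑ ^ p) h2t hump fun x => ?_).trans
        (mul_le_mul' le_rfl (add_le_add hUj2.le le_rfl))
      refine le_trans (le_of_eq ?_) (enorm_add_rpow_le hp _ _)
      rw [sub_add_cancel]
    have hUn : ∫⁻ x in A, ‖u x - v x‖ₑ ^ p ≤ t₁ := by
      refine le_trans (le_of_eq ?_) hn1.le
      refine lintegral_congr fun x => ?_
      rw [← enorm_neg]
      congr 2
      simp only [hv]; abel
    have hUv : ∀ {a : ℝ≥0∞}, ∫⁻ x in A, ‖uj j x - u x‖ₑ ^ p ≤ a →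
        ∫⁻ x in A, ‖uj j x - v x‖ₑ ^ p ≤ 2 ^ p * (a + t₁) := by
      intro a ha
      refine (lintegral_le_mul_add (a := fun x => ‖uj j x - u x‖ₑ ^ p) h2t huvp fun x => ?_).trans
        (mul_le_mul' le_rfl (add_le_add ha hUn))
      refine le_trans (le_of_eq ?_) (enorm_add_rpow_le hp _ _)
      rw [sub_add_sub_cancel]
    have hujA : MemLp (uj j) (ENNReal.ofReal p) (volume.restrict A) :=
      (hconv.1 j).mono_measure (Measure.restrict_mono hAΩ le_rfl)
    -- This ramp vanishes at distance at most `T/16` from the complement and equals one from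
    -- distance `T/8` on, a region containing all the steps shorter than `s` that meet a transition
    -- layer.
    set u' : Euc d → Euc m := fun x => ramp (16 / T * Metric.infDist x Aᶜ - 1) • uj j x with hu'
    have hu'm : StronglyMeasurable u' :=
      (measurable_ramp_infDist Aᶜ (16 / T) 1).stronglyMeasurable.smul (hujm j)
    have hQj : quotEnergy p (r₀ / 2) (ε j) u' ≤ Q := by
      refine (quotEnergy_ramp_le hp hAm hεj0 (half_lt_self hr₀) (by positivity) ?_ (hujm j)).trans ?_
      · rw [div_mul_eq_mul_div, div_le_one hT0]
        linarith
      · refine mul_le_mul' le_rfl (add_le_add ?_ ?_)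
        · refine (localEnergy_le_energy hp0.le hAΩ hAm hc₀ (half_lt_self hr₀) (hρm _ hεj0)
            (h0 _ hεj0) (uj j)).trans ?_
          exact add_le_add (mul_le_mul' le_rfl hEj.le) (mul_le_mul' le_rfl hPj.le)
        · exact mul_le_mul' (mul_le_mul' le_rfl hUjb) le_rfl
    have havg := nat_mul_le_of_forall_cutoff hp hAΩ hAm hN0 hT0 (min_le_right _ _ : s ≤ _) hεj0
      hεj1.le hs0 (h1 _ hεj0) (hψm _ hεj0) (hujm j) hvm hu'm (fun x hx => ?_) (β := β)
      (fun ξ hξ => hB (φ n) (hφ n) (hφk n hn2) W hWm hWR (ε j) ξ hεj0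
        (hξ.le.trans (min_le_left _ _)))
      (Q := ENNReal.ofReal C * Q) (fun ξ => ?_)
      (I := ⨅ v ∈ dirichletClass Ω p (ε j * r) g A, energy f (ε j) v A)
      (fun θ hθm hθ0 hθ1 hθ => iInf₂_le _ (convexComb_mem_dirichletClass (hconv.1 j) hgΩ
        ((hφ n).memLp _ _) hv hθm hθ0 hθ1 hθ (fun x hx => hc x (hx.trans hεjc)) hεjT.le))
    · set I := ⨅ v ∈ dirichletClass Ω p (ε j * r) g A, energy f (ε j) v A with hI
      have hNI : (N : ℝ≥0∞) * I ≤ N * (F + 7 * e) := by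
        refine havg.trans ?_
        calc _ ≤ (N : ℝ≥0∞) * ((F + e) + (volume W + K * β + K * ENNReal.ofReal L ^ p *
                  (2 ^ p * (t₁ + t₁))) * M + Z * t₂) + K * (M * (ENNReal.ofReal C * Q)) := by
              refine add_le_add (mul_le_mul' le_rfl (add_le_add (add_le_add hEj.le ?_) ?_)) ?_
              · exact mul_le_mul' (add_le_add le_rfl (mul_le_mul' le_rfl (hUv hUj1.le))) hMj.le
              · refine mul_le_mul' (add_le_add le_rfl (mul_le_mul' le_rfl
                  (add_le_add (add_le_add ?_ le_rfl) (mul_le_mul' le_rfl (hUv hUj2.le))))) htailj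
                exact mul_le_mul' le_rfl (mul_le_mul' le_rfl (mul_le_mul' le_rfl hUjb))
              · exact mul_le_mul' le_rfl (mul_le_mul' hMj.le le_rfl)
          _ = (N : ℝ≥0∞) * ((F + e) + ((volume W + K * β) * M + 2 * (K * ENNReal.ofReal L ^ p *
                  2 ^ p * M * t₁)) + Z * t₂) + K * (M * (ENNReal.ofReal C * Q)) := by ring
          _ ≤ (N : ℝ≥0∞) * ((F + e) + (2 * e + 2 * e) + e) + N * e :=
              add_le_add (mul_le_mul' le_rfl (add_le_add (add_le_add le_rfl
                (add_le_add hXM (mul_le_mul' le_rfl ht₁))) ht₂)) hN.le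
          _ = N * (F + 7 * e) := by ring
      exact (ENNReal.mul_le_mul_iff_right (by exact_mod_cast hN0.ne') (ENNReal.natCast_ne_top N)).1 hNI
    · simp only [hu']
      rw [ramp_of_one_le, one_smul]
      have : 16 / T * (T / 8) ≤ 16 / T * Metric.infDist x Aᶜ :=
        mul_le_mul_of_nonneg_left hx (by positivity)
      have h3 : 16 / T * (T / 8) = 2 := by field_simp; norm_num
      linarith
    · refine (hC (ε j) u' ξ hεj0 (integrable_ramp_smul hp hAb hujA (hujm j)) hu'm).trans ?_
      rw [ENNReal.ofReal_mul hC0.le, mul_comm (ENNReal.ofReal C), mul_assoc]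
      exact mul_le_mul' le_rfl (mul_le_mul' le_rfl hQj)
  rw [← he7]
  exact limsup_le_of_le (by isBoundedDefault) hmain

end upperBound


/-! ### Changes of representative, subsequences and compactness of minimizing sequences -/

section convergence

variable {d m : ℕ} {p : ℝ} {A Ω : Set (Euc d)}

theorem energy_congr (f : ℝ → Euc d → Euc d → Euc m → ℝ≥0) (ε : ℝ) (hAm : MeasurableSet A)
    {u u' : Euc d → Euc m} (h : ∀ᵐ x : Euc d, x ∈ A → u x = u' x) :
    energy f ε u A = energy f ε u' A := by
  refine lintegral_congr fun ξ => ?_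
  refine setLIntegral_congr_fun_ae (measurableSet_shiftSet hAm (ε • ξ)) ?_
  filter_upwards [h, ae_shift h (ε • ξ)] with x h1 h2 hx
  rw [h1 hx.1, h2 hx.2]

theorem dirichletClass_congr {r : ℝ} {g g' : Euc d → Euc m} (h : g =ᵐ[volume] g') :
    dirichletClass Ω p r g A = dirichletClass Ω p r g' A := by
  ext u
  refine and_congr_right fun _ => ⟨fun h1 => ?_, fun h1 => ?_⟩
  · filter_upwards [h1, h] with x h2 h3 h4 h5
    rw [h2 h4 h5, h3]
  · filter_upwards [h1, h] with x h2 h3 h4 h5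
    rw [h2 h4 h5, h3]

theorem admissible_of_ae_eq (hp : 1 < p) (hAΩ : A ⊆ Ω) (hAo : IsOpen A) (hA : volume A < ⊤)
    (hΩm : MeasurableSet Ω) {g g' u u' : Euc d → Euc m} (hg : g =ᵐ[volume] g')
    (hu : u =ᵐ[volume.restrict Ω] u') (h : u ∈ admissible Ω p g A) : u' ∈ admissible Ω p g' A := by
  refine ⟨h.1.ae_eq hu, h.2.1.congr hp hAo hA ?_, ?_⟩
  · filter_upwards [ae_mono (Measure.restrict_mono hAΩ le_rfl) hu, ae_restrict_of_ae hg] with x h1 h2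
    rw [h1, h2]
  · filter_upwards [h.2.2, (ae_restrict_iff' hΩm).1 hu, hg] with x h1 h2 h3 hx
    rw [← h2 hx.1, h1 hx, h3]

theorem MemWLoc.aestronglyMeasurable {g : Euc d → Euc m} (hg : MemWLoc p g) :
    AEStronglyMeasurable g volume := by
  have h : AEStronglyMeasurable g (volume.restrict (⋃ n : ℕ, Metric.ball (0 : Euc d) n)) := by
    rw [aestronglyMeasurable_iUnion_iff]
    exact fun n => (hg.memLp Metric.isBounded_ball).1
  rwa [Metric.iUnion_ball_nat, Measure.restrict_univ] at h

theorem MemWLoc.congr {g g' : Euc d → Euc m} (hg : MemWLoc p g) (h : g =ᵐ[volume] g') :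
    MemWLoc p g' := fun U hU hUb => by
  obtain ⟨V, hV⟩ := hg U hU hUb
  exact ⟨V, hV.congr (ae_restrict_of_ae h)⟩

theorem TendstoLp.congr {u u' : ℕ → Euc d → Euc m} {u₀ u₀' : Euc d → Euc m}
    (h : TendstoLp Ω p u u₀) (hu : ∀ j, u j =ᵐ[volume.restrict Ω] u' j)
    (hu₀ : u₀ =ᵐ[volume.restrict Ω] u₀') : TendstoLp Ω p u' u₀' := by
  refine ⟨fun j => (h.1 j).ae_eq (hu j), h.2.1.ae_eq hu₀, h.2.2.congr fun j => ?_⟩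
  exact eLpNorm_congr_ae ((hu j).sub hu₀)

theorem TendstoLp.comp {u : ℕ → Euc d → Euc m} {u₀ : Euc d → Euc m} (h : TendstoLp Ω p u u₀)
    {φ : ℕ → ℕ} (hφ : StrictMono φ) : TendstoLp Ω p (fun k => u (φ k)) u₀ :=
  ⟨fun _ => h.1 _, h.2.1, h.2.2.comp hφ.tendsto_atTop⟩

theorem TendstoLp.unique (hp : 1 < p) {u : ℕ → Euc d → Euc m} {u₀ u₁ : Euc d → Euc m}
    (h₀ : TendstoLp Ω p u u₀) (h₁ : TendstoLp Ω p u u₁) : u₀ =ᵐ[volume.restrict Ω] u₁ := by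
  have hp1 : (1 : ℝ≥0∞) ≤ ENNReal.ofReal p := by simpa using hp.le
  have hle : ∀ j, eLpNorm (fun x => u₀ x - u₁ x) (ENNReal.ofReal p) (volume.restrict Ω) ≤
      eLpNorm (fun x => u j x - u₁ x) (ENNReal.ofReal p) (volume.restrict Ω)
        + eLpNorm (fun x => u j x - u₀ x) (ENNReal.ofReal p) (volume.restrict Ω) := by
    intro j
    refine le_trans (le_of_eq ?_) (eLpNorm_sub_le ((h₁.1 j).sub h₁.2.1).1 ((h₀.1 j).sub h₀.2.1).1 hp1)
    congr 1
    funext x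
    simp
  have hlim := h₁.2.2.add h₀.2.2
  rw [add_zero] at hlim
  have h0 := le_antisymm (ge_of_tendsto' hlim hle) zero_le
  have h2 := (eLpNorm_eq_zero_iff (h₀.2.1.sub h₁.2.1).1
    (zero_lt_one.trans_le hp1).ne').1 h0
  filter_upwards [h2] with x hx
  exact sub_eq_zero.1 hx

/-- The `Γ`-liminf inequality along subsequences. -/
theorem GammaTendstoLp.le_liminf_subseq {Φ : ℕ → (Euc d → Euc m) → ℝ≥0∞}
    {Φ₀ : (Euc d → Euc m) → ℝ≥0∞} (h : GammaTendstoLp Ω p Φ Φ₀) {φ : ℕ → ℕ} (hφ : StrictMono φ)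
    {u : ℕ → Euc d → Euc m} {u₀ : Euc d → Euc m} (hu : TendstoLp Ω p u u₀) :
    Φ₀ u₀ ≤ liminf (fun k => Φ (φ k) (u k)) atTop := by
  -- The subsequence is completed to a full sequence by inserting the limit `u₀` at the missing
  -- indices, which preserves convergence.
  set w : ℕ → Euc d → Euc m := Function.extend φ u (fun _ => u₀) with hw
  have hwφ : ∀ k, w (φ k) = u k := fun k => hφ.injective.extend_apply _ _ _
  have hwn : ∀ j, (¬ ∃ k, φ k = j) → w j = u₀ := fun j hj => Function.extend_apply' _ _ _ hj
  have hconv : TendstoLp Ω p w u₀ := by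
    refine ⟨fun j => ?_, hu.2.1, ?_⟩
    · by_cases hj : ∃ k, φ k = j
      · obtain ⟨k, rfl⟩ := hj
        rw [hwφ]; exact hu.1 k
      · rw [hwn j hj]; exact hu.2.1
    · rw [ENNReal.tendsto_nhds_zero]
      intro e he
      obtain ⟨K, hK⟩ := eventually_atTop.1 (ENNReal.tendsto_nhds_zero.1 hu.2.2 e he)
      filter_upwards [eventually_ge_atTop (φ K)] with j hj
      by_cases hj' : ∃ k, φ k = j
      · obtain ⟨k, rfl⟩ := hj'
        rw [hwφ]
        exact hK k (hφ.le_iff_le.1 hj)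
      · rw [hwn j hj']
        simp
  refine ((h u₀ hu.2.1).1 w hconv).trans ?_
  refine (liminf_le_liminf_of_le hφ.tendsto_atTop).trans (le_of_eq ?_)
  rw [← Filter.liminf_comp]
  refine congrArg (fun F : ℕ → ℝ≥0∞ => liminf F atTop) (funext fun k => ?_)
  simp only [Function.comp, hwφ]

/-- Compactness of sequences with bounded energy in the Dirichlet classes. -/
theorem exists_subseq_tendstoLp_of_energy_le (hd : 0 < d) (hp : 1 < p) (hΩm : MeasurableSet Ω)
    (hΩb : Bornology.IsBounded Ω) (hAΩ : A ⊆ Ω) (hAo : IsOpen A)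
    {f : ℝ → Euc d → Euc d → Euc m → ℝ≥0}
    (hf : GrowthAssumptions Ω p f) {ε : ℕ → ℝ} (hε : Tendsto ε atTop (𝓝[>] 0))
    (hε0 : ∀ k, 0 < ε k)
    {g : Euc d → Euc m} (hg : MemWLoc p g) (hgm : StronglyMeasurable g) {r : ℝ} (hr : 0 < r)
    {M : ℝ≥0∞} (hM : M ≠ ⊤) {u : ℕ → Euc d → Euc m}
    (hu : ∀ k, u k ∈ dirichletClass Ω p (ε k * r) g A) (huM : ∀ k, energy f (ε k) (u k) A ≤ M) :
    ∃ φ : ℕ → ℕ, StrictMono φ ∧ ∃ u₀ ∈ admissible Ω p g A, TendstoLp Ω p (fun k => u (φ k)) u₀ := by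
  have hp0 : 0 < p := by linarith
  have hAm := hAo.measurableSet
  have hAb : Bornology.IsBounded A := hΩb.subset hAΩ
  have hAf : volume A < ⊤ := hAb.measure_lt_top
  have h2t := two_rpow_ne_top p
  obtain ⟨R₀, hR₀⟩ := hAb.subset_ball (0 : Euc d)
  set R := max R₀ 1 with hR
  have hR0 : 0 < R := lt_of_lt_of_le one_pos (le_max_right _ _)
  have hAR : A ⊆ Metric.ball 0 R := hR₀.trans (Metric.ball_subset_ball (le_max_left _ _))
  obtain ⟨C, hC⟩ := exists_isTest_of_energy_le hp hAΩ hAo hAb hf hg hgm hr hM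
  obtain ⟨J, hJ⟩ := eventually_atTop.1 (hε.eventually hC)
  -- The test functions exist only for small `ε`, whence the shift of the index by `J`.
  have hex := fun k => hJ (k + J) (Nat.le_add_left J k) (u (k + J)) (hu _) (huM _)
  choose v hv1 hv2 hv3 using hex
  obtain ⟨φ, hφ, w, hw, hvw⟩ := exists_subseq_tendsto_of_fderiv_bounded hd hp
    (fun k => (hv1 k).1.of_le (by simp)) hR0 (fun k x hx => (hv1 k).eq_zero fun hxA =>
      absurd (mem_ball_zero_iff.1 (hAR hxA)) (not_lt.2 hx)) hv2
  have hwA : MemLp w (ENNReal.ofReal p) (volume.restrict A) := hw.mono_measure Measure.restrict_le_self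
  have hvwA : Tendsto (fun k => ∫⁻ x in A, ‖v (φ k) x - w x‖ₑ ^ p) atTop (𝓝 0) :=
    tendsto_of_tendsto_of_tendsto_of_le_of_le tendsto_const_nhds hvw (fun _ => zero_le)
      fun k => setLIntegral_le_lintegral _ _
  have hw0 : MemWZero A p w := memWZero_of_tendsto hp hAo hAf (fun k => hv1 (φ k))
    (fun k => hv2 (φ k)) hwA hvwA
  have hgΩ := hg.memLp hΩb
  set u₀ : Euc d → Euc m := fun x => g x + A.indicator w x with hu₀
  have hwi : MemLp (A.indicator w) (ENNReal.ofReal p) volume := hw.indicator hAm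
  have hψ : StrictMono fun k => φ k + J := fun a b hab => Nat.add_lt_add_right (hφ hab) J
  have hu₀m : MemLp u₀ (ENNReal.ofReal p) (volume.restrict Ω) := hgΩ.add (hwi.restrict Ω)
  refine ⟨fun k => φ k + J, hψ, u₀, ⟨hu₀m, ?_, ?_⟩, fun k => (hu _).1, hu₀m, ?_⟩
  · refine hw0.congr hp hAo hAf ((ae_restrict_iff' hAm).2 (Eventually.of_forall fun x hx => ?_))
    simp [hu₀, indicator_of_mem hx]
  · refine Eventually.of_forall fun x hx => ?_
    simp [hu₀, indicator_of_notMem hx.2]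
  · rw [tendsto_eLpNorm_zero_iff hp0]
    have hεp : Tendsto (fun k => ENNReal.ofReal (C * ε (φ k + J) ^ p)) atTop (𝓝 0) := by
      have h1 : Tendsto (fun k => ε (φ k + J)) atTop (𝓝 0) :=
        (hε.mono_right nhdsWithin_le_nhds).comp hψ.tendsto_atTop
      have h2 := (((Real.continuous_rpow_const hp0.le).tendsto 0).comp h1).const_mul C
      rw [Real.zero_rpow hp0.ne', mul_zero] at h2
      have h3 := ENNReal.tendsto_ofReal h2
      rwa [ENNReal.ofReal_zero] at h3
    have hlim := ENNReal.Tendsto.const_mul (hεp.add hvwA) (Or.inr h2t)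
    rw [add_zero, mul_zero] at hlim
    refine tendsto_of_tendsto_of_tendsto_of_le_of_le tendsto_const_nhds hlim (fun _ => zero_le)
      fun k => ?_
    -- On `Ω \ A` the distance to the complement is zero, so the boundary condition gives `u = g =
    -- u₀` there, almost everywhere.
    have hsplit : ∫⁻ x in Ω, ‖u (φ k + J) x - u₀ x‖ₑ ^ p =
        ∫⁻ x in A, ‖u (φ k + J) x - u₀ x‖ₑ ^ p := by
      rw [← lintegral_indicator hΩm, ← lintegral_indicator hAm]
      refine lintegral_congr_ae ?_
      filter_upwards [(hu (φ k + J)).2] with x hx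
      by_cases hxA : x ∈ A
      · rw [indicator_of_mem hxA, indicator_of_mem (hAΩ hxA)]
      · rw [indicator_of_notMem hxA]
        by_cases hxΩ : x ∈ Ω
        · have h3 := hx hxΩ (by
            rw [Metric.infDist_zero_of_mem (mem_compl hxA)]; exact mul_pos (hε0 _) hr)
          rw [indicator_of_mem hxΩ, h3]
          simp [hu₀, indicator_of_notMem hxA, hp0]
        · rw [indicator_of_notMem hxΩ]
    dsimp only
    rw [hsplit]
    calc ∫⁻ x in A, ‖u (φ k + J) x - u₀ x‖ₑ ^ p
        = ∫⁻ x in A, ‖(v (φ k) x - w x) - (v (φ k) x - (u (φ k + J) x - g x))‖ₑ ^ p := by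
          refine setLIntegral_congr_fun hAm fun x hx => ?_
          simp only [hu₀, indicator_of_mem hx]
          congr 2; abel
      _ ≤ 2 ^ p * ((∫⁻ x in A, ‖v (φ k) x - (u (φ k + J) x - g x)‖ₑ ^ p)
            + ∫⁻ x in A, ‖v (φ k) x - w x‖ₑ ^ p) := by
          refine lintegral_le_mul_add_of_aemeasurable h2t
            (((((hv1 (φ k)).memLp (ENNReal.ofReal p) (volume.restrict A)).sub
              hwA).1.enorm).pow_const p) fun x => ?_
          rw [add_comm (‖_‖ₑ ^ p)]
          exact enorm_sub_rpow_le hp _ _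
      _ ≤ _ := mul_le_mul' le_rfl (add_le_add (hv3 (φ k)) le_rfl)

end convergence


/-! ### Convergence of the infima and of asymptotic minimizers -/

theorem convergence_of_minima {d m : ℕ} (hd : 0 < d) {p : ℝ} (hp : 1 < p) {A Ω : Set (Euc d)}
    (hΩm : MeasurableSet Ω) (hΩb : Bornology.IsBounded Ω) (hAΩ : A ⊆ Ω) (hAo : IsOpen A)
    {f : ℝ → Euc d → Euc d → Euc m → ℝ≥0} (hf : GrowthAssumptions Ω p f)
    {ε : ℕ → ℝ} (hε : ∀ j, 0 < ε j) (hε0 : Tendsto ε atTop (𝓝 0))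
    {f₀ : Euc d → (Euc d →L[ℝ] Euc m) → ℝ≥0}
    (hΓ : GammaTendstoLp Ω p (fun j u => energy f (ε j) u A) (fun u => limitEnergy f₀ p u A))
    {g : Euc d → Euc m} (hg : MemWLoc p g) (hgm : StronglyMeasurable g) {r : ℝ} (hr : 0 < r) :
    (∃ μ : ℝ≥0∞, IsLeast ((fun u => limitEnergy f₀ p u A) '' admissible Ω p g A) μ ∧
      Tendsto (fun j => ⨅ u ∈ dirichletClass Ω p (ε j * r) g A, energy f (ε j) u A) atTop (𝓝 μ)) ∧
    (∀ (u : ℕ → Euc d → Euc m) (u₀ : Euc d → Euc m) (l : ℝ≥0∞),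
      (∀ j, u j ∈ dirichletClass Ω p (ε j * r) g A) → TendstoLp Ω p u u₀ →
      Tendsto (fun j => energy f (ε j) (u j) A) atTop (𝓝 l) →
      Tendsto (fun j => ⨅ v ∈ dirichletClass Ω p (ε j * r) g A, energy f (ε j) v A) atTop (𝓝 l) →
      u₀ ∈ admissible Ω p g A ∧
      ∀ v ∈ admissible Ω p g A, limitEnergy f₀ p u₀ A ≤ limitEnergy f₀ p v A) := by
  have hAm := hAo.measurableSet
  have hAb : Bornology.IsBounded A := hΩb.subset hAΩ
  have hAf : volume A < ⊤ := hAb.measure_lt_top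
  have hε' : Tendsto ε atTop (𝓝[>] 0) :=
    tendsto_nhdsWithin_iff.2 ⟨hε0, Eventually.of_forall hε⟩
  set I : ℕ → ℝ≥0∞ := fun j => ⨅ u ∈ dirichletClass Ω p (ε j * r) g A, energy f (ε j) u A with hI
  -- upper bound
  have hupper : ∀ v ∈ admissible Ω p g A, limsup I atTop ≤ limitEnergy f₀ p v A := by
    intro v hv
    obtain ⟨w, hw, hwlim⟩ := (hΓ v hv.1).2
    -- The cut-off estimates are stated for strongly measurable functions. Replacing `v` and the
    -- recovery sequence by such representatives changes neither admissibility nor the energies.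
    obtain ⟨v', hv'm, hvv'⟩ := hv.1.1
    choose w' hw'm hww' using fun j => (hw.1 j).1
    refine limsup_iInf_energy_le hd hp hΩb hAΩ hAo hf hε' hg hgm hr
      (admissible_of_ae_eq hp hAΩ hAo hAf hΩm EventuallyEq.rfl hvv' hv) hv'm (hw.congr hww' hvv')
      hw'm (le_trans (le_of_eq ?_) hwlim)
    refine congrArg (fun F : ℕ → ℝ≥0∞ => limsup F atTop) (funext fun j => ?_)
    refine (energy_congr f (ε j) hAm ?_).symm
    exact (ae_restrict_iff' hAm).1 (ae_mono (Measure.restrict_mono hAΩ le_rfl) (hww' j))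
  -- boundedness
  obtain ⟨M, hMt, hM⟩ := exists_energy_le hp hAΩ hAo hAb hf hg hgm
  have hsup : limsup I atTop ≤ M := by
    refine limsup_le_of_le (by isBoundedDefault) ?_
    filter_upwards [hε'.eventually hM] with j hj
    exact (iInf₂_le g ⟨hg.memLp hΩb, Eventually.of_forall fun _ _ _ => rfl⟩).trans hj
  have hinf_sup : liminf I atTop ≤ limsup I atTop := liminf_le_limsup
  have hℓt : liminf I atTop ≠ ⊤ := ne_top_of_le_ne_top hMt (hinf_sup.trans hsup)
  -- lower bound
  have hlower : ∃ u ∈ admissible Ω p g A, limitEnergy f₀ p u A ≤ liminf I atTop := by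
    -- Infinitely many indices have an infimum within `1/(n+1)` of the liminf, which is finite
    -- because the datum `g` itself has bounded energy. A diagonal extraction gives competitors
    -- whose energies have limsup at most the liminf of the infima.
    have hfreq : ∀ n : ℕ, ∃ᶠ j in atTop, ∃ u ∈ dirichletClass Ω p (ε j * r) g A,
        energy f (ε j) u A < liminf I atTop + ((n : ℝ≥0∞) + 1)⁻¹ := by
      intro n
      have hlt : liminf I atTop < liminf I atTop + ((n : ℝ≥0∞) + 1)⁻¹ :=
        ENNReal.lt_add_right hℓt (ENNReal.inv_ne_zero.2 (by finiteness))
      refine (frequently_lt_of_liminf_lt (by isBoundedDefault) hlt).mono fun j hj => ?_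
      simpa only [hI, iInf_lt_iff, exists_prop] using hj
    obtain ⟨σ, hσ, hP⟩ := extraction_forall_of_frequently hfreq
    choose u hu hue using hP
    obtain ⟨φ, hφ, u₀, hu₀, hconv⟩ := exists_subseq_tendstoLp_of_energy_le hd hp hΩm hΩb hAΩ hAo hf
      (hε'.comp hσ.tendsto_atTop) (fun k => hε _) hg hgm hr (M := liminf I atTop + 1)
      (by finiteness) hu fun k => (hue k).le.trans
        (add_le_add le_rfl (ENNReal.inv_le_one.2 le_add_self))
    refine ⟨u₀, hu₀, ?_⟩
    have hlim : Tendsto (fun k => liminf I atTop + ((φ k : ℝ≥0∞) + 1)⁻¹) atTop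
        (𝓝 (liminf I atTop)) := by
      have h1 : Tendsto (fun n : ℕ => ((n : ℝ≥0∞) + 1)⁻¹) atTop (𝓝 0) := by
        refine tendsto_of_tendsto_of_tendsto_of_le_of_le tendsto_const_nhds
          ENNReal.tendsto_inv_nat_nhds_zero (fun _ => zero_le) fun n => ?_
        exact ENNReal.inv_le_inv.2 le_self_add
      have h2 := (h1.comp hφ.tendsto_atTop).const_add (liminf I atTop)
      rwa [add_zero] at h2
    rw [← hlim.liminf_eq]
    refine (hΓ.le_liminf_subseq (hσ.comp hφ) hconv).trans (liminf_le_liminf ?_)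
    exact Eventually.of_forall fun k => (hue (φ k)).le
  obtain ⟨u₁, hu₁, hu₁le⟩ := hlower
  -- The limit energy of `u₁` is at most the liminf of the infima by compactness, and at least their
  -- limsup because `u₁` is itself an admissible competitor in the upper bound.
  have hlimI : Tendsto I atTop (𝓝 (limitEnergy f₀ p u₁ A)) :=
    tendsto_of_le_liminf_of_limsup_le hu₁le (hupper u₁ hu₁)
  have hmin : ∀ v ∈ admissible Ω p g A, limitEnergy f₀ p u₁ A ≤ limitEnergy f₀ p v A :=
    fun v hv => hu₁le.trans (hinf_sup.trans (hupper v hv))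
  refine ⟨⟨_, ⟨⟨u₁, hu₁, rfl⟩, ?_⟩, hlimI⟩, ?_⟩
  · rintro _ ⟨v, hv, rfl⟩
    exact hmin v hv
  · intro u u₀ l hu hconv hul hIl
    have hl : l = limitEnergy f₀ p u₁ A := tendsto_nhds_unique hIl hlimI
    -- Finiteness of `l` provides the energy bound `l + 1` for large indices, hence compactness. The
    -- limit of the subsequence agrees with `u₀` almost everywhere on `Ω`, which makes `u₀`
    -- admissible.
    have hlt : l ≠ ⊤ := by
      rw [hl]
      exact ne_top_of_le_ne_top hℓt hu₁le
    obtain ⟨J, hJ⟩ := eventually_atTop.1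
      (hul.eventually (gt_mem_nhds (ENNReal.lt_add_right hlt one_ne_zero)))
    have hshift : StrictMono fun k => k + J := fun a b hab => Nat.add_lt_add_right hab J
    obtain ⟨φ, hφ, w, hw, hwconv⟩ := exists_subseq_tendstoLp_of_energy_le hd hp hΩm hΩb hAΩ hAo hf
      (hε'.comp hshift.tendsto_atTop) (fun k => hε _) hg hgm hr (M := l + 1) (by finiteness)
      (fun k => hu (k + J)) fun k => (hJ _ (Nat.le_add_left J k)).le
    have hww := hwconv.unique hp (hconv.comp (hshift.comp hφ))
    refine ⟨admissible_of_ae_eq hp hAΩ hAo hAf hΩm EventuallyEq.rfl hww hw, fun v hv => ?_⟩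
    refine le_trans ?_ (hmin v hv)
    rw [← hl, ← hul.liminf_eq]
    exact (hΓ u₀ hconv.2.1).1 u hconv

end NonlocalGamma

theorem mainTheorem9
    (d m : ℕ) (hd : 0 < d) (hm : 0 < m) (p : ℝ) (hp : 1 < p)
    (Ω : Set (NonlocalGamma.Euc d)) (hΩo : IsOpen Ω) (hΩb : Bornology.IsBounded Ω)
    (hΩL : NonlocalGamma.LipschitzBoundary Ω)
    (A : Set (NonlocalGamma.Euc d)) (hAΩ : A ⊆ Ω) (hAo : IsOpen A)
    (hAL : NonlocalGamma.LipschitzBoundary A)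
    (f : ℝ → NonlocalGamma.Euc d → NonlocalGamma.Euc d → NonlocalGamma.Euc m → ℝ≥0)
    (hf : NonlocalGamma.GrowthAssumptions Ω p f)
    (ε : ℕ → ℝ) (hε : ∀ j, 0 < ε j) (hε0 : Tendsto ε atTop (𝓝 0))
    (f₀ : NonlocalGamma.Euc d → (NonlocalGamma.Euc d →L[ℝ] NonlocalGamma.Euc m) → ℝ≥0)
    (hΓ : NonlocalGamma.GammaTendstoLp Ω p
      (fun j u => NonlocalGamma.energy f (ε j) u A)
      (fun u => NonlocalGamma.limitEnergy f₀ p u A))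
    (g : NonlocalGamma.Euc d → NonlocalGamma.Euc m) (hg : NonlocalGamma.MemWLoc p g)
    (r : ℝ) (hr : 0 < r) :
    -- the minimum of the limit problem is attained, and the infima converge to it
    (∃ μ : ℝ≥0∞,
      IsLeast ((fun u => NonlocalGamma.limitEnergy f₀ p u A) ''
        NonlocalGamma.admissible Ω p g A) μ ∧
      Tendsto (fun j => ⨅ u ∈ NonlocalGamma.dirichletClass Ω p (ε j * r) g A,
        NonlocalGamma.energy f (ε j) u A) atTop (𝓝 μ)) ∧
    -- limits of asymptotically minimizing sequences are minimizers
    (∀ (u : ℕ → NonlocalGamma.Euc d → NonlocalGamma.Euc m)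
      (u₀ : NonlocalGamma.Euc d → NonlocalGamma.Euc m) (l : ℝ≥0∞),
      (∀ j, u j ∈ NonlocalGamma.dirichletClass Ω p (ε j * r) g A) →
      NonlocalGamma.TendstoLp Ω p u u₀ →
      Tendsto (fun j => NonlocalGamma.energy f (ε j) (u j) A) atTop (𝓝 l) →
      Tendsto (fun j => ⨅ v ∈ NonlocalGamma.dirichletClass Ω p (ε j * r) g A,
        NonlocalGamma.energy f (ε j) v A) atTop (𝓝 l) →
      u₀ ∈ NonlocalGamma.admissible Ω p g A ∧
      ∀ v ∈ NonlocalGamma.admissible Ω p g A,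
        NonlocalGamma.limitEnergy f₀ p u₀ A ≤ NonlocalGamma.limitEnergy f₀ p v A) := by
  have hAb : Bornology.IsBounded A := hΩb.subset hAΩ
  have hAf : volume A < ⊤ := hAb.measure_lt_top
  -- The datum is replaced by a strongly measurable representative; both the Dirichlet classes and
  -- the admissible class depend on it only up to null sets.
  obtain ⟨g', hg'm, hgg'⟩ := hg.aestronglyMeasurable
  have hadm : NonlocalGamma.admissible Ω p g A = NonlocalGamma.admissible Ω p g' A := by
    ext u
    exact ⟨NonlocalGamma.admissible_of_ae_eq hp hAΩ hAo hAf hΩo.measurableSet hgg' EventuallyEq.rfl,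
      NonlocalGamma.admissible_of_ae_eq hp hAΩ hAo hAf hΩo.measurableSet hgg'.symm EventuallyEq.rfl⟩
  simp only [NonlocalGamma.dirichletClass_congr hgg', hadm]
  exact NonlocalGamma.convergence_of_minima hd hp hΩo.measurableSet hΩb hAΩ hAo hf hε hε0 hΓ
    (hg.congr hgg') hg'm hr
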